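/- Let $d\in\mathbf N$, $s>1$ and $t>0$. Notation. $\Sigma_t^s(\mathbf R^d)$ is the (Beurling type) Gelfand–Shilov space of all $f\in C^\infty(\mathbf R^d)$ such that $\sup_{\alpha,\beta,x} |x^\alpha\partial^\beta f(x)|/(h^{|\alpha+\beta|}\alpha!^t\beta!^s)<\infty$ for every $h>0$, with the topology given by these norms, and $(\Sigma_t^s)'(\mathbf R^d)$ is its topological dual. $G_c^s(\mathbf R^d)$ is the space of compactly supported $f\in C^\infty(\mathbf R^d)$ such that $\sup_{\alpha,x}|\partial^\alpha f(x)|/(h^{|\alpha|}\alpha!^s)<\infty$ for every $h>0$; $\mathscr D_s'(\mathbf R^d)$ is its topological dual (the linear functionals that are continuous on the test functions supported in any fixed compact set), and $\mathscr E_s'(\mathbf R^d)\subseteq \mathscr D_s'(\mathbf R^d)$ is the subspace of ultradistributions of compact support. Thus $\mathscr E_s'\subseteq(\Sigma_t^s)'\subseteq\mathscr D_s'$. The Fourier transform is $\widehat f(\xi)=(2\pi)^{-d/2}\int f(x)e^{-i\langle x,\xi\rangle}\,dx$, extended to $(\Sigma_t^s)'(\mathbf R^d)$ by duality. For $v \in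 \mathscr D_s'(\mathbf R^d)$ and $\varphi\in G_c^s(\mathbf R^d)$, $\widehat{\varphi v}(\xi)=(2\pi)^{-d/2}\langle v,\varphi e^{-i\langle\cdot,\xi\rangle}\rangle$. A conic set is one that is invariant under multiplication by positive scalars. * For $u\in(\Sigma_t^s)'(\mathbf R^d)$ and a window $\psi\in\Sigma_t^s(\mathbf R^d)\setminus 0$ put $V_\psi u(x,\xi)=(2\pi)^{-d/2}\langle u, e^{-i\langle\cdot,\xi\rangle}\,\overline{\psi(\cdot-x)}\rangle$. A point $(x_0,\xi_0)\in \mathbf R^{2d}\setminus 0$ is not in $\mathrm{WF}^{t,s}(u)\subseteq\mathbf R^{2d}\setminus0$ if there is an open set $U\subseteq\mathbf R^{2d}\setminus 0$ containing $(x_0,\xi_0)$ such that $\sup_{\lambda>0,\,(x,\xi)\in U}e^{r\lambda}|V_\psi u(\lambda^tx,\lambda^s\xi)|<\infty$ for all $r>0$. * For $v\in\mathscr D_s'(\mathbf R^d)$, a point $(x_0,\xi_0)\in\mathbf R^d\times(\mathbf R^d\setminus0)$ is not in the Gevrey wave front set $\mathrm{WF}_s(v)\subseteq\mathbf R^d\times(\mathbf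 R^d\setminus0)$ if there are $\varphi\in G_c^s(\mathbf R^d)$ with $\varphi(x_0)=1$ and an open conic set $\Gamma\subseteq\mathbf R^d\setminus0$ containing $\xi_0$ such that $\sup_{\xi\in\Gamma}e^{r|\xi|^{1/s}}|\widehat{\varphi v}(\xi)|<\infty$ for all $r>0$. * For $u\in\mathscr E_s'(\mathbf R^d)+\Sigma_t^s(\mathbf R^d)$, whose Fourier transform is a continuous function, a point $\eta\in\mathbf R^d\setminus0$ is not in $V_s(u)\subseteq\mathbf R^d\setminus0$ if there is an open conic set $\Gamma\subseteq\mathbf R^d\setminus0$ containing $\eta$ such that $\sup_{\xi\in\Gamma}e^{r|\xi|^{1/s}}|\widehat u(\xi)|<\infty$ for all $r>0$. Statement. Let $u\in\mathscr E_s'(\mathbf R^d)+\Sigma_t^s(\mathbf R^d)$ and let $\pi_2(x,\xi)=\xi$. Then, for every choice of the window $\psi\in\Sigma_t^s(\mathbf R^d)\setminus0$ in the definition of $\mathrm{WF}^{t,s}(u)$, $$\mathrm{WF}^{t,s}(u)\subseteq\{0\}\times\pi_2\,\mathrm{WF}_s(u).$$ If moreover $t\geqslant s$, then $$\mathrm{WF}^{t,s}(u)=\{0\}\times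 V_s(u).$$ -/

import Mathlib

open scoped Nat ContDiff ComplexConjugate

noncomputable section

namespace GelfandShilov

/-- The Euclidean space `ℝᵈ`. -/
abbrev Rd (d : ℕ) : Type := EuclideanSpace ℝ (Fin d)

/-- `‖f‖ ≤ M` for the Gelfand-Shilov norm with parameter `h`:
`sup |x|ᵏ |Dⁿ f(x)| / (hᵏ⁺ⁿ k!ᵗ n!ˢ) ≤ M`, with `Dⁿ f(x)` the `n`-th Fréchet derivative.
As `|α|! ≤ d^|α| α!` and `α! ≤ |α|!`, the coordinate norms
`sup |x^α D^β f(x)| / (h^|α+β| α!ᵗ β!ˢ)` define the same space and the same topology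
when `h` ranges over all positive numbers. -/
def NormLE {d : ℕ} (t s h M : ℝ) (f : Rd d → ℂ) : Prop :=
  ∀ (k n : ℕ) (x : Rd d),
    ‖x‖ ^ k * ‖iteratedFDeriv ℝ n f x‖ ≤ M * (h ^ (k + n) * ((k ! : ℝ) ^ t * (n ! : ℝ) ^ s))

/-- `‖f‖ ≤ M` for the Gevrey norm with parameter `h`: `sup |Dⁿ f(x)| / (hⁿ n!ˢ) ≤ M`. -/
def GevreyNormLE {d : ℕ} (s h M : ℝ) (f : Rd d → ℂ) : Prop :=
  ∀ (n : ℕ) (x : Rd d), ‖iteratedFDeriv ℝ n f x‖ ≤ M * (h ^ n * (n ! : ℝ) ^ s)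

section Helpers

variable {d : ℕ} {s t h M N : ℝ} {f g : Rd d → ℂ}

lemma NormLE.nonneg (hf : NormLE t s h M f) : 0 ≤ M := by
  have := hf 0 0 0
  simp at this
  exact (norm_nonneg _).trans this

lemma GevreyNormLE.nonneg (hf : GevreyNormLE s h M f) : 0 ≤ M := by
  have := hf 0 0
  simp at this
  exact (norm_nonneg _).trans this

lemma NormLE.add (hfc : ContDiff ℝ ∞ f) (hgc : ContDiff ℝ ∞ g)
    (hf : NormLE t s h M f) (hg : NormLE t s h N g) : NormLE t s h (M + N) (f + g) := by
  intro k n x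
  have e : iteratedFDeriv ℝ n (f + g) x = iteratedFDeriv ℝ n f x + iteratedFDeriv ℝ n g x :=
    iteratedFDeriv_add_apply ((hfc.of_le (mod_cast le_top)).contDiffAt)
      ((hgc.of_le (mod_cast le_top)).contDiffAt)
  rw [e]
  have h1 := hf k n x
  have h2 := hg k n x
  have h3 := mul_le_mul_of_nonneg_left
    (norm_add_le (iteratedFDeriv ℝ n f x) (iteratedFDeriv ℝ n g x))
    (pow_nonneg (norm_nonneg x) k)
  linarith

lemma GevreyNormLE.add (hfc : ContDiff ℝ ∞ f) (hgc : ContDiff ℝ ∞ g)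
    (hf : GevreyNormLE s h M f) (hg : GevreyNormLE s h N g) :
    GevreyNormLE s h (M + N) (f + g) := by
  intro n x
  have e : iteratedFDeriv ℝ n (f + g) x = iteratedFDeriv ℝ n f x + iteratedFDeriv ℝ n g x :=
    iteratedFDeriv_add_apply ((hfc.of_le (mod_cast le_top)).contDiffAt)
      ((hgc.of_le (mod_cast le_top)).contDiffAt)
  rw [e]
  have h1 := hf n x
  have h2 := hg n x
  have h3 := norm_add_le (iteratedFDeriv ℝ n f x) (iteratedFDeriv ℝ n g x)
  linarith

lemma NormLE.smul (c : ℂ) (hfc : ContDiff ℝ ∞ f) (hf : NormLE t s h M f) :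
    NormLE t s h (‖c‖ * M) (c • f) := by
  intro k n x
  have e : iteratedFDeriv ℝ n (c • f) x = c • iteratedFDeriv ℝ n f x :=
    iteratedFDeriv_const_smul_apply ((hfc.of_le (mod_cast le_top)).contDiffAt)
  rw [e, norm_smul]
  have h1 := mul_le_mul_of_nonneg_left (hf k n x) (norm_nonneg c)
  linarith

lemma GevreyNormLE.smul (c : ℂ) (hfc : ContDiff ℝ ∞ f) (hf : GevreyNormLE s h M f) :
    GevreyNormLE s h (‖c‖ * M) (c • f) := by
  intro n x
  have e : iteratedFDeriv ℝ n (c • f) x = c • iteratedFDeriv ℝ n f x :=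
    iteratedFDeriv_const_smul_apply ((hfc.of_le (mod_cast le_top)).contDiffAt)
  rw [e, norm_smul]
  have h1 := mul_le_mul_of_nonneg_left (hf n x) (norm_nonneg c)
  linarith

lemma iteratedFDeriv_zero_fun' (n : ℕ) (x : Rd d) :
    iteratedFDeriv ℝ n (0 : Rd d → ℂ) x = 0 := by
  have : (0 : Rd d → ℂ) = fun _ => 0 := rfl
  rw [this, iteratedFDeriv_fun_zero]
  rfl

/-- Powers are dominated by `hᵏ k!ᵗ`, for every `h, t > 0`. -/
lemma exists_pow_le {a : ℝ} (ha : 0 ≤ a) (hh : 0 < h) (ht : 0 < t) :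
    ∃ C : ℝ, 0 ≤ C ∧ ∀ k : ℕ, a ^ k ≤ C * (h ^ k * (k ! : ℝ) ^ t) := by
  set b : ℝ := (a / h) ^ (t⁻¹) with hb
  have hb0 : 0 ≤ b := Real.rpow_nonneg (div_nonneg ha hh.le) _
  refine ⟨Real.exp b ^ t, by positivity, fun k => ?_⟩
  have h1 : b ^ k ≤ (k ! : ℝ) * Real.exp b := by
    have := Real.pow_div_factorial_le_exp b hb0 k
    rwa [div_le_iff₀ (by positivity), mul_comm] at this
  have h2 : (b ^ k) ^ t = (a / h) ^ k := by
    rw [← Real.rpow_natCast, ← Real.rpow_mul hb0, mul_comm, Real.rpow_mul hb0, hb,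
      ← Real.rpow_mul (div_nonneg ha hh.le), inv_mul_cancel₀ ht.ne', Real.rpow_one,
      Real.rpow_natCast]
  have h3 : (a / h) ^ k ≤ ((k ! : ℝ) * Real.exp b) ^ t := by
    rw [← h2]
    exact Real.rpow_le_rpow (by positivity) h1 ht.le
  rw [Real.mul_rpow (by positivity) (by positivity), div_pow, div_le_iff₀ (by positivity)] at h3
  linarith

/-- The character `x ↦ e^{-i⟨x, ξ⟩}`. -/
def char (ξ : Rd d) (x : Rd d) : ℂ := Complex.exp (-Complex.I * (inner ℝ x ξ : ℝ))

lemma char_eq (ξ : Rd d) :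
    char ξ = (fun y : ℝ => Complex.exp (-Complex.I * (y : ℂ))) ∘ (innerSL ℝ ξ) := by
  funext x
  simp [char, real_inner_comm]

lemma contDiff_cexp_aux : ContDiff ℝ ∞ (fun y : ℝ => Complex.exp (-Complex.I * (y : ℂ))) :=
  (contDiff_const.mul Complex.ofRealCLM.contDiff).cexp

lemma contDiff_char (ξ : Rd d) : ContDiff ℝ ∞ (char ξ) := by
  rw [char_eq]
  exact contDiff_cexp_aux.comp (innerSL ℝ ξ).contDiff

lemma iteratedDeriv_cexp_aux (n : ℕ) :
    iteratedDeriv n (fun y : ℝ => Complex.exp (-Complex.I * (y : ℂ))) =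
      fun y : ℝ => (-Complex.I) ^ n * Complex.exp (-Complex.I * (y : ℂ)) := by
  induction n with
  | zero => simp
  | succ n ih =>
    rw [iteratedDeriv_succ, ih]
    funext y
    have h1 : HasDerivAt (fun y : ℝ => Complex.exp (-Complex.I * (y : ℂ)))
        (Complex.exp (-Complex.I * (y : ℂ)) * (-Complex.I * 1)) y :=
      ((Complex.ofRealCLM.hasDerivAt (x := y)).const_mul (-Complex.I)).cexp
    rw [(h1.const_mul ((-Complex.I) ^ n)).deriv]
    ring

lemma norm_iteratedFDeriv_char_le (ξ x : Rd d) (n : ℕ) :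
    ‖iteratedFDeriv ℝ n (char ξ) x‖ ≤ ‖ξ‖ ^ n := by
  rw [char_eq, ContinuousLinearMap.iteratedFDeriv_comp_right _ contDiff_cexp_aux x
    (i := n) (mod_cast le_top)]
  refine (ContinuousMultilinearMap.norm_compContinuousLinearMap_le _ _).trans ?_
  rw [norm_iteratedFDeriv_eq_norm_iteratedDeriv, iteratedDeriv_cexp_aux]
  have : ‖Complex.exp (-Complex.I * ((innerSL ℝ ξ x : ℝ) : ℂ))‖ = 1 := by
    rw [Complex.norm_exp]; simp
  rw [norm_mul, this]
  simp [innerSL_apply_norm]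

/-- Multiplication by a character, at one point: the bounds survive with `2h` in place of `h`. -/
lemma char_mul_bound (hs : 0 < s) (hh : 0 < h) (ξ : Rd d) :
    ∃ C : ℝ, 0 ≤ C ∧ ∀ (f : Rd d → ℂ), ContDiff ℝ ∞ f → ∀ (a A : ℝ) (x : Rd d), 0 ≤ a → 0 ≤ A →
      (∀ n : ℕ, a * ‖iteratedFDeriv ℝ n f x‖ ≤ A * (h ^ n * (n ! : ℝ) ^ s)) →
      ∀ n : ℕ, a * ‖iteratedFDeriv ℝ n (fun y => char ξ y * f y) x‖ ≤
        C * A * ((2 * h) ^ n * (n ! : ℝ) ^ s) := by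
  obtain ⟨C, hC, hCb⟩ := exists_pow_le (norm_nonneg ξ) hh hs
  refine ⟨C, hC, fun f hfc a A x ha hA hb n => ?_⟩
  have h1 := norm_iteratedFDeriv_mul_le (N := ∞) (contDiff_char ξ) hfc x (n := n)
    (mod_cast le_top)
  have h2 : ∀ i ∈ Finset.range (n + 1),
      a * ((n.choose i : ℝ) * ‖iteratedFDeriv ℝ i (char ξ) x‖ *
        ‖iteratedFDeriv ℝ (n - i) f x‖) ≤ (n.choose i : ℝ) * (C * A * (h ^ n * (n ! : ℝ) ^ s)) := by
    intro i hi
    have hin : i ≤ n := Nat.lt_succ_iff.mp (Finset.mem_range.mp hi)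
    have e1 : ‖iteratedFDeriv ℝ i (char ξ) x‖ ≤ C * (h ^ i * (i ! : ℝ) ^ s) :=
      (norm_iteratedFDeriv_char_le ξ x i).trans (hCb i)
    have e2 := hb (n - i)
    have e3 : ((i ! : ℝ) ^ s) * (((n - i)! : ℕ) : ℝ) ^ s ≤ (n ! : ℝ) ^ s := by
      rw [← Real.mul_rpow (by positivity) (by positivity)]
      refine Real.rpow_le_rpow (by positivity) ?_ hs.le
      exact_mod_cast Nat.le_of_dvd (Nat.factorial_pos n)
        (Nat.factorial_mul_factorial_dvd_factorial hin)
    have e4 : h ^ i * h ^ (n - i) = h ^ n := by rw [← pow_add, Nat.add_sub_cancel' hin]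
    have e5 := mul_le_mul e1 e2 (by positivity) (by positivity)
    have e6 : C * (h ^ i * (i ! : ℝ) ^ s) * (A * (h ^ (n - i) * (((n - i)! : ℕ) : ℝ) ^ s)) =
        C * A * h ^ n * (((i ! : ℝ) ^ s) * (((n - i)! : ℕ) : ℝ) ^ s) := by
      rw [← e4]; ring
    have e7 : C * A * h ^ n * (((i ! : ℝ) ^ s) * (((n - i)! : ℕ) : ℝ) ^ s) ≤
        C * A * h ^ n * (n ! : ℝ) ^ s := mul_le_mul_of_nonneg_left e3 (by positivity)
    have e8 : ‖iteratedFDeriv ℝ i (char ξ) x‖ * (a * ‖iteratedFDeriv ℝ (n - i) f x‖) ≤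
        C * A * (h ^ n * (n ! : ℝ) ^ s) := by
      rw [e6] at e5; linarith
    have e9 := mul_le_mul_of_nonneg_left e8 (Nat.cast_nonneg (α := ℝ) (n.choose i))
    linarith
  have h3 : ∑ i ∈ Finset.range (n + 1), (n.choose i : ℝ) = 2 ^ n := by
    exact_mod_cast Nat.sum_range_choose n
  calc a * ‖iteratedFDeriv ℝ n (fun y => char ξ y * f y) x‖
      ≤ a * ∑ i ∈ Finset.range (n + 1), (n.choose i : ℝ) * ‖iteratedFDeriv ℝ i (char ξ) x‖ *
        ‖iteratedFDeriv ℝ (n - i) f x‖ := mul_le_mul_of_nonneg_left h1 ha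
    _ ≤ ∑ i ∈ Finset.range (n + 1), (n.choose i : ℝ) * (C * A * (h ^ n * (n ! : ℝ) ^ s)) := by
        rw [Finset.mul_sum]; exact Finset.sum_le_sum h2
    _ = C * A * ((2 * h) ^ n * (n ! : ℝ) ^ s) := by
        rw [← Finset.sum_mul, h3, mul_pow]; ring

lemma NormLE.translate (ht : 0 < t) (hh : 0 < h) (y : Rd d) :
    ∃ C : ℝ, ∀ (f : Rd d → ℂ) (M : ℝ), NormLE t s h M f →
      NormLE t s (2 * h) (C * M) (fun z => f (z - y)) := by
  obtain ⟨C, hC, hCb⟩ := exists_pow_le (norm_nonneg y) hh ht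
  refine ⟨1 + C, fun f M hf k n x => ?_⟩
  have hM := hf.nonneg
  rw [iteratedFDeriv_comp_sub]
  set D := ‖iteratedFDeriv ℝ n f (x - y)‖ with hD
  have hD0 : 0 ≤ D := norm_nonneg _
  have h1 : ‖x‖ ^ k ≤ 2 ^ k * (‖x - y‖ ^ k + ‖y‖ ^ k) := by
    have e1 : ‖x‖ ≤ ‖x - y‖ + ‖y‖ := by
      simpa using norm_add_le (x - y) y
    refine (pow_le_pow_left₀ (norm_nonneg x) e1 k).trans ?_
    refine (add_pow_le (norm_nonneg _) (norm_nonneg _) k).trans ?_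
    refine mul_le_mul_of_nonneg_right ?_ (by positivity)
    exact pow_le_pow_right₀ one_le_two (Nat.sub_le k 1)
  have h2 := hf k n (x - y)
  have h3 := hf 0 n (x - y)
  rw [← hD] at h2 h3
  simp only [pow_zero, one_mul, zero_add, Nat.factorial_zero, Nat.cast_one, Real.one_rpow] at h3
  have h4 := mul_le_mul (hCb k) h3 hD0 (by positivity)
  have h5 : ‖x‖ ^ k * D ≤ 2 ^ k * ((1 + C) * M * (h ^ (k + n) * ((k ! : ℝ) ^ t * (n ! : ℝ) ^ s))) := by
    have := mul_le_mul_of_nonneg_right h1 hD0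
    refine this.trans ?_
    rw [mul_assoc]
    refine mul_le_mul_of_nonneg_left ?_ (by positivity)
    rw [pow_add] at h2 ⊢
    linarith
  refine h5.trans ?_
  have h6 : (2 : ℝ) ^ k ≤ 2 ^ (k + n) := pow_le_pow_right₀ one_le_two (Nat.le_add_right k n)
  have h7 := mul_le_mul_of_nonneg_right h6
    (show 0 ≤ (1 + C) * M * (h ^ (k + n) * ((k ! : ℝ) ^ t * (n ! : ℝ) ^ s)) by positivity)
  refine h7.trans (le_of_eq ?_)
  rw [mul_pow]
  ring

lemma norm_iteratedFDeriv_conj (f : Rd d → ℂ) (n : ℕ) (x : Rd d) :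
    ‖iteratedFDeriv ℝ n (fun y => conj (f y)) x‖ = ‖iteratedFDeriv ℝ n f x‖ :=
  LinearIsometryEquiv.norm_iteratedFDeriv_comp_left Complex.conjLIE f x n

lemma contDiff_conj (hf : ContDiff ℝ ∞ f) : ContDiff ℝ ∞ (fun y => conj (f y)) :=
  Complex.conjCLE.contDiff.comp hf

end Helpers

/-! ### Test functions -/

/-- The Beurling type Gelfand-Shilov space `Σ_t^s(ℝᵈ)`: the smooth functions all of whose
norms, for all `h > 0`, are finite. -/
def Sig (d : ℕ) (t s : ℝ) : Submodule ℂ (Rd d → ℂ) where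
  carrier := {f | ContDiff ℝ ∞ f ∧ ∀ h : ℝ, 0 < h → ∃ M : ℝ, NormLE t s h M f}
  add_mem' := by
    rintro f g ⟨hf, hf'⟩ ⟨hg, hg'⟩
    refine ⟨hf.add hg, fun h hh => ?_⟩
    obtain ⟨M, hM⟩ := hf' h hh
    obtain ⟨N, hN⟩ := hg' h hh
    exact ⟨M + N, hM.add hf hg hN⟩
  zero_mem' := by
    refine ⟨contDiff_const, fun h hh => ⟨0, fun k n x => ?_⟩⟩
    rw [iteratedFDeriv_zero_fun']
    simp
  smul_mem' := by
    rintro c f ⟨hf, hf'⟩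
    refine ⟨contDiff_const.smul hf, fun h hh => ?_⟩
    obtain ⟨M, hM⟩ := hf' h hh
    exact ⟨‖c‖ * M, hM.smul c hf⟩

/-- The space `G_c^s(ℝᵈ)` of compactly supported Gevrey functions of order `s`, of Beurling type:
for every `h > 0` there is `C` with `|Dⁿ f| ≤ C hⁿ n!ˢ`. As `f` has compact support, asking for
this on each compact set and asking for it on `ℝᵈ` is the same. -/
def GevreyC (d : ℕ) (s : ℝ) : Submodule ℂ (Rd d → ℂ) where
  carrier := {f | ContDiff ℝ ∞ f ∧ HasCompactSupport f ∧
    ∀ h : ℝ, 0 < h → ∃ M : ℝ, GevreyNormLE s h M f}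
  add_mem' := by
    rintro f g ⟨hf, hfc, hf'⟩ ⟨hg, hgc, hg'⟩
    refine ⟨hf.add hg, hfc.add hgc, fun h hh => ?_⟩
    obtain ⟨M, hM⟩ := hf' h hh
    obtain ⟨N, hN⟩ := hg' h hh
    exact ⟨M + N, hM.add hf hg hN⟩
  zero_mem' := by
    refine ⟨contDiff_const, HasCompactSupport.zero, fun h hh => ⟨0, fun n x => ?_⟩⟩
    rw [iteratedFDeriv_zero_fun']
    simp
  smul_mem' := by
    rintro c f ⟨hf, hfc, hf'⟩
    refine ⟨contDiff_const.smul hf, hfc.smul_left (f := fun _ => c), fun h hh => ?_⟩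
    obtain ⟨M, hM⟩ := hf' h hh
    exact ⟨‖c‖ * M, hM.smul c hf⟩

section Operations

variable {d : ℕ} {s t : ℝ}

/-- `y ↦ e^{-i⟨y, ξ⟩} ϕ(y)` as an element of `G_c^s`. -/
def GevreyC.mulChar (hs : 0 < s) (ϕ : GevreyC d s) (ξ : Rd d) : GevreyC d s :=
  ⟨fun y => char ξ y * ϕ.1 y, by
    refine ⟨(contDiff_char ξ).mul ϕ.2.1, ϕ.2.2.1.mul_left, fun h hh => ?_⟩
    obtain ⟨C, hC, hCb⟩ := char_mul_bound (h := h / 2) hs (by positivity) ξ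
    obtain ⟨M, hM⟩ := ϕ.2.2.2 (h / 2) (by positivity)
    refine ⟨C * M, fun n x => ?_⟩
    have := hCb ϕ.1 ϕ.2.1 1 M x zero_le_one hM.nonneg (fun n => by simpa using hM n x) n
    rw [one_mul, mul_div_cancel₀ h two_ne_zero] at this
    exact this⟩

/-- `y ↦ e^{-i⟨y, ξ⟩} ψ(y)` as an element of `Σ_t^s`. -/
def Sig.mulChar (hs : 0 < s) (ψ : Sig d t s) (ξ : Rd d) : Sig d t s :=
  ⟨fun y => char ξ y * ψ.1 y, by
    refine ⟨(contDiff_char ξ).mul ψ.2.1, fun h hh => ?_⟩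
    obtain ⟨C, hC, hCb⟩ := char_mul_bound (h := h / 2) hs (by positivity) ξ
    obtain ⟨M, hM⟩ := ψ.2.2 (h / 2) (by positivity)
    have hM0 := hM.nonneg
    refine ⟨C * M, fun k n x => ?_⟩
    have := hCb ψ.1 ψ.2.1 (‖x‖ ^ k) (M * ((h / 2) ^ k * (k ! : ℝ) ^ t)) x (by positivity)
      (by positivity) (fun n => (hM k n x).trans (le_of_eq (by rw [pow_add]; ring))) n
    rw [mul_div_cancel₀ h two_ne_zero] at this
    refine this.trans ?_
    have e : (h / 2) ^ k ≤ h ^ k := pow_le_pow_left₀ (by positivity) (by linarith) k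
    have e2 := mul_le_mul_of_nonneg_right e
      (show 0 ≤ C * M * (k ! : ℝ) ^ t * (h ^ n * (n ! : ℝ) ^ s) by positivity)
    rw [pow_add]
    linarith⟩

/-- The translate `y ↦ ψ(y - x)` as an element of `Σ_t^s`. -/
def Sig.translate (ht : 0 < t) (ψ : Sig d t s) (x : Rd d) : Sig d t s :=
  ⟨fun y => ψ.1 (y - x), by
    refine ⟨ψ.2.1.comp (contDiff_id.sub contDiff_const), fun h hh => ?_⟩
    obtain ⟨C, hC⟩ := NormLE.translate (s := s) (h := h / 2) ht (by positivity) x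
    obtain ⟨M, hM⟩ := ψ.2.2 (h / 2) (by positivity)
    have := hC ψ.1 M hM
    rw [mul_div_cancel₀ h two_ne_zero] at this
    exact ⟨C * M, this⟩⟩

/-- The complex conjugate as an element of `Σ_t^s`. -/
def Sig.conj (ψ : Sig d t s) : Sig d t s :=
  ⟨fun y => (starRingEnd ℂ) (ψ.1 y), by
    refine ⟨contDiff_conj ψ.2.1, fun h hh => ?_⟩
    obtain ⟨M, hM⟩ := ψ.2.2 h hh
    exact ⟨M, fun k n x => by rw [norm_iteratedFDeriv_conj]; exact hM k n x⟩⟩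

/-- On functions supported in a fixed compact set the Gevrey norms dominate the
Gelfand-Shilov norms. -/
lemma exists_normLE_of_gevreyNormLE (ht : 0 < t) {h : ℝ} (hh : 0 < h) {K : Set (Rd d)}
    (hK : IsCompact K) :
    ∃ C : ℝ, 0 ≤ C ∧ ∀ (f : Rd d → ℂ) (M : ℝ), tsupport f ⊆ K → GevreyNormLE s h M f →
      NormLE t s h (C * M) f := by
  obtain ⟨R, hR⟩ := hK.isBounded.exists_norm_le
  obtain ⟨C, hC, hCb⟩ := exists_pow_le (abs_nonneg R) hh ht
  refine ⟨C, hC, fun f M hfK hf k n x => ?_⟩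
  have hM := hf.nonneg
  by_cases hx : x ∈ K
  · have h1 : ‖x‖ ^ k ≤ C * (h ^ k * (k ! : ℝ) ^ t) :=
      (pow_le_pow_left₀ (norm_nonneg x) ((hR x hx).trans (le_abs_self R)) k).trans (hCb k)
    have h2 := mul_le_mul h1 (hf n x) (norm_nonneg _) (by positivity)
    refine h2.trans (le_of_eq ?_)
    rw [pow_add]; ring
  · have h1 : iteratedFDeriv ℝ n f x = 0 := by
      by_contra hne
      exact hx (hfK (support_iteratedFDeriv_subset n (Function.mem_support.mpr hne)))
    rw [h1, norm_zero, mul_zero]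
    positivity

lemma gevreyC_le_sig (ht : 0 < t) : GevreyC d s ≤ Sig d t s := by
  rintro f ⟨hf, hfc, hb⟩
  refine ⟨hf, fun h hh => ?_⟩
  obtain ⟨M, hM⟩ := hb h hh
  obtain ⟨C, -, hC⟩ := exists_normLE_of_gevreyNormLE (s := s) ht hh hfc
  exact ⟨C * M, hC f M subset_rfl hM⟩

end Operations

/-! ### Ultradistributions

Ultradistributions act linearly, `⟨u, ϕ⟩`; the action that is conjugate linear in the test
function is `(u, ϕ) = ⟨u, conj ϕ⟩`. -/

/-- The space `(Σ_t^s)'(ℝᵈ)`: linear functionals on `Σ_t^s` that are continuous, i.e. bounded by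
a multiple of the norm with parameter `h` for some `h > 0` (these norms define the topology and
increase as `h` decreases). -/
structure SigDual (d : ℕ) (t s : ℝ) where
  toLin : Sig d t s →ₗ[ℂ] ℂ
  bounded : ∃ h : ℝ, 0 < h ∧ ∃ C : ℝ, ∀ (f : Sig d t s) (M : ℝ),
    NormLE t s h M f.1 → ‖toLin f‖ ≤ C * M

/-- The space `D_s'(ℝᵈ)` of Gevrey ultradistributions of order `s`: linear functionals on `G_c^s`
whose restrictions to the test functions supported in `K` are continuous, for all compact `K`. -/
structure GevreyDual (d : ℕ) (s : ℝ) where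
  toLin : GevreyC d s →ₗ[ℂ] ℂ
  bounded : ∀ K : Set (Rd d), IsCompact K → ∃ h : ℝ, 0 < h ∧ ∃ C : ℝ,
    ∀ (f : GevreyC d s) (M : ℝ), tsupport f.1 ⊆ K → GevreyNormLE s h M f.1 → ‖toLin f‖ ≤ C * M

section Dual

variable {d : ℕ} {s t : ℝ}

/-- The embedding `(Σ_t^s)' ⊆ D_s'`: restriction to `G_c^s ⊆ Σ_t^s`. -/
def SigDual.toGevreyDual (ht : 0 < t) (u : SigDual d t s) : GevreyDual d s where
  toLin := u.toLin ∘ₗ Submodule.inclusion (gevreyC_le_sig ht)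
  bounded := by
    intro K hK
    obtain ⟨h, hh, C, hC⟩ := u.bounded
    obtain ⟨C', -, hC'⟩ := exists_normLE_of_gevreyNormLE (s := s) ht hh hK
    refine ⟨h, hh, C * C', fun f M hfK hf => ?_⟩
    have := hC (Submodule.inclusion (gevreyC_le_sig ht) f) (C' * M) (hC' f.1 M hfK hf)
    rw [mul_assoc]
    exact this

/-- `v ∈ D_s'` has compact support, i.e. `v ∈ E_s'`: it vanishes on the complement of some
compact set. -/
def GevreyDual.CompactlySupported (v : GevreyDual d s) : Prop :=
  ∃ K : Set (Rd d), IsCompact K ∧ ∀ ϕ : GevreyC d s, tsupport ϕ.1 ⊆ Kᶜ → v.toLin ϕ = 0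

/-- `u ∈ E_s' + Σ_t^s`, as subspaces of `D_s'`: `u = v + w` with `v ∈ E_s'` and `w ∈ Σ_t^s`,
where `w` acts by integration. -/
def SigDual.MemCompactAddSig (ht : 0 < t) (u : SigDual d t s) : Prop :=
  ∃ v : GevreyDual d s, v.CompactlySupported ∧ ∃ w : Sig d t s, ∀ ϕ : GevreyC d s,
    (u.toGevreyDual ht).toLin ϕ = v.toLin ϕ + ∫ x, w.1 x * ϕ.1 x

/-- The normalizing factor `(2π)^{-d/2}`. -/
def fourierConst (d : ℕ) : ℂ := (((2 * Real.pi) ^ (-(d : ℝ) / 2) : ℝ) : ℂ)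

/-- The inverse Fourier transform `(2π)^{-d/2} ∫ f(x) e^{i⟨x, ξ⟩} dx`. -/
def fourierInv (f : Rd d → ℂ) (ξ : Rd d) : ℂ :=
  fourierConst d * ∫ x, f x * Complex.exp (Complex.I * (inner ℝ x ξ : ℝ))

/-- The Fourier transform of `u ∈ (Σ_t^s)'`, defined by `⟨û, χ⟩ = ⟨u, χ̂⟩`, is the continuous
function `g`. Here `χ̂ = ϕ` runs through `Σ_t^s`, so that `χ` is the inverse Fourier transform
of `ϕ`. -/
def SigDual.HasFourierTransform (u : SigDual d t s) (g : Rd d → ℂ) : Prop :=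
  Continuous g ∧ ∀ ϕ : Sig d t s,
    MeasureTheory.Integrable (fun ξ => g ξ * fourierInv ϕ.1 ξ) ∧
      u.toLin ϕ = ∫ ξ, g ξ * fourierInv ϕ.1 ξ

/-- The short-time Fourier transform
`V_ψ u(x, ξ) = (2π)^{-d/2} (u, M_ξ T_x ψ) = (2π)^{-d/2} ⟨u, e^{-i⟨·, ξ⟩} conj ψ(· - x)⟩`. -/
def SigDual.stft (ht : 0 < t) (hs : 0 < s) (u : SigDual d t s) (ψ : Sig d t s)
    (x ξ : Rd d) : ℂ :=
  fourierConst d * u.toLin (Sig.mulChar hs (Sig.translate ht (Sig.conj ψ) x) ξ)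

/-- The Fourier transform of the compactly supported ultradistribution `ϕ v`,
`(ϕ v)^(ξ) = (2π)^{-d/2} ⟨v, ϕ e^{-i⟨·, ξ⟩}⟩`, for `v ∈ D_s'` and `ϕ ∈ G_c^s`. -/
def GevreyDual.localFourier (hs : 0 < s) (v : GevreyDual d s) (ϕ : GevreyC d s)
    (ξ : Rd d) : ℂ :=
  fourierConst d * v.toLin (GevreyC.mulChar hs ϕ ξ)

/-- Open conic subsets of `ℝᵈ \ 0`. -/
def IsOpenConic (Γ : Set (Rd d)) : Prop :=
  IsOpen Γ ∧ (0 : Rd d) ∉ Γ ∧ ∀ ξ ∈ Γ, ∀ a : ℝ, 0 < a → a • ξ ∈ Γ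

/-- `sup_{ξ ∈ Γ} e^{r |ξ|^{1/s}} |g(ξ)| < ∞` for all `r > 0`. -/
def DecaysOn (s : ℝ) (g : Rd d → ℂ) (Γ : Set (Rd d)) : Prop :=
  ∀ r : ℝ, 0 < r → ∃ C : ℝ, ∀ ξ ∈ Γ, Real.exp (r * ‖ξ‖ ^ (1 / s)) * ‖g ξ‖ ≤ C

/-- The Gevrey wave front set `WF_s(v) ⊆ ℝᵈ × (ℝᵈ \ 0)` of `v ∈ D_s'`. -/
def GevreyDual.waveFront (hs : 0 < s) (v : GevreyDual d s) : Set (Rd d × Rd d) :=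
  {p | p.2 ≠ 0 ∧ ¬ ∃ ϕ : GevreyC d s, ϕ.1 p.1 = 1 ∧
    ∃ Γ : Set (Rd d), IsOpenConic Γ ∧ p.2 ∈ Γ ∧ DecaysOn s (v.localFourier hs ϕ) Γ}

/-- The set `V_s(u) ⊆ ℝᵈ \ 0` of directions in which `û` does not decay. -/
def SigDual.singularDirections (u : SigDual d t s) : Set (Rd d) :=
  {η | η ≠ 0 ∧ ¬ ∃ g : Rd d → ℂ, u.HasFourierTransform g ∧
    ∃ Γ : Set (Rd d), IsOpenConic Γ ∧ η ∈ Γ ∧ DecaysOn s g Γ}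

/-- The `t,s`-Gelfand-Shilov wave front set `WF^{t,s}(u) ⊆ T*ℝᵈ \ 0`, computed with the
window `ψ`. -/
def SigDual.waveFront (ht : 0 < t) (hs : 0 < s) (ψ : Sig d t s) (u : SigDual d t s) :
    Set (Rd d × Rd d) :=
  {p | p ≠ 0 ∧ ¬ ∃ U : Set (Rd d × Rd d), IsOpen U ∧ (0 : Rd d × Rd d) ∉ U ∧ p ∈ U ∧
    ∀ r : ℝ, 0 < r → ∃ C : ℝ, ∀ l : ℝ, 0 < l → ∀ z ∈ U,
      Real.exp (r * l) * ‖u.stft ht hs ψ (l ^ t • z.1) (l ^ s • z.2)‖ ≤ C}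

end Dual

end GelfandShilov

end

noncomputable section

namespace GelfandShilov

/-! ### Elementary inequalities -/

/-! Write `u = χv + w` with `w ∈ Σ_t^s`, `v` compactly supported and `χ` a Gevrey cutoff equal to
`1` near a compact set outside of which `v` vanishes; such cutoffs exist because `s > 1`. Then `û`
is the explicit continuous function `g(η) = (2π)^{-d/2} ⟨v, χ e^{-i⟨·,η⟩}⟩ + ŵ(η)`, which grows at
most like `exp(r‖η‖^{1/s})` for some `r` (`hasFourierTransform_fourierSum`,
`moderateGrowth_fourierSum`). That `v` may be exchanged with Fourier integrals follows from
Hahn-Banach and Bochner integration (`map_integral_of_bounded`, `GevreyDual.cutoff_parseval`).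

Let `Ψ` be the inverse Fourier transform of `conj ψ`; it decays faster than every
`exp(-r‖·‖^{1/s})`. Up to a unimodular factor, `V_ψ u(x, ξ)` is the inverse Fourier transform at `x`
of `η ↦ g(η) Ψ(η - ξ)` (`SigDual.HasFourierTransform.stft_eq`), and Fourier inversion in `x`
recovers `g(η) Ψ(η - ξ)` from it (`SigDual.HasFourierTransform.mul_window_eq`).

Three facts follow. (1) `|V_ψ u(x, ξ)| ≤ C exp(r₀‖ξ‖^{1/s} - r‖x‖^{1/t})` with `r₀` fixed and `r`
arbitrary (`exists_norm_stft_le`). Along `(λ^t x, λ^s ξ)` both exponents are linear in `λ`, so the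
decay wins when `x ≠ 0`, and the wave front set lies over the origin. (2) If `g` decays on a cone
around `η₀`, its convolution with a rapidly decaying function decays on a smaller cone
(`IsOpenConic.exists_convolution_bound`), whence `(0, η₀)` is not in the wave front set. (3)
Conversely, if `(0, η₀)` is not in it, the transform decays for `‖x‖ < ε λ^t` by definition and for
larger `x` by (1); integrating over `x` gives decay of `g` on a cone. Facts (1)-(3) yield the
equality.

For the inclusion, suppose that no point over `η₀` lies in `WF_s(u)`. Finitely many localizing
functions `ϕ_x` have no common zero on the support of `χ`. Division is possible in the Gevrey class
(`inv_mem_gev`), so `χv = ∑ θ_x ϕ_x v` with Gevrey `θ_x`. Multiplication by `θ_x` is a convolution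
on the Fourier side, hence the convolution estimate gives decay of `g` near `η₀`, and (2) applies.
-/

lemma rpow_add_le_two_rpow {a b p : ℝ} (ha : 0 ≤ a) (hb : 0 ≤ b) (hp : 0 ≤ p) :
    (a + b) ^ p ≤ 2 ^ p * (a ^ p + b ^ p) := by
  have h1 : a + b ≤ 2 * max a b := by
    linarith [le_max_left a b, le_max_right a b]
  have h2 : (max a b) ^ p ≤ a ^ p + b ^ p := by
    rcases max_cases a b with ⟨h, -⟩ | ⟨h, -⟩ <;> rw [h] <;>
      linarith [Real.rpow_nonneg ha p, Real.rpow_nonneg hb p]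
  calc (a + b) ^ p ≤ (2 * max a b) ^ p := Real.rpow_le_rpow (by positivity) h1 hp
    _ = 2 ^ p * (max a b) ^ p := Real.mul_rpow (by norm_num) (by positivity)
    _ ≤ _ := mul_le_mul_of_nonneg_left h2 (by positivity)

/-- Powers are dominated by factorials times a stretched exponential. -/
lemma pow_le_exp_rpow {s h a : ℝ} (hs : 0 < s) (hh : 0 < h) (ha : 0 ≤ a) (n : ℕ) :
    a ^ n ≤ h ^ n * (n ! : ℝ) ^ s * Real.exp (s * (1 / h) ^ (1 / s) * a ^ (1 / s)) := by
  set b : ℝ := (a / h) ^ (1 / s) with hb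
  have hb0 : 0 ≤ b := Real.rpow_nonneg (div_nonneg ha hh.le) _
  have h1 : b ^ n ≤ (n ! : ℝ) * Real.exp b := by
    have := Real.pow_div_factorial_le_exp b hb0 n
    rwa [div_le_iff₀ (by positivity), mul_comm] at this
  have h2 : (b ^ n) ^ s = (a / h) ^ n := by
    rw [← Real.rpow_natCast, ← Real.rpow_mul hb0, mul_comm, Real.rpow_mul hb0, hb,
      ← Real.rpow_mul (div_nonneg ha hh.le), one_div_mul_cancel hs.ne', Real.rpow_one,
      Real.rpow_natCast]
  have h3 : (a / h) ^ n ≤ ((n ! : ℝ) * Real.exp b) ^ s := by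
    rw [← h2]
    exact Real.rpow_le_rpow (by positivity) h1 hs.le
  rw [Real.mul_rpow (by positivity) (by positivity), div_pow, div_le_iff₀ (by positivity),
    ← Real.exp_mul] at h3
  have h4 : b * s = s * (1 / h) ^ (1 / s) * a ^ (1 / s) := by
    rw [hb, div_eq_mul_one_div, Real.mul_rpow ha (by positivity)]; ring
  rw [h4] at h3
  linarith

/-- If all moments of `b` at `a` are dominated by `hⁿ n!ˢ` for a small enough `h`, then `b` has
stretched exponential decay in `a`. -/
lemma exists_le_exp_neg {s r : ℝ} (hs : 0 < s) (hr : 0 < r) :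
    ∃ h : ℝ, 0 < h ∧ ∀ a b C : ℝ, 0 ≤ a → 0 ≤ b → 0 ≤ C →
      (∀ n : ℕ, a ^ n * b ≤ C * (h ^ n * (n ! : ℝ) ^ s)) →
      b ≤ 2 ^ s * C * Real.exp (-(r * a ^ (1 / s))) := by
  -- The final exponent is `-(y / 2) * s = -(s / (2 * q)) * a ^ (1 / s)`; this `q` makes its rate
  -- equal to `r`.
  set q : ℝ := s / (2 * r) with hq
  have hq0 : 0 < q := by positivity
  refine ⟨q ^ s, by positivity, fun a b C ha hb hC H => ?_⟩
  set y : ℝ := a ^ (1 / s) / q with hy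
  have hy0 : 0 ≤ y := by positivity
  have hsi : 0 < 1 / s := by positivity
  have key : ∀ n : ℕ, b ^ (1 / s) * (y ^ n / n !) ≤ C ^ (1 / s) := by
    intro n
    have h1 := Real.rpow_le_rpow (by positivity) (H n) hsi.le
    have e : ∀ z : ℝ, 0 ≤ z → (z ^ n) ^ (1 / s) = (z ^ (1 / s)) ^ n := fun z hz => by
      rw [← Real.rpow_natCast, ← Real.rpow_mul hz, mul_comm, Real.rpow_mul hz, Real.rpow_natCast]
    have e2 : ∀ z : ℝ, 0 ≤ z → (z ^ s) ^ (1 / s) = z := fun z hz => by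
      rw [← Real.rpow_mul hz, mul_one_div_cancel hs.ne', Real.rpow_one]
    rw [Real.mul_rpow (by positivity) hb, Real.mul_rpow hC (by positivity),
      Real.mul_rpow (by positivity) (by positivity), e a ha, e _ (by positivity), e2 _ hq0.le,
      e2 _ (by positivity)] at h1
    rw [hy, div_pow, ← mul_div_assoc, ← mul_div_assoc, div_div, div_le_iff₀ (by positivity)]
    linarith
  have hsum : HasSum (fun n : ℕ => (1 / 2 : ℝ) ^ n) 2 := hasSum_geometric_two
  have hexp : HasSum (fun n : ℕ => b ^ (1 / s) * ((y / 2) ^ n / n !))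
      (b ^ (1 / s) * Real.exp (y / 2)) := by
    have := NormedSpace.expSeries_div_hasSum_exp (𝔸 := ℝ) (y / 2)
    rw [← Real.exp_eq_exp_ℝ] at this
    exact this.mul_left _
  -- Summing the moment bounds with weights `2⁻ⁿ` replaces the terms of `exp y` by those of `exp (y
  -- / 2)`, at the price of a factor `2`.
  have hle : b ^ (1 / s) * Real.exp (y / 2) ≤ C ^ (1 / s) * 2 := by
    refine hasSum_le (fun n => ?_) hexp (hsum.mul_left _)
    have := mul_le_mul_of_nonneg_right (key n) (show (0 : ℝ) ≤ (1 / 2) ^ n by positivity)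
    refine le_trans (le_of_eq ?_) this
    rw [div_pow y 2, div_pow 1 2, one_pow]; ring
  have h2 : b ^ (1 / s) ≤ C ^ (1 / s) * 2 * Real.exp (-(y / 2)) := by
    rw [Real.exp_neg, ← div_eq_mul_inv, le_div_iff₀ (Real.exp_pos _)]; exact hle
  have h3 := Real.rpow_le_rpow (by positivity) h2 hs.le
  rw [Real.mul_rpow (by positivity) (by positivity), Real.mul_rpow (by positivity) (by positivity),
    ← Real.rpow_mul hb, ← Real.rpow_mul hC, one_div_mul_cancel hs.ne', Real.rpow_one,
    Real.rpow_one, ← Real.exp_mul] at h3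
  have h4 : -(y / 2) * s = -(r * a ^ (1 / s)) := by
    rw [hy, hq]; field_simp
  rw [h4] at h3
  linarith

/-- Powers are dominated by stretched exponentials. -/
lemma exists_pow_le_exp {s r : ℝ} (hs : 0 < s) (hr : 0 < r) (n : ℕ) :
    ∃ C : ℝ, 0 < C ∧ ∀ a : ℝ, 0 ≤ a → (1 + a) ^ n ≤ C * Real.exp (r * a ^ (1 / s)) := by
  -- Chosen so that the rate `s * (1 / h) ^ (1 / s)` of `pow_le_exp_rpow` is exactly `r`.
  set h : ℝ := (s / r) ^ s with hh
  have h0 : 0 < h := by positivity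
  have e : s * (1 / h) ^ (1 / s) = r := by
    rw [hh, one_div, ← Real.inv_rpow (by positivity), ← Real.rpow_mul (by positivity),
      mul_one_div_cancel hs.ne', Real.rpow_one]
    field_simp
  refine ⟨2 ^ n * (1 + h ^ n * (n ! : ℝ) ^ s), by positivity, fun a ha => ?_⟩
  have h1 := pow_le_exp_rpow hs h0 ha n
  rw [e] at h1
  have h2 := add_pow_le zero_le_one ha n
  have h3 : (2 : ℝ) ^ (n - 1) ≤ 2 ^ n := pow_le_pow_right₀ one_le_two (Nat.sub_le n 1)
  have h4 : (1 : ℝ) ≤ Real.exp (r * a ^ (1 / s)) := Real.one_le_exp (by positivity)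
  rw [one_pow] at h2
  have h5 := mul_le_mul_of_nonneg_right h3 (show 0 ≤ 1 + a ^ n by positivity)
  rw [mul_assoc]
  refine (h2.trans h5).trans (mul_le_mul_of_nonneg_left ?_ (by positivity))
  linarith

lemma factorial_rpow_mul_le {s : ℝ} (hs : 0 ≤ s) {i n : ℕ} (hin : i ≤ n) :
    (i ! : ℝ) ^ s * (((n - i)! : ℕ) : ℝ) ^ s ≤ (n ! : ℝ) ^ s := by
  rw [← Real.mul_rpow (by positivity) (by positivity)]
  refine Real.rpow_le_rpow (by positivity) ?_ hs
  exact_mod_cast Nat.le_of_dvd (Nat.factorial_pos n)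
    (Nat.factorial_mul_factorial_dvd_factorial hin)

section

variable {d : ℕ} {s t h A B p : ℝ} {f g : Rd d → ℂ}

/-- The pointwise Leibniz bound with a weight `p`. -/
lemma weighted_leibniz_bound (hs : 0 ≤ s) (hh : 0 ≤ h) (hf : ContDiff ℝ ∞ f)
    (hg : ContDiff ℝ ∞ g) (hp : 0 ≤ p) (x : Rd d)
    (hA : ∀ n : ℕ, ‖iteratedFDeriv ℝ n f x‖ ≤ A * (h ^ n * (n ! : ℝ) ^ s))
    (hB : ∀ n : ℕ, p * ‖iteratedFDeriv ℝ n g x‖ ≤ B * (h ^ n * (n ! : ℝ) ^ s)) (n : ℕ) :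
    p * ‖iteratedFDeriv ℝ n (fun y => f y * g y) x‖ ≤
      A * B * ((2 * h) ^ n * (n ! : ℝ) ^ s) := by
  have hA0 : 0 ≤ A := by simpa using (norm_nonneg _).trans (hA 0)
  have hB0 : 0 ≤ B := by simpa using (mul_nonneg hp (norm_nonneg _)).trans (hB 0)
  have h1 := norm_iteratedFDeriv_mul_le (N := ∞) hf hg x (n := n) (mod_cast le_top)
  have h2 : ∀ i ∈ Finset.range (n + 1),
      p * ((n.choose i : ℝ) * ‖iteratedFDeriv ℝ i f x‖ *
        ‖iteratedFDeriv ℝ (n - i) g x‖) ≤ (n.choose i : ℝ) * (A * B * (h ^ n * (n ! : ℝ) ^ s)) := by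
    intro i hi
    have hin : i ≤ n := Nat.lt_succ_iff.mp (Finset.mem_range.mp hi)
    have e3 := factorial_rpow_mul_le hs hin
    have e4 : h ^ i * h ^ (n - i) = h ^ n := by rw [← pow_add, Nat.add_sub_cancel' hin]
    have e5 := mul_le_mul (hA i) (hB (n - i)) (by positivity) (by positivity)
    have e6 : A * (h ^ i * (i ! : ℝ) ^ s) * (B * (h ^ (n - i) * (((n - i)! : ℕ) : ℝ) ^ s)) =
        A * B * h ^ n * (((i ! : ℝ) ^ s) * (((n - i)! : ℕ) : ℝ) ^ s) := by
      rw [← e4]; ring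
    have e7 := mul_le_mul_of_nonneg_left e3 (show 0 ≤ A * B * h ^ n by positivity)
    have e8 : ‖iteratedFDeriv ℝ i f x‖ * (p * ‖iteratedFDeriv ℝ (n - i) g x‖) ≤
        A * B * (h ^ n * (n ! : ℝ) ^ s) := by
      rw [e6] at e5; linarith
    have e9 := mul_le_mul_of_nonneg_left e8 (Nat.cast_nonneg (α := ℝ) (n.choose i))
    linarith
  have h3 : ∑ i ∈ Finset.range (n + 1), (n.choose i : ℝ) = 2 ^ n := by
    exact_mod_cast Nat.sum_range_choose n
  calc p * ‖iteratedFDeriv ℝ n (fun y => f y * g y) x‖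
      ≤ p * ∑ i ∈ Finset.range (n + 1), (n.choose i : ℝ) * ‖iteratedFDeriv ℝ i f x‖ *
        ‖iteratedFDeriv ℝ (n - i) g x‖ := mul_le_mul_of_nonneg_left h1 hp
    _ ≤ ∑ i ∈ Finset.range (n + 1), (n.choose i : ℝ) * (A * B * (h ^ n * (n ! : ℝ) ^ s)) := by
        rw [Finset.mul_sum]; exact Finset.sum_le_sum h2
    _ = A * B * ((2 * h) ^ n * (n ! : ℝ) ^ s) := by
        rw [← Finset.sum_mul, h3, mul_pow]; ring

/-- The pointwise Leibniz bound. -/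
lemma leibniz_bound (hs : 0 ≤ s) (hh : 0 ≤ h) (hf : ContDiff ℝ ∞ f) (hg : ContDiff ℝ ∞ g)
    (x : Rd d) (hA : ∀ n : ℕ, ‖iteratedFDeriv ℝ n f x‖ ≤ A * (h ^ n * (n ! : ℝ) ^ s))
    (hB : ∀ n : ℕ, ‖iteratedFDeriv ℝ n g x‖ ≤ B * (h ^ n * (n ! : ℝ) ^ s)) (n : ℕ) :
    ‖iteratedFDeriv ℝ n (fun y => f y * g y) x‖ ≤ A * B * ((2 * h) ^ n * (n ! : ℝ) ^ s) := by
  have := weighted_leibniz_bound hs hh hf hg zero_le_one x hA (fun n => by simpa using hB n) n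
  simpa using this

end

/-! ### The algebra of functions with global Gevrey bounds -/

/-- The smooth functions all of whose global Gevrey norms of order `s` are finite. -/
def Gev (d : ℕ) (s : ℝ) : Submodule ℂ (Rd d → ℂ) where
  carrier := {f | ContDiff ℝ ∞ f ∧ ∀ h : ℝ, 0 < h → ∃ M : ℝ, GevreyNormLE s h M f}
  add_mem' := by
    rintro f g ⟨hf, hf'⟩ ⟨hg, hg'⟩
    refine ⟨hf.add hg, fun h hh => ?_⟩
    obtain ⟨M, hM⟩ := hf' h hh
    obtain ⟨N, hN⟩ := hg' h hh
    exact ⟨M + N, hM.add hf hg hN⟩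
  zero_mem' := by
    refine ⟨contDiff_const, fun h hh => ⟨0, fun n x => ?_⟩⟩
    rw [iteratedFDeriv_zero_fun']
    simp
  smul_mem' := by
    rintro c f ⟨hf, hf'⟩
    refine ⟨contDiff_const.smul hf, fun h hh => ?_⟩
    obtain ⟨M, hM⟩ := hf' h hh
    exact ⟨‖c‖ * M, hM.smul c hf⟩

section

variable {d : ℕ} {s t : ℝ} {f g : Rd d → ℂ}

lemma GevreyC.mem_gev (ϕ : GevreyC d s) : ϕ.1 ∈ Gev d s := ⟨ϕ.2.1, ϕ.2.2.2⟩

lemma Sig.mem_gev (ϕ : Sig d t s) : ϕ.1 ∈ Gev d s := by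
  refine ⟨ϕ.2.1, fun h hh => ?_⟩
  obtain ⟨M, hM⟩ := ϕ.2.2 h hh
  exact ⟨M, fun n x => by simpa using hM 0 n x⟩

lemma mul_mem_gev (hs : 0 < s) (hf : f ∈ Gev d s) (hg : g ∈ Gev d s) :
    (fun x => f x * g x) ∈ Gev d s := by
  refine ⟨hf.1.mul hg.1, fun h hh => ?_⟩
  obtain ⟨M, hM⟩ := hf.2 (h / 2) (by positivity)
  obtain ⟨N, hN⟩ := hg.2 (h / 2) (by positivity)
  refine ⟨M * N, fun n x => ?_⟩
  have := leibniz_bound hs.le (by positivity) hf.1 hg.1 x (fun n => hM n x) (fun n => hN n x) n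
  rwa [mul_div_cancel₀ h two_ne_zero] at this

lemma conj_mem_gev (hf : f ∈ Gev d s) : (fun x => conj (f x)) ∈ Gev d s := by
  refine ⟨contDiff_conj hf.1, fun h hh => ?_⟩
  obtain ⟨M, hM⟩ := hf.2 h hh
  exact ⟨M, fun n x => by rw [norm_iteratedFDeriv_conj]; exact hM n x⟩

lemma char_mem_gev (hs : 0 < s) (ξ : Rd d) : char ξ ∈ Gev d s := by
  refine ⟨contDiff_char ξ, fun h hh => ?_⟩
  obtain ⟨C, hC, hCb⟩ := exists_pow_le (norm_nonneg ξ) hh hs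
  exact ⟨C, fun n x => (norm_iteratedFDeriv_char_le ξ x n).trans (hCb n)⟩

lemma const_mem_gev (hs : 0 < s) (c : ℂ) : (fun _ => c) ∈ Gev d s := by
  have h1 := (Gev d s).smul_mem c (char_mem_gev hs (0 : Rd d))
  convert h1 using 1
  funext x
  simp [char]

lemma gevreyC_mul_mem (hs : 0 < s) (ϕ : GevreyC d s) (hf : f ∈ Gev d s) :
    (fun x => f x * ϕ.1 x) ∈ GevreyC d s :=
  ⟨hf.1.mul ϕ.2.1, ϕ.2.2.1.mul_left, (mul_mem_gev hs hf (GevreyC.mem_gev ϕ)).2⟩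

/-- This is the gain in the Leibniz formula: for `s > 1` the binomial coefficient survives with the
negative exponent `1 - s`, so the intermediate terms are small. The inversion theorem rests on it.
-/
lemma choose_mul_factorial_rpow {s : ℝ} {k n : ℕ} (hkn : k ≤ n) :
    (n.choose k : ℝ) * ((k ! : ℝ) ^ s * (((n - k)! : ℕ) : ℝ) ^ s) =
      (n.choose k : ℝ) ^ (1 - s) * (n ! : ℝ) ^ s := by
  have h0 : (0 : ℝ) < n.choose k := by exact_mod_cast Nat.choose_pos hkn
  have h1 : (n ! : ℝ) = n.choose k * (k ! * ((n - k)! : ℕ)) := by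
    exact_mod_cast (by rw [← Nat.choose_mul_factorial_mul_factorial hkn]; ring)
  rw [h1, Real.mul_rpow h0.le (by positivity), Real.mul_rpow (by positivity) (by positivity),
    Real.rpow_sub h0, Real.rpow_one]
  have : (0 : ℝ) < (n.choose k : ℝ) ^ s := by positivity
  field_simp

lemma le_choose : ∀ {n k : ℕ}, 0 < k → k < n → n ≤ n.choose k := by
  intro n
  induction n with
  | zero => omega
  | succ n ih =>
    rintro (_ | k) hk hkn
    · omega
    rw [Nat.choose_succ_succ]
    rcases Nat.lt_or_ge (k + 1) n with h | h
    · have h1 := ih k.succ_pos h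
      have h2 : 1 ≤ n.choose k := Nat.choose_pos (by omega)
      omega
    · obtain rfl : n = k + 1 := by omega
      simp

/-- The recursive estimate for the derivatives of `1 / f`. -/
lemma norm_iteratedFDeriv_inv_le (hs : 1 < s) {h c M A : ℝ} (hh : 0 < h) (hc : 0 < c)
    (hf : ContDiff ℝ ∞ f) (hfc : ∀ x, c ≤ ‖f x‖) (hM : GevreyNormLE s h M f) {n : ℕ} (hn : 0 < n)
    (hA : ∀ m < n, ∀ x, ‖iteratedFDeriv ℝ m (fun y => (f y)⁻¹) x‖ ≤
      A * ((2 * h) ^ m * (m ! : ℝ) ^ s)) (x : Rd d) :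
    ‖iteratedFDeriv ℝ n (fun y => (f y)⁻¹) x‖ ≤
      c⁻¹ * M * ((n : ℝ) ^ (1 - s) + (1 / 2) ^ n) * A * ((2 * h) ^ n * (n ! : ℝ) ^ s) := by
  have hM0 := hM.nonneg
  have hA0 : 0 ≤ A := by simpa using (norm_nonneg _).trans (hA 0 hn x)
  have hne : ∀ y, f y ≠ 0 := fun y hy => by
    have := hfc y; rw [hy, norm_zero] at this; linarith
  have hG : ContDiff ℝ ∞ (fun y => (f y)⁻¹) := hf.inv hne
  set G : Rd d → ℂ := fun y => (f y)⁻¹ with hGdef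
  -- With `f x` frozen at the point of differentiation, the Leibniz term in which `f y - f x` is not
  -- differentiated vanishes. The `n`-th derivative of `G` then occurs only on the other side, and
  -- the sum involves lower orders only.
  have e1 : (fun y => (f y - f x) * G y) = (fun _ => (1 : ℂ)) - f x • G := by
    funext y
    simp only [Pi.sub_apply, Pi.smul_apply, smul_eq_mul, hGdef, sub_mul, mul_inv_cancel₀ (hne y)]
  have hnN : (n : ℕ∞ω) ≤ ∞ := mod_cast le_top
  have e2 : iteratedFDeriv ℝ n (fun y => (f y - f x) * G y) x = -(f x • iteratedFDeriv ℝ n G x) := by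
    have hG' : ContDiff ℝ n (f x • G) := (contDiff_const.smul hG).of_le hnN
    rw [e1, iteratedFDeriv_sub_apply contDiff_const.contDiffAt hG'.contDiffAt,
      iteratedFDeriv_const_smul_apply ((hG.of_le hnN).contDiffAt),
      iteratedFDeriv_const_of_ne hn.ne']
    simp
  have hD : ∀ k : ℕ, 0 < k → iteratedFDeriv ℝ k (fun y => f y - f x) x = iteratedFDeriv ℝ k f x := by
    intro k hk
    have : (fun y => f y - f x) = f - fun _ => f x := rfl
    rw [this, iteratedFDeriv_sub_apply ((hf.of_le (mod_cast le_top)).contDiffAt)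
      contDiff_const.contDiffAt, iteratedFDeriv_const_of_ne hk.ne']
    simp
  have h1 := norm_iteratedFDeriv_mul_le (N := ∞) (hf.sub contDiff_const) hG x (n := n) hnN
    (f := fun y => f y - f x)
  rw [e2, norm_neg, norm_smul, Finset.sum_range_succ'] at h1
  simp only [Nat.choose_zero_right, norm_iteratedFDeriv_zero, sub_self, norm_zero, mul_zero,
    zero_mul, add_zero] at h1
  set W : ℝ := A * ((2 * h) ^ n * (n ! : ℝ) ^ s) with hW
  have hW0 : 0 ≤ W := by positivity
  have hterm : ∀ k < n, (n.choose (k + 1) : ℝ) * ‖iteratedFDeriv ℝ (k + 1) (fun y => f y - f x) x‖ *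
      ‖iteratedFDeriv ℝ (n - (k + 1)) G x‖ ≤
      M * W * ((1 / 2) ^ (k + 1) * (n.choose (k + 1) : ℝ) ^ (1 - s)) := by
    intro k hk
    rw [hD _ k.succ_pos]
    have hkn : k + 1 ≤ n := hk
    have a1 := mul_le_mul (hM (k + 1) x) (hA (n - (k + 1)) (by omega) x) (norm_nonneg _)
      (by positivity)
    have a2 := mul_le_mul_of_nonneg_left a1 (Nat.cast_nonneg (α := ℝ) (n.choose (k + 1)))
    rw [mul_assoc]
    refine a2.trans (le_of_eq ?_)
    have a3 := choose_mul_factorial_rpow (s := s) hkn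
    have a4 : (2 * h) ^ n = (2 * h) ^ (k + 1) * (2 * h) ^ (n - (k + 1)) := by
      rw [← pow_add, Nat.add_sub_cancel' hkn]
    -- The derivatives of `f` are measured with `h` and those of `1 / f` with `2 * h`; the mismatch
    -- supplies the geometric factor that keeps the sum bounded.
    have a5 : h ^ (k + 1) = (1 / 2) ^ (k + 1) * (2 * h) ^ (k + 1) := by
      rw [← mul_pow]; congr 1; ring
    rw [hW, a4]
    calc (n.choose (k + 1) : ℝ) * (M * (h ^ (k + 1) * ((k + 1)! : ℝ) ^ s) *
          (A * ((2 * h) ^ (n - (k + 1)) * (((n - (k + 1))! : ℕ) : ℝ) ^ s)))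
        = M * A * h ^ (k + 1) * (2 * h) ^ (n - (k + 1)) * ((n.choose (k + 1) : ℝ) *
          (((k + 1)! : ℝ) ^ s * (((n - (k + 1))! : ℕ) : ℝ) ^ s)) := by ring
      _ = _ := by rw [a3, a5]; ring
  have hgeo : ∀ m : ℕ, ∑ k ∈ Finset.range m, (1 / 2 : ℝ) ^ (k + 1) ≤ 1 := by
    intro m
    have : ∑ k ∈ Finset.range m, (1 / 2 : ℝ) ^ (k + 1) = 1 - (1 / 2) ^ m := by
      induction m with
      | zero => simp
      | succ m ih => rw [Finset.sum_range_succ, ih, pow_succ]; ring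
    rw [this]
    have : (0 : ℝ) ≤ (1 / 2) ^ m := by positivity
    linarith
  obtain ⟨m, rfl⟩ : ∃ m, n = m + 1 := ⟨n - 1, by omega⟩
  -- Every binomial coefficient strictly inside its row is at least the order `n = m + 1`, hence
  -- contributes at most `n ^ (1 - s)`. Only the last term has coefficient `1`, and it carries `(1 /
  -- 2) ^ n`.
  have hsum : ∑ k ∈ Finset.range (m + 1), ((1 / 2 : ℝ) ^ (k + 1) *
      ((m + 1).choose (k + 1) : ℝ) ^ (1 - s)) ≤ ((m + 1 : ℕ) : ℝ) ^ (1 - s) + (1 / 2) ^ (m + 1) := by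
    rw [Finset.sum_range_succ, Nat.choose_self, Nat.cast_one, Real.one_rpow, mul_one]
    gcongr
    have : ∀ k ∈ Finset.range m, (1 / 2 : ℝ) ^ (k + 1) * ((m + 1).choose (k + 1) : ℝ) ^ (1 - s) ≤
        (1 / 2 : ℝ) ^ (k + 1) * ((m + 1 : ℕ) : ℝ) ^ (1 - s) := by
      intro k hk
      have hk' := Finset.mem_range.mp hk
      refine mul_le_mul_of_nonneg_left ?_ (by positivity)
      refine Real.rpow_le_rpow_of_nonpos (by positivity) ?_ (by linarith)
      have : m + 1 ≤ (m + 1).choose (k + 1) :=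
        le_choose k.succ_pos (by omega)
      exact_mod_cast this
    refine (Finset.sum_le_sum this).trans ?_
    rw [← Finset.sum_mul]
    exact mul_le_of_le_one_left (by positivity) (hgeo m)
  have h2 := h1.trans (Finset.sum_le_sum fun k hk => hterm k (Finset.mem_range.mp hk))
  rw [← Finset.mul_sum] at h2
  have h3 := h2.trans (mul_le_mul_of_nonneg_left hsum (by positivity))
  have h4 := (mul_le_mul_of_nonneg_right (hfc x)
    (norm_nonneg (iteratedFDeriv ℝ (m + 1) G x))).trans h3
  have h5 := mul_le_mul_of_nonneg_left h4 (inv_nonneg.mpr hc.le)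
  rw [← mul_assoc, inv_mul_cancel₀ hc.ne', one_mul] at h5
  refine h5.trans (le_of_eq ?_)
  rw [hW]; ring

/-- The factor in front of `A` in the recursive estimate tends to `0` because `s > 1`. From some
order on it is at most `1`, so a constant valid for the finitely many lower orders propagates to all
orders by induction. -/
lemma inv_mem_gev (hs : 1 < s) {c : ℝ} (hc : 0 < c) (hf : f ∈ Gev d s) (hfc : ∀ x, c ≤ ‖f x‖) :
    (fun x => (f x)⁻¹) ∈ Gev d s := by
  have hne : ∀ y, f y ≠ 0 := fun y hy => by
    have := hfc y; rw [hy, norm_zero] at this; linarith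
  refine ⟨hf.1.inv hne, fun H hH => ?_⟩
  obtain ⟨M, hM⟩ := hf.2 (H / 2) (by positivity)
  have hM0 := hM.nonneg
  set P : ℕ → ℝ → Prop := fun n A => ∀ m < n, ∀ x, ‖iteratedFDeriv ℝ m (fun y => (f y)⁻¹) x‖ ≤
      A * (H ^ m * (m ! : ℝ) ^ s) with hP
  have step : ∀ n A, 0 < n → P n A → ∀ x, ‖iteratedFDeriv ℝ n (fun y => (f y)⁻¹) x‖ ≤
      c⁻¹ * M * ((n : ℝ) ^ (1 - s) + (1 / 2) ^ n) * A * (H ^ n * (n ! : ℝ) ^ s) := by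
    intro n A hn hA x
    have := norm_iteratedFDeriv_inv_le hs (h := H / 2) (by positivity) hc hf.1 hfc hM hn (A := A)
      (by rw [mul_div_cancel₀ H two_ne_zero]; exact hA) x
    rwa [mul_div_cancel₀ H two_ne_zero] at this
  have hex : ∀ n, ∃ A, 0 ≤ A ∧ P n A := by
    intro n
    induction n with
    | zero => exact ⟨0, le_rfl, fun m hm => absurd hm (Nat.not_lt_zero m)⟩
    | succ n ih =>
      obtain ⟨A, hA0, hA⟩ := ih
      have hB : ∃ B, ∀ x, ‖iteratedFDeriv ℝ n (fun y => (f y)⁻¹) x‖ ≤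
          B * (H ^ n * (n ! : ℝ) ^ s) := by
        rcases Nat.eq_zero_or_pos n with rfl | hn
        · refine ⟨c⁻¹, fun x => ?_⟩
          simpa using inv_anti₀ hc (hfc x)
        · exact ⟨_, step n A hn hA⟩
      obtain ⟨B, hB⟩ := hB
      refine ⟨max A B, le_max_of_le_left hA0, fun m hm x => ?_⟩
      rcases Nat.lt_succ_iff_lt_or_eq.mp hm with hm' | rfl
      · exact (hA m hm' x).trans (by gcongr; exact le_max_left _ _)
      · exact (hB x).trans (by gcongr; exact le_max_right _ _)
  have hlim : Filter.Tendsto (fun n : ℕ => c⁻¹ * M * ((n : ℝ) ^ (1 - s) + (1 / 2) ^ n))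
      Filter.atTop (nhds 0) := by
    have h1 : Filter.Tendsto (fun n : ℕ => (n : ℝ) ^ (1 - s)) Filter.atTop (nhds 0) := by
      have := (tendsto_rpow_neg_atTop (show 0 < s - 1 by linarith)).comp
        (tendsto_natCast_atTop_atTop (R := ℝ))
      simpa [Function.comp_def, neg_sub] using this
    have h2 : Filter.Tendsto (fun n : ℕ => (1 / 2 : ℝ) ^ n) Filter.atTop (nhds 0) :=
      tendsto_pow_atTop_nhds_zero_of_lt_one (by norm_num) (by norm_num)
    simpa using (h1.add h2).const_mul (c⁻¹ * M)
  obtain ⟨N, hN⟩ := Filter.eventually_atTop.mp (hlim.eventually_le_const zero_lt_one)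
  obtain ⟨A, hA0, hA⟩ := hex (N + 1)
  have hall : ∀ n, P n A := by
    intro n
    induction n with
    | zero => exact fun m hm => absurd hm (Nat.not_lt_zero m)
    | succ n ih =>
      rcases Nat.lt_or_ge n (N + 1) with hn | hn
      · exact fun m hm => hA m (by omega)
      · intro m hm x
        rcases Nat.lt_succ_iff_lt_or_eq.mp hm with hm' | rfl
        · exact ih m hm' x
        · refine (step m A (by omega) ih x).trans ?_
          gcongr
          exact mul_le_of_le_one_left hA0 (hN m (by omega))
  exact ⟨A, fun n x => hall (n + 1) n (Nat.lt_succ_self n) x⟩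

end

section

/-! ### Gevrey cutoff functions -/

section Glue

variable {a : ℕ}

/-- The function `z ↦ exp (-1 / zᵃ)`. -/
def expNegInvPow (a : ℕ) (z : ℂ) : ℂ := Complex.exp (-(z ^ a)⁻¹)

lemma differentiableAt_expNegInvPow {z : ℂ} (hz : z ≠ 0) :
    DifferentiableAt ℂ (expNegInvPow a) z :=
  (((differentiableAt_id.pow a).inv (pow_ne_zero a hz)).neg).cexp

lemma analyticAt_expNegInvPow {z : ℂ} (hz : z ≠ 0) : AnalyticAt ℂ (expNegInvPow a) z :=
  (((analyticAt_id.pow a).inv (pow_ne_zero a hz)).neg).cexp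

/-- Cauchy's estimate on the disc of radius `ε x` around `x`. With `z = x (1 + w)` and `‖w‖ = ε`
small, the real part of `z⁻ᵃ` is at least half of `x⁻ᵃ`, by continuity of `(1 + w)⁻ᵃ` at `w = 0`. -/
lemma exists_norm_iteratedDeriv_expNegInvPow_le (a : ℕ) :
    ∃ K : ℝ, 0 < K ∧ ∀ (n : ℕ) (x : ℝ), 0 < x →
      ‖iteratedDeriv n (expNegInvPow a) x‖ ≤
        n ! * (K / x) ^ n * Real.exp (-((x ^ a)⁻¹ / 2)) := by
  have hcont : ContinuousAt (fun w : ℂ => (((1 + w) ^ a)⁻¹).re) 0 := by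
    refine Complex.continuous_re.continuousAt.comp ?_
    refine ContinuousAt.inv₀ (by fun_prop) (by simp)
  have hev : ∀ᶠ w : ℂ in nhds 0, 1 / 2 < (((1 + w) ^ a)⁻¹).re :=
    hcont.eventually (lt_mem_nhds (by simp; norm_num))
  obtain ⟨δ, hδ, hδ'⟩ := Metric.eventually_nhds_iff.mp hev
  set ε : ℝ := min (δ / 2) (1 / 2) with hε
  have hε0 : 0 < ε := by positivity
  have hεδ : ε < δ := (min_le_left _ _).trans_lt (by linarith)
  have hε1 : ε < 1 := (min_le_right _ _).trans_lt (by norm_num)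
  refine ⟨1 / ε, by positivity, fun n x hx => ?_⟩
  have hR : 0 < ε * x := by positivity
  have hne : ∀ z ∈ Metric.closedBall (x : ℂ) (ε * x), z ≠ 0 := by
    rintro z hz rfl
    rw [mem_closedBall_iff_norm, zero_sub, norm_neg, Complex.norm_real, Real.norm_of_nonneg hx.le]
      at hz
    nlinarith
  have hdiff : DiffContOnCl ℂ (expNegInvPow a) (Metric.ball (x : ℂ) (ε * x)) := by
    refine DifferentiableOn.diffContOnCl fun z hz => ?_
    rw [closure_ball _ hR.ne'] at hz
    exact (differentiableAt_expNegInvPow (hne z hz)).differentiableWithinAt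
  have hbd : ∀ z ∈ Metric.sphere (x : ℂ) (ε * x),
      ‖expNegInvPow a z‖ ≤ Real.exp (-((x ^ a)⁻¹ / 2)) := by
    intro z hz
    have hxC : (x : ℂ) ≠ 0 := by exact_mod_cast hx.ne'
    set w : ℂ := (z - x) / x with hw
    have hzw : z = x * (1 + w) := by rw [hw]; field_simp; ring
    have hwn : ‖w‖ = ε := by
      rw [hw, norm_div, mem_sphere_iff_norm.mp hz, Complex.norm_real, Real.norm_of_nonneg hx.le]
      field_simp
    have h1 := hδ' (y := w) (by rw [dist_zero_right, hwn]; exact hεδ)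
    have h2 : (z ^ a)⁻¹ = (((x ^ a)⁻¹ : ℝ) : ℂ) * ((1 + w) ^ a)⁻¹ := by
      rw [hzw, mul_pow, mul_inv]; push_cast; rfl
    rw [expNegInvPow, Complex.norm_exp, h2, Complex.neg_re, Complex.re_ofReal_mul]
    refine Real.exp_le_exp.mpr (neg_le_neg ?_)
    have h3 : 0 < (x ^ a)⁻¹ := by positivity
    nlinarith
  refine (Complex.norm_iteratedDeriv_le_of_forall_mem_sphere_norm_le n hR hdiff hbd).trans
    (le_of_eq ?_)
  rw [div_div, one_div, inv_pow]
  ring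

/-- In the variable `y = x⁻ᵃ` the `a`-th power of the left side is at most `yⁿ e^{-y/2} ≤ 2ⁿ n!`.
Taking the `a`-th root leaves only `n!^{1/a}`. -/
lemma inv_pow_mul_exp_le (ha : 0 < a) (n : ℕ) {x : ℝ} (hx : 0 < x) :
    (1 / x) ^ n * Real.exp (-((x ^ a)⁻¹ / 2)) ≤ 2 ^ n * (n ! : ℝ) ^ (1 / (a : ℝ)) := by
  set y : ℝ := (x ^ a)⁻¹ with hy
  have hy0 : 0 < y := by positivity
  have ha1 : (1 : ℝ) ≤ a := by exact_mod_cast ha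
  have h1 : ((1 / x) ^ n * Real.exp (-(y / 2))) ^ a ≤ 2 ^ n * n ! := by
    have e1 : ((1 / x) ^ n) ^ a = y ^ n := by
      rw [hy, ← pow_mul, mul_comm, pow_mul, one_div, inv_pow]
    have e2 : Real.exp (-(y / 2)) ^ a ≤ Real.exp (-(y / 2)) :=
      pow_le_of_le_one (Real.exp_pos _).le (Real.exp_le_one_iff.mpr (by linarith)) ha.ne'
    have e3 := Real.pow_div_factorial_le_exp (y / 2) (by positivity) n
    rw [div_le_iff₀ (by positivity)] at e3
    rw [mul_pow, e1]
    refine (mul_le_mul_of_nonneg_left e2 (by positivity)).trans ?_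
    rw [Real.exp_neg, ← div_eq_mul_inv, div_le_iff₀ (Real.exp_pos _)]
    rw [div_pow, div_le_iff₀ (by positivity)] at e3
    linarith
  have h2 := Real.rpow_le_rpow (by positivity) h1 (show 0 ≤ (a : ℝ)⁻¹ by positivity)
  rw [Real.pow_rpow_inv_natCast (by positivity) ha.ne', Real.mul_rpow (by positivity)
    (by positivity)] at h2
  rw [one_div (a : ℝ)]
  refine h2.trans (mul_le_mul_of_nonneg_right ?_ (by positivity))
  have : (2 : ℝ) ^ n = ((2 : ℝ) ^ n) ^ (1 : ℝ) := (Real.rpow_one _).symm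
  nth_rewrite 2 [this]
  exact Real.rpow_le_rpow_of_exponent_le (one_le_pow₀ one_le_two) (inv_le_one_of_one_le₀ ha1)

/-- The iterated derivatives of the function `exp (-1 / xᵃ)` on `x > 0`, extended by zero. -/
def glueDeriv (a n : ℕ) (x : ℝ) : ℂ := if 0 < x then iteratedDeriv n (expNegInvPow a) x else 0

lemma hasDerivAt_glueDeriv (ha : 0 < a) (n : ℕ) (x : ℝ) :
    HasDerivAt (glueDeriv a n) (glueDeriv a (n + 1) x) x := by
  rcases lt_trichotomy x 0 with hx | rfl | hx
  · have h1 : glueDeriv a (n + 1) x = 0 := if_neg hx.le.not_gt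
    rw [h1]
    refine (hasDerivAt_const x (0 : ℂ)).congr_of_eventuallyEq ?_
    filter_upwards [gt_mem_nhds hx] with y hy
    exact if_neg hy.le.not_gt
  · have h1 : glueDeriv a (n + 1) 0 = 0 := if_neg (lt_irrefl _)
    have h2 : glueDeriv a n 0 = 0 := if_neg (lt_irrefl _)
    obtain ⟨K, hK, hb⟩ := exists_norm_iteratedDeriv_expNegInvPow_le a
    -- Using order `n + 2` rather than `n` leaves two spare powers of `y`; the bound `C y²` is
    -- `o(y)`, which is differentiability at the origin with derivative `0`.
    set C : ℝ := n ! * K ^ n * (2 ^ (n + 2) * ((n + 2)! : ℝ) ^ (1 / (a : ℝ))) with hC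
    have hC0 : 0 ≤ C := by positivity
    have hbd : ∀ y, ‖glueDeriv a n y‖ ≤ C * ‖y ^ 2‖ := by
      intro y
      unfold glueDeriv
      split_ifs with hy
      · refine (hb n y hy).trans ?_
        have h3 := inv_pow_mul_exp_le ha (n + 2) hy
        have h4 : (n ! : ℝ) * (K / y) ^ n * Real.exp (-((y ^ a)⁻¹ / 2)) =
            n ! * K ^ n * y ^ 2 * ((1 / y) ^ (n + 2) * Real.exp (-((y ^ a)⁻¹ / 2))) := by
          rw [div_pow, one_div, inv_pow, pow_add]; field_simp
        rw [h4, hC, Real.norm_of_nonneg (by positivity)]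
        have := mul_le_mul_of_nonneg_left h3 (show 0 ≤ n ! * K ^ n * y ^ 2 by positivity)
        linarith
      · rw [norm_zero]; positivity
    rw [h1, hasDerivAt_iff_isLittleO, h2]
    simp only [sub_zero, smul_zero]
    refine (Asymptotics.IsBigO.of_bound C (Filter.Eventually.of_forall hbd)).trans_isLittleO ?_
    exact Asymptotics.isLittleO_pow_id one_lt_two
  · have h1 : glueDeriv a (n + 1) x = iteratedDeriv (n + 1) (expNegInvPow a) x := if_pos hx
    have hxC : (x : ℂ) ≠ 0 := by exact_mod_cast hx.ne'
    have h2 : HasDerivAt (iteratedDeriv n (expNegInvPow a))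
        (iteratedDeriv (n + 1) (expNegInvPow a) x) (x : ℂ) := by
      rw [iteratedDeriv_succ, hasDerivAt_deriv_iff]
      rw [iteratedDeriv_eq_iterate]
      exact ((analyticAt_expNegInvPow hxC).iterated_deriv n).differentiableAt
    rw [h1]
    refine h2.comp_ofReal.congr_of_eventuallyEq ?_
    filter_upwards [lt_mem_nhds hx] with y hy
    exact if_pos hy

lemma iteratedDeriv_glueDeriv (ha : 0 < a) (n : ℕ) :
    iteratedDeriv n (glueDeriv a 0) = glueDeriv a n := by
  induction n with
  | zero => exact iteratedDeriv_zero
  | succ n ih =>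
    rw [iteratedDeriv_succ, ih]
    funext x
    exact (hasDerivAt_glueDeriv ha n x).deriv

lemma contDiff_glueDeriv (ha : 0 < a) : ContDiff ℝ ∞ (glueDeriv a 0) := by
  refine contDiff_of_differentiable_iteratedDeriv fun m _ => ?_
  rw [iteratedDeriv_glueDeriv ha]
  exact fun x => (hasDerivAt_glueDeriv ha m x).differentiableAt

lemma glueDeriv_zero_eq (x : ℝ) :
    glueDeriv a 0 x = ((if 0 < x then Real.exp (-(x ^ a)⁻¹) else 0 : ℝ) : ℂ) := by
  unfold glueDeriv
  split_ifs
  · simp [expNegInvPow]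
  · simp

/-- The derivatives are of size `(2K)ⁿ n!^{1 + 1/a}`. The strictly positive gap between `1 + 1/a`
and `s` gives a positive power of `n!` that absorbs `(2K / h)ⁿ` for every `h`, as the Beurling class
requires. -/
lemma exists_norm_iteratedDeriv_glue_le {s : ℝ} (ha : 0 < a) (has : 1 + 1 / (a : ℝ) < s) {h : ℝ}
    (hh : 0 < h) : ∃ M : ℝ, ∀ (n : ℕ) (x : ℝ),
      ‖iteratedDeriv n (glueDeriv a 0) x‖ ≤ M * (h ^ n * (n ! : ℝ) ^ s) := by
  obtain ⟨K, hK, hb⟩ := exists_norm_iteratedDeriv_expNegInvPow_le a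
  obtain ⟨M, hM0, hM⟩ := exists_pow_le (a := 2 * K) (t := s - (1 + 1 / (a : ℝ))) (by positivity) hh
    (by linarith)
  refine ⟨M, fun n x => ?_⟩
  rw [iteratedDeriv_glueDeriv ha]
  unfold glueDeriv
  split_ifs with hx
  · have hn : (0 : ℝ) < n ! := by positivity
    calc _ ≤ n ! * (K / x) ^ n * Real.exp (-((x ^ a)⁻¹ / 2)) := hb n x hx
      _ = n ! * K ^ n * ((1 / x) ^ n * Real.exp (-((x ^ a)⁻¹ / 2))) := by
        rw [div_pow, div_pow]; ring
      _ ≤ n ! * K ^ n * (2 ^ n * (n ! : ℝ) ^ (1 / (a : ℝ))) :=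
        mul_le_mul_of_nonneg_left (inv_pow_mul_exp_le ha n hx) (by positivity)
      _ = (2 * K) ^ n * (n ! : ℝ) ^ (1 + 1 / (a : ℝ)) := by
        rw [Real.rpow_add hn, Real.rpow_one, mul_pow]; ring
      _ ≤ M * (h ^ n * (n ! : ℝ) ^ (s - (1 + 1 / (a : ℝ)))) * (n ! : ℝ) ^ (1 + 1 / (a : ℝ)) :=
        mul_le_mul_of_nonneg_right (hM n) (by positivity)
      _ = M * (h ^ n * ((n ! : ℝ) ^ (s - (1 + 1 / (a : ℝ))) * (n ! : ℝ) ^ (1 + 1 / (a : ℝ)))) := by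
        ring
      _ = _ := by rw [← Real.rpow_add hn, sub_add_cancel]
  · rw [norm_zero]; positivity

end Glue

variable {d : ℕ} {s : ℝ}

lemma comp_clm_mem_gev {g : ℝ → ℂ} (hg : ContDiff ℝ ∞ g)
    (hb : ∀ h : ℝ, 0 < h → ∃ M : ℝ, ∀ (n : ℕ) (x : ℝ),
      ‖iteratedDeriv n g x‖ ≤ M * (h ^ n * (n ! : ℝ) ^ s)) (l : Rd d →L[ℝ] ℝ) (hl : ‖l‖ ≤ 1)
    (b : ℝ) : (fun x => g (b + l x)) ∈ Gev d s := by
  have hg' : ContDiff ℝ ∞ (fun y => g (b + y)) := hg.comp (contDiff_const.add contDiff_id)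
  have e : (fun x => g (b + l x)) = (fun y => g (b + y)) ∘ l := rfl
  refine ⟨hg'.comp l.contDiff, fun h hh => ?_⟩
  obtain ⟨M, hM⟩ := hb h hh
  refine ⟨M, fun n x => ?_⟩
  rw [e, ContinuousLinearMap.iteratedFDeriv_comp_right _ hg' x (i := n) (mod_cast le_top)]
  refine (ContinuousMultilinearMap.norm_compContinuousLinearMap_le _ _).trans ?_
  rw [iteratedFDeriv_comp_add_left, norm_iteratedFDeriv_eq_norm_iteratedDeriv]
  have : ∏ _i : Fin n, ‖l‖ ≤ 1 := Finset.prod_le_one (fun _ _ => norm_nonneg _) fun _ _ => hl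
  exact (mul_le_of_le_one_right (norm_nonneg _) this).trans (hM n _)

/-- A Gevrey function that is `1` on a half space and `0` on an opposite half space. -/
lemma exists_step_mem_gev (hs : 1 < s) (l : Rd d →L[ℝ] ℝ) (hl : ‖l‖ ≤ 1) :
    ∃ f ∈ Gev d s, (∀ x, l x ≤ 1 → f x = 1) ∧ ∀ x, 2 ≤ l x → f x = 0 := by
  -- The exponent must satisfy `1 + 1 / a < s`; this is where `s > 1` enters.
  obtain ⟨a, ha⟩ := exists_nat_gt (1 / (s - 1))
  have hs1 : 0 < s - 1 := by linarith
  have haR : (0 : ℝ) < a := (by positivity : (0 : ℝ) < 1 / (s - 1)).trans ha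
  have ha0 : 0 < a := by exact_mod_cast haR
  have has : 1 + 1 / (a : ℝ) < s := by
    have : 1 / (a : ℝ) < s - 1 := by rwa [one_div_lt haR hs1]
    linarith
  have hb := fun h hh => exists_norm_iteratedDeriv_glue_le (s := s) (h := h) ha0 has hh
  set f : Rd d → ℂ := fun x => glueDeriv a 0 (2 + (-l) x) with hfdef
  set g : Rd d → ℂ := fun x => glueDeriv a 0 (-1 + l x) with hgdef
  have hf : f ∈ Gev d s := comp_clm_mem_gev (contDiff_glueDeriv ha0) hb (-l) (by rwa [norm_neg]) 2
  have hg : g ∈ Gev d s := comp_clm_mem_gev (contDiff_glueDeriv ha0) hb l hl (-1)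
  set θ : ℝ → ℝ := fun x => if 0 < x then Real.exp (-(x ^ a)⁻¹) else 0 with hθ
  have hθ0 : ∀ x, 0 ≤ θ x := fun x => by
    simp only [hθ]; split_ifs
    · exact (Real.exp_pos _).le
    · exact le_rfl
  have hθ1 : ∀ x, 1 / 2 ≤ x → Real.exp (-2 ^ a) ≤ θ x := fun x hx => by
    have hx0 : 0 < x := by linarith
    simp only [hθ, if_pos hx0]
    refine Real.exp_le_exp.mpr (neg_le_neg ?_)
    rw [← inv_pow]
    refine pow_le_pow_left₀ (by positivity) ?_ a
    rw [inv_le_comm₀ hx0 two_pos]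
    linarith
  have hfθ : ∀ x, f x = (θ (2 - l x) : ℝ) := fun x => by
    simp only [hfdef, glueDeriv_zero_eq, hθ, sub_eq_add_neg, neg_apply]
  have hgθ : ∀ x, g x = (θ (-1 + l x) : ℝ) := fun x => by
    simp only [hgdef, glueDeriv_zero_eq, hθ]
  -- The arguments `2 - l x` and `l x - 1` sum to `1`, so one of them is at least `1 / 2`. Hence `f
  -- + g` is bounded below, and the step function is `f / (f + g)`.
  have hlow : ∀ x, Real.exp (-2 ^ a) ≤ ‖(f + g) x‖ := by
    intro x
    rw [Pi.add_apply, hfθ, hgθ, ← Complex.ofReal_add, Complex.norm_real,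
      Real.norm_of_nonneg (add_nonneg (hθ0 _) (hθ0 _))]
    rcases le_total (l x) (3 / 2) with h | h
    · linarith [hθ1 (2 - l x) (by linarith), hθ0 (-1 + l x)]
    · linarith [hθ1 (-1 + l x) (by linarith), hθ0 (2 - l x)]
  refine ⟨fun x => f x * ((f + g) x)⁻¹, mul_mem_gev (zero_lt_one.trans hs) hf
    (inv_mem_gev hs (Real.exp_pos _) ((Gev d s).add_mem hf hg) hlow), fun x hx => ?_,
    fun x hx => ?_⟩
  · have h1 : g x = 0 := by
      rw [hgθ]; simp only [hθ]; rw [if_neg (by linarith)]; simp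
    have h2 := hlow x
    rw [Pi.add_apply, h1, add_zero] at h2
    have h3 : f x ≠ 0 := by
      intro h; rw [h, norm_zero] at h2; exact absurd h2 (Real.exp_pos _).not_ge
    simp only [Pi.add_apply, h1, add_zero, mul_inv_cancel₀ h3]
  · have h1 : f x = 0 := by
      rw [hfθ]; simp only [hθ]; rw [if_neg (by linarith)]; simp
    simp only [h1, zero_mul]

lemma prod_mem_gev (hs : 0 < s) {ι : Type*} (S : Finset ι) (f : ι → Rd d → ℂ)
    (hf : ∀ i, f i ∈ Gev d s) : (fun x => ∏ i ∈ S, f i x) ∈ Gev d s := by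
  classical
  induction S using Finset.induction_on with
  | empty => simpa using const_mem_gev hs (1 : ℂ)
  | insert i S hi ih => simpa [Finset.prod_insert hi] using mul_mem_gev hs (hf i) ih

/-- A Gevrey cutoff function that is `1` on the unit ball. -/
lemma exists_cutoff (d : ℕ) (hs : 1 < s) :
    ∃ χ : GevreyC d s, ∀ x : Rd d, ‖x‖ ≤ 1 → χ.1 x = 1 := by
  have hs0 := zero_lt_one.trans hs
  have hl : ∀ i : Fin d, ‖(EuclideanSpace.proj i : Rd d →L[ℝ] ℝ)‖ ≤ 1 := fun i =>
    ContinuousLinearMap.opNorm_le_bound _ zero_le_one fun x => by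
      rw [one_mul]; exact PiLp.norm_apply_le x i
  -- The cutoff is the product of step functions in the directions of all the positive and negative
  -- coordinates; it can be nonzero only where every `|x i| ≤ 2`.
  choose f hf hf1 hf0 using fun i : Fin d =>
    exists_step_mem_gev hs (EuclideanSpace.proj i : Rd d →L[ℝ] ℝ) (hl i)
  choose g hg hg1 hg0 using fun i : Fin d =>
    exists_step_mem_gev hs (-(EuclideanSpace.proj i : Rd d →L[ℝ] ℝ)) (by rw [norm_neg]; exact hl i)
  have hmem := prod_mem_gev hs0 Finset.univ (fun i x => f i x * g i x)
    fun i => mul_mem_gev hs0 (hf i) (hg i)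
  refine ⟨⟨_, hmem.1, ?_, hmem.2⟩, fun x hx => ?_⟩
  · refine HasCompactSupport.intro (isCompact_closedBall (0 : Rd d) (Real.sqrt (d * 2 ^ 2)))
      fun x hx => ?_
    by_contra hne
    refine hx ?_
    have hi : ∀ i, ‖x i‖ ≤ 2 := by
      intro i
      have h1 := Finset.prod_ne_zero_iff.mp hne i (Finset.mem_univ i)
      rw [Real.norm_eq_abs, abs_le]
      by_contra hcon
      rw [not_and_or, not_le, not_le] at hcon
      rcases hcon with h | h
      · refine h1 ?_
        rw [hg0 i x (by simp; linarith), mul_zero]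
      · refine h1 ?_
        rw [hf0 i x (by simp; linarith), zero_mul]
    rw [mem_closedBall_zero_iff, EuclideanSpace.norm_eq]
    refine Real.sqrt_le_sqrt ?_
    calc ∑ i, ‖x i‖ ^ 2 ≤ ∑ _i : Fin d, (2 : ℝ) ^ 2 :=
          Finset.sum_le_sum fun i _ => pow_le_pow_left₀ (norm_nonneg _) (hi i) 2
      _ = d * 2 ^ 2 := by simp
  · change ∏ i, f i x * g i x = 1
    refine Finset.prod_eq_one fun i _ => ?_
    have h1 := (PiLp.norm_apply_le x i).trans hx
    rw [Real.norm_eq_abs, abs_le] at h1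
    rw [hf1 i x (by simp; linarith), hg1 i x (by simp; linarith), one_mul]

/-- Gevrey bounds are inherited by the dilates `x ↦ f(x / R)` with `R ≥ 1`. -/
lemma gevreyNormLE_dilate {f : Rd d → ℂ} (hf : ContDiff ℝ ∞ f) {h M R : ℝ}
    (hR : 1 ≤ R) (hM : GevreyNormLE s h M f) : GevreyNormLE s h M (fun x => f (R⁻¹ • x)) := by
  have hM0 := hM.nonneg
  intro n x
  set l : Rd d →L[ℝ] Rd d := R⁻¹ • ContinuousLinearMap.id ℝ (Rd d) with hl
  have e : (fun x => f (R⁻¹ • x)) = f ∘ l := rfl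
  have hln : ‖l‖ ≤ 1 := by
    rw [hl, norm_smul, norm_inv, Real.norm_of_nonneg (by linarith)]
    exact mul_le_one₀ (inv_le_one_of_one_le₀ hR) (norm_nonneg _) ContinuousLinearMap.norm_id_le
  rw [e, ContinuousLinearMap.iteratedFDeriv_comp_right _ hf x (i := n) (mod_cast le_top)]
  refine (ContinuousMultilinearMap.norm_compContinuousLinearMap_le _ _).trans ?_
  have : ∏ _i : Fin n, ‖l‖ ≤ 1 := Finset.prod_le_one (fun _ _ => norm_nonneg _) fun _ _ => hln
  exact (mul_le_of_le_one_right (norm_nonneg _) this).trans (hM n _)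

/-- The dilate `x ↦ χ(x / R)` of a compactly supported Gevrey function. -/
def GevreyC.dilate (χ : GevreyC d s) {R : ℝ} (hR : 1 ≤ R) : GevreyC d s :=
  ⟨fun x => χ.1 (R⁻¹ • x), χ.2.1.comp (contDiff_const_smul R⁻¹),
    χ.2.2.1.comp_smul (inv_ne_zero (by linarith)), fun h hh => by
      obtain ⟨M, hM⟩ := χ.2.2.2 h hh
      exact ⟨M, gevreyNormLE_dilate χ.2.1 hR hM⟩⟩

end

variable {d : ℕ} {s t : ℝ}

/-! ### Decay of Gelfand-Shilov functions -/

lemma integrable_exp_neg_norm_rpow {r : ℝ} (ht : 0 < t) (hr : 0 < r) :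
    MeasureTheory.Integrable (fun x : Rd d => Real.exp (-(r * ‖x‖ ^ (1 / t)))) := by
  obtain ⟨C, hC0, hC⟩ := exists_pow_le_exp ht hr (d + 1)
  have hint : MeasureTheory.Integrable (fun x : Rd d => C * (1 + ‖x‖) ^ (-((d + 1 : ℕ) : ℝ))) :=
    (integrable_one_add_norm (by simp)).const_mul C
  refine hint.mono' (Continuous.aestronglyMeasurable ?_) (Filter.Eventually.of_forall fun x => ?_)
  · have : Continuous fun x : Rd d => ‖x‖ ^ (1 / t) :=
      continuous_norm.rpow_const fun _ => Or.inr (by positivity)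
    fun_prop
  · have h1 : 0 < 1 + ‖x‖ := by positivity
    rw [Real.norm_of_nonneg (Real.exp_pos _).le, Real.rpow_neg h1.le, Real.rpow_natCast,
      Real.exp_neg, ← div_eq_mul_inv, le_div_iff₀ (by positivity), inv_mul_le_iff₀ (Real.exp_pos _),
      mul_comm]
    exact hC _ (norm_nonneg _)

/-- For a fixed order of differentiation the weights `‖x‖ᵏ` are moments, and `exists_le_exp_neg`
turns them into exponential decay. The minimum of the two norm parameters serves the moments and the
derivatives at once. -/
lemma Sig.exists_decay (f : Sig d t s) (ht : 0 < t) {r h : ℝ} (hr : 0 < r) (hh : 0 < h) :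
    ∃ C : ℝ, 0 ≤ C ∧ ∀ (n : ℕ) (x : Rd d), ‖iteratedFDeriv ℝ n f.1 x‖ ≤
      C * Real.exp (-(r * ‖x‖ ^ (1 / t))) * (h ^ n * (n ! : ℝ) ^ s) := by
  obtain ⟨k, hk0, hk⟩ := exists_le_exp_neg ht hr
  obtain ⟨M, hM⟩ := f.2.2 (min k h) (by positivity)
  have hM0 := hM.nonneg
  refine ⟨2 ^ t * M, by positivity, fun n x => ?_⟩
  have := hk ‖x‖ ‖iteratedFDeriv ℝ n f.1 x‖ (M * (h ^ n * (n ! : ℝ) ^ s)) (norm_nonneg _)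
    (norm_nonneg _) (by positivity) fun m => by
      refine (hM m n x).trans ?_
      have h1 : min k h ^ (m + n) ≤ k ^ m * h ^ n := by
        rw [pow_add]
        gcongr
        · exact min_le_left _ _
        · exact min_le_right _ _
      have h2 := mul_le_mul_of_nonneg_right h1
        (show 0 ≤ M * ((m ! : ℝ) ^ t * (n ! : ℝ) ^ s) by positivity)
      linarith
  linarith

lemma Sig.exists_norm_le (f : Sig d t s) (ht : 0 < t) {r : ℝ} (hr : 0 < r) :
    ∃ C : ℝ, 0 ≤ C ∧ ∀ x : Rd d, ‖f.1 x‖ ≤ C * Real.exp (-(r * ‖x‖ ^ (1 / t))) := by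
  obtain ⟨C, hC0, hC⟩ := Sig.exists_decay f ht hr zero_lt_one
  exact ⟨C, hC0, fun x => by simpa using hC 0 x⟩

lemma Sig.integrable_pow_mul (f : Sig d t s) (ht : 0 < t) (k n : ℕ) :
    MeasureTheory.Integrable (fun x => ‖x‖ ^ k * ‖iteratedFDeriv ℝ n f.1 x‖) := by
  obtain ⟨C, hC0, hC⟩ := Sig.exists_decay f ht two_pos zero_lt_one
  obtain ⟨D, hD0, hD⟩ := exists_pow_le_exp ht one_pos k
  refine ((integrable_exp_neg_norm_rpow (d := d) ht one_pos).const_mul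
    (D * C * (n ! : ℝ) ^ s)).mono' (Continuous.aestronglyMeasurable ?_)
    (Filter.Eventually.of_forall fun x => ?_)
  · exact (continuous_norm.pow k).mul
      (f.2.1.continuous_iteratedFDeriv (m := n) (mod_cast le_top)).norm
  · rw [Real.norm_of_nonneg (by positivity)]
    have h1 : ‖x‖ ^ k ≤ D * Real.exp (1 * ‖x‖ ^ (1 / t)) :=
      (pow_le_pow_left₀ (norm_nonneg x) (by linarith [norm_nonneg x]) k).trans (hD _ (norm_nonneg x))
    have h2 := mul_le_mul h1 (hC n x) (norm_nonneg _) (by positivity)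
    refine h2.trans (le_of_eq ?_)
    have h3 : Real.exp (-(1 * ‖x‖ ^ (1 / t))) =
        Real.exp (1 * ‖x‖ ^ (1 / t)) * Real.exp (-(2 * ‖x‖ ^ (1 / t))) := by
      rw [← Real.exp_add]; ring_nf
    rw [h3]; ring

lemma Sig.integrable (f : Sig d t s) (ht : 0 < t) : MeasureTheory.Integrable f.1 := by
  have := Sig.integrable_pow_mul f ht 0 0
  simp only [pow_zero, one_mul, norm_iteratedFDeriv_zero] at this
  exact (MeasureTheory.integrable_norm_iff f.2.1.continuous.aestronglyMeasurable).mp this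

/-! ### Localized functionals -/

/-- For `v ∈ D_s'` and `χ ∈ G_c^s`, the functional `f ↦ ⟨v, f χ⟩`. -/
def GevreyDual.cutoff (hs : 0 < s) (v : GevreyDual d s) (χ : GevreyC d s) : Gev d s →ₗ[ℂ] ℂ :=
  v.toLin ∘ₗ
    { toFun := fun f => ⟨fun x => f.1 x * χ.1 x, gevreyC_mul_mem hs χ f.2⟩
      map_add' := fun f g => Subtype.ext (funext fun x => add_mul (f.1 x) (g.1 x) (χ.1 x))
      map_smul' := fun c f => Subtype.ext (funext fun x => mul_assoc c (f.1 x) (χ.1 x)) }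

lemma GevreyDual.cutoff_apply (hs : 0 < s) (v : GevreyDual d s) (χ : GevreyC d s) (f : Gev d s) :
    v.cutoff hs χ f = v.toLin ⟨fun x => f.1 x * χ.1 x, gevreyC_mul_mem hs χ f.2⟩ := rfl

/-- The localized functional is bounded by a Gevrey norm on the support of the cutoff. -/
lemma GevreyDual.exists_cutoff_le (hs : 0 < s) (v : GevreyDual d s) (χ : GevreyC d s) :
    ∃ h : ℝ, 0 < h ∧ ∃ C : ℝ, 0 ≤ C ∧ ∀ (f : Gev d s) (M : ℝ), 0 ≤ M →
      (∀ (n : ℕ), ∀ x ∈ tsupport χ.1, ‖iteratedFDeriv ℝ n f.1 x‖ ≤ M * (h ^ n * (n ! : ℝ) ^ s)) →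
        ‖v.cutoff hs χ f‖ ≤ C * M := by
  obtain ⟨h, hh, C, hC⟩ := v.bounded (tsupport χ.1) χ.2.2.1
  obtain ⟨N, hN⟩ := χ.2.2.2 (h / 2) (by positivity)
  have hN0 := hN.nonneg
  refine ⟨h / 2, by positivity, |C| * N, by positivity, fun f M hM0 hM => ?_⟩
  have hsub : tsupport (fun x => f.1 x * χ.1 x) ⊆ tsupport χ.1 := tsupport_mul_subset_right
  have h1 := hC ⟨fun x => f.1 x * χ.1 x, gevreyC_mul_mem hs χ f.2⟩ (M * N) hsub fun n x => by
    by_cases hx : x ∈ tsupport χ.1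
    · have := leibniz_bound hs.le (by positivity) f.2.1 χ.2.1 x (fun n => hM n x hx)
        (fun n => hN n x) n
      rwa [mul_div_cancel₀ h two_ne_zero] at this
    · have h1 : iteratedFDeriv ℝ n (fun x => f.1 x * χ.1 x) x = 0 := by
        by_contra hne
        exact hx (hsub (support_iteratedFDeriv_subset n (Function.mem_support.mpr hne)))
      rw [h1, norm_zero]
      positivity
  rw [GevreyDual.cutoff_apply]
  refine h1.trans ?_
  have := mul_le_mul_of_nonneg_right (le_abs_self C) (show 0 ≤ M * N by positivity)
  linarith

/-! ### Density of compactly supported functions -/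

/-- The function vanishes for `‖x‖ < R`. Elsewhere `‖x‖ᵏ ≤ ‖x‖ᵏ⁺¹ / R`, so one extra moment of `f`
pays for the factor `1 / R`, and the derivatives of the dilated cutoff are bounded uniformly in `R`.
-/
lemma exists_normLE_tail (hs : 0 < s) (ht : 0 < t) {χ : GevreyC d s}
    (hχ : ∀ x : Rd d, ‖x‖ ≤ 1 → χ.1 x = 1) (f : Sig d t s) {h : ℝ} (hh : 0 < h) :
    ∃ D : ℝ, 0 ≤ D ∧ ∀ R : ℝ, 1 ≤ R →
      NormLE t s h (D / R) (fun x => (1 - χ.1 (R⁻¹ • x)) * f.1 x) := by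
  have hgmem : (fun x => 1 - χ.1 x) ∈ Gev d s :=
    (Gev d s).sub_mem (const_mem_gev hs 1) (GevreyC.mem_gev χ)
  obtain ⟨M, hM⟩ := hgmem.2 (h / 2) (by positivity)
  -- The factor `2 ^ t` compensates `(k + 1)!ᵗ ≤ (2ᵗ)ᵏ k!ᵗ`, and the `2` the doubling in the Leibniz
  -- bound.
  set q : ℝ := h / 2 / 2 ^ t with hq
  have h2t : (1 : ℝ) ≤ 2 ^ t := Real.one_le_rpow one_le_two ht.le
  have hq0 : 0 < q := by positivity
  obtain ⟨N, hN⟩ := f.2.2 q hq0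
  have hM0 := hM.nonneg
  have hN0 := hN.nonneg
  refine ⟨M * (N * q), by positivity, fun R hR k n x => ?_⟩
  have hR0 : 0 < R := by linarith
  rcases lt_or_ge ‖x‖ R with hx | hx
  · have hev : (fun x => (1 - χ.1 (R⁻¹ • x)) * f.1 x) =ᶠ[nhds x] fun _ => 0 := by
      filter_upwards [(isOpen_lt continuous_norm continuous_const).mem_nhds hx] with y hy
      have : ‖R⁻¹ • y‖ ≤ 1 := by
        rw [norm_smul, norm_inv, Real.norm_of_nonneg hR0.le, inv_mul_le_iff₀ hR0, mul_one]
        exact le_of_lt hy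
      rw [hχ _ this, sub_self, zero_mul]
    rw [(Filter.EventuallyEq.iteratedFDeriv ℝ hev n).eq_of_nhds, iteratedFDeriv_fun_zero]
    simp only [Pi.zero_apply, norm_zero, mul_zero]
    positivity
  · have hgR := gevreyNormLE_dilate hgmem.1 hR hM
    have hfB : ∀ n : ℕ, ‖x‖ ^ k * ‖iteratedFDeriv ℝ n f.1 x‖ ≤
        (N * q / R * ((h / 2) ^ k * (k ! : ℝ) ^ t)) * ((h / 2) ^ n * (n ! : ℝ) ^ s) := by
      intro n
      have h1 := hN (k + 1) n x
      have h2 : R * (‖x‖ ^ k * ‖iteratedFDeriv ℝ n f.1 x‖) ≤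
          ‖x‖ ^ (k + 1) * ‖iteratedFDeriv ℝ n f.1 x‖ := by
        rw [pow_succ', mul_assoc]
        exact mul_le_mul_of_nonneg_right hx (by positivity)
      have h3 : ((k + 1)! : ℝ) ^ t ≤ (2 ^ t) ^ k * (k ! : ℝ) ^ t := by
        rw [Nat.factorial_succ, Nat.cast_mul, Real.mul_rpow (by positivity) (by positivity)]
        refine mul_le_mul_of_nonneg_right ?_ (by positivity)
        rw [← Real.rpow_natCast, ← Real.rpow_mul (by norm_num), mul_comm, Real.rpow_mul (by norm_num),
          Real.rpow_natCast]
        refine Real.rpow_le_rpow (by positivity) ?_ ht.le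
        exact_mod_cast Nat.lt_two_pow_self
      have h4 : q ^ k * (2 ^ t) ^ k = (h / 2) ^ k := by
        rw [← mul_pow, hq, div_mul_cancel₀ _ (by positivity)]
      have h5 : q ^ n ≤ (h / 2) ^ n := by
        refine pow_le_pow_left₀ hq0.le ?_ n
        exact div_le_self (by positivity) h2t
      have h6 : N * (q ^ (k + 1 + n) * (((k + 1)! : ℝ) ^ t * (n ! : ℝ) ^ s)) ≤
          N * q * (((h / 2) ^ k * (k ! : ℝ) ^ t) * ((h / 2) ^ n * (n ! : ℝ) ^ s)) := by
        calc N * (q ^ (k + 1 + n) * (((k + 1)! : ℝ) ^ t * (n ! : ℝ) ^ s))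
            = N * q * q ^ k * (q ^ n * (((k + 1)! : ℝ) ^ t * (n ! : ℝ) ^ s)) := by
              rw [pow_add, pow_add, pow_one]; ring
          _ ≤ N * q * q ^ k * ((h / 2) ^ n * ((2 ^ t) ^ k * (k ! : ℝ) ^ t * (n ! : ℝ) ^ s)) := by
              gcongr
          _ = N * q * (((q ^ k * (2 ^ t) ^ k) * (k ! : ℝ) ^ t) * ((h / 2) ^ n * (n ! : ℝ) ^ s)) := by
              ring
          _ = _ := by rw [h4]
      have h7 := (h2.trans h1).trans h6
      rw [← le_div_iff₀' hR0] at h7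
      refine h7.trans (le_of_eq ?_)
      ring
    have h8 := weighted_leibniz_bound hs.le (by positivity)
      (hgmem.1.comp (contDiff_const_smul R⁻¹)) f.2.1 (by positivity) x
      (fun n => hgR n x) hfB n
    rw [mul_div_cancel₀ h two_ne_zero] at h8
    refine h8.trans ?_
    have h9 : (h / 2) ^ k ≤ h ^ k := pow_le_pow_left₀ (by positivity) (by linarith) k
    calc M * (N * q / R * ((h / 2) ^ k * (k ! : ℝ) ^ t)) * (h ^ n * (n ! : ℝ) ^ s)
        ≤ M * (N * q / R * (h ^ k * (k ! : ℝ) ^ t)) * (h ^ n * (n ! : ℝ) ^ s) := by gcongr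
      _ = _ := by rw [pow_add]; ring

lemma GevreyDual.apply_eq_zero {v : GevreyDual d s} {K O : Set (Rd d)}
    (hv : ∀ ϕ : GevreyC d s, tsupport ϕ.1 ⊆ Kᶜ → v.toLin ϕ = 0) (hO : IsOpen O) (hKO : K ⊆ O)
    (ϕ : GevreyC d s) (hϕ : ∀ x ∈ O, ϕ.1 x = 0) : v.toLin ϕ = 0 := by
  refine hv ϕ ((closure_minimal ?_ hO.isClosed_compl).trans (Set.compl_subset_compl.mpr hKO))
  exact fun x hx hxO => hx (hϕ x hxO)

lemma Sig.integrable_mul (w f : Sig d t s) (ht : 0 < t) :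
    MeasureTheory.Integrable (fun x => w.1 x * f.1 x) := by
  obtain ⟨C, hC0, hC⟩ := Sig.exists_norm_le f ht one_pos
  refine (Sig.integrable w ht).mul_bdd (c := C) f.2.1.continuous.aestronglyMeasurable
    (Filter.Eventually.of_forall fun x => (hC x).trans ?_)
  exact mul_le_of_le_one_right hC0 (Real.exp_le_one_iff.mpr (neg_nonpos.mpr (by positivity)))

/-- The decomposition of `u ∈ E_s' + Σ_t^s` persists on all of `Σ_t^s`. -/
lemma SigDual.eq_cutoff_add_integral (hs : 1 < s) (ht : 0 < t) {u : SigDual d t s}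
    {v : GevreyDual d s} {w : Sig d t s} {K O : Set (Rd d)} (hK : IsCompact K)
    (hv : ∀ ϕ : GevreyC d s, tsupport ϕ.1 ⊆ Kᶜ → v.toLin ϕ = 0) (hO : IsOpen O) (hKO : K ⊆ O)
    (hu : ∀ ϕ : GevreyC d s, (u.toGevreyDual ht).toLin ϕ = v.toLin ϕ + ∫ x, w.1 x * ϕ.1 x)
    {χ : GevreyC d s} (hχ : ∀ x ∈ O, χ.1 x = 1) (f : Sig d t s) :
    u.toLin f = v.cutoff (zero_lt_one.trans hs) χ ⟨f.1, Sig.mem_gev f⟩ + ∫ x, w.1 x * f.1 x := by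
  have hs0 := zero_lt_one.trans hs
  obtain ⟨χ₀, hχ₀⟩ := exists_cutoff d hs
  obtain ⟨h, hh, C, hC⟩ := u.bounded
  obtain ⟨D, hD0, hD⟩ := exists_normLE_tail hs0 ht hχ₀ f hh
  obtain ⟨R₀, hR₀⟩ := hK.isBounded.exists_norm_le
  set I : ℝ := ∫ x, ‖w.1 x‖ with hI
  have hI0 : 0 ≤ I := MeasureTheory.integral_nonneg fun x => norm_nonneg _
  have hbound : ∀ R : ℝ, max 1 (R₀ + 1) ≤ R →
      ‖u.toLin f - (v.cutoff hs0 χ ⟨f.1, Sig.mem_gev f⟩ + ∫ x, w.1 x * f.1 x)‖ ≤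
        (|C| * D + I * D) / R := by
    intro R hR
    have hR1 : 1 ≤ R := (le_max_left _ _).trans hR
    have hR0 : 0 < R := by linarith
    have hR2 : R₀ < R := by linarith [(le_max_right 1 (R₀ + 1)).trans hR]
    set ρ : GevreyC d s := GevreyC.dilate χ₀ hR1 with hρ
    have hρ1 : ∀ x : Rd d, ‖x‖ < R → ρ.1 x = 1 := fun x hx => hχ₀ (R⁻¹ • x) (by
      rw [norm_smul, norm_inv, Real.norm_of_nonneg hR0.le, inv_mul_le_iff₀ hR0, mul_one]
      exact hx.le)
    set g : GevreyC d s := ⟨fun x => f.1 x * ρ.1 x, gevreyC_mul_mem hs0 ρ (Sig.mem_gev f)⟩ with hg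
    set g' : Sig d t s := Submodule.inclusion (gevreyC_le_sig ht) g with hg'
    have htail : (f - g').1 = fun x => (1 - χ₀.1 (R⁻¹ • x)) * f.1 x := by
      funext x
      change f.1 x - f.1 x * χ₀.1 (R⁻¹ • x) = _
      ring
    have hn : NormLE t s h (D / R) (f - g').1 := by rw [htail]; exact hD R hR1
    have h1 : ‖u.toLin f - u.toLin g'‖ ≤ |C| * (D / R) := by
      rw [← map_sub]
      exact (hC _ _ hn).trans (mul_le_mul_of_nonneg_right (le_abs_self C) (by positivity))
    have h2 : u.toLin g' = v.toLin g + ∫ x, w.1 x * g.1 x := hu g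
    -- The test functions `f ρ` and `f χ` agree on the neighbourhood of `K` where both cutoffs are
    -- `1`, and `v` does not see the rest.
    have h3 : v.toLin g = v.cutoff hs0 χ ⟨f.1, Sig.mem_gev f⟩ := by
      rw [GevreyDual.cutoff_apply, ← sub_eq_zero, ← map_sub]
      refine GevreyDual.apply_eq_zero hv (hO.inter
        (isOpen_lt continuous_norm (continuous_const (y := R))))
        (fun x hx => ⟨hKO hx, (hR₀ x hx).trans_lt hR2⟩) _ fun x hx => ?_
      change f.1 x * ρ.1 x - f.1 x * χ.1 x = 0
      rw [hρ1 x hx.2, hχ x hx.1, sub_self]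
    have h4 : ‖(∫ x, w.1 x * f.1 x) - ∫ x, w.1 x * g'.1 x‖ ≤ I * (D / R) := by
      rw [← MeasureTheory.integral_sub (Sig.integrable_mul w f ht) (Sig.integrable_mul w g' ht), hI,
        ← MeasureTheory.integral_mul_const]
      refine MeasureTheory.norm_integral_le_of_norm_le ((Sig.integrable w ht).norm.mul_const _)
        (Filter.Eventually.of_forall fun x => ?_)
      rw [← mul_sub, norm_mul]
      refine mul_le_mul_of_nonneg_left ?_ (norm_nonneg _)
      simpa using hn 0 0 x
    have h5 : u.toLin f - (v.cutoff hs0 χ ⟨f.1, Sig.mem_gev f⟩ + ∫ x, w.1 x * f.1 x) =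
        (u.toLin f - u.toLin g') - ((∫ x, w.1 x * f.1 x) - ∫ x, w.1 x * g.1 x) := by
      rw [h2, h3]; ring
    rw [h5]
    refine (norm_sub_le _ _).trans ((add_le_add h1 h4).trans (le_of_eq ?_))
    ring
  have hlim : Filter.Tendsto (fun R : ℝ => (|C| * D + I * D) / R) Filter.atTop (nhds 0) :=
    tendsto_const_nhds.div_atTop Filter.tendsto_id
  have := ge_of_tendsto hlim (Filter.eventually_atTop.mpr ⟨_, hbound⟩)
  exact sub_eq_zero.mp (norm_le_zero_iff.mp this)

open MeasureTheory FourierTransform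

/-! ### A Fubini theorem for bounded functionals -/

/-- If a functional `L` is bounded by the supremum of the absolute values of a family of
functionals, then it commutes with weakly defined integrals of norm continuous functions. -/
theorem map_integral_of_bounded {E X ι : Type*} [AddCommGroup E] [Module ℂ E]
    [TopologicalSpace X] [SecondCountableTopology X] [MeasurableSpace X] [OpensMeasurableSpace X]
    (μ : Measure X) (l : ι → E →ₗ[ℂ] ℂ) (hE : ∀ f, ∃ M, ∀ i, ‖l i f‖ ≤ M)
    (L : E →ₗ[ℂ] ℂ) (C : ℝ) (hL : ∀ f M, 0 ≤ M → (∀ i, ‖l i f‖ ≤ M) → ‖L f‖ ≤ C * M)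
    {a : X → ℂ} (ha : Continuous a) {F : X → E}
    (hF : ∀ x₀, ∀ ε > 0, ∀ᶠ x in nhds x₀, ∀ i, ‖l i (F x - F x₀)‖ ≤ ε)
    {b : X → ℝ} (hb0 : ∀ x, 0 ≤ b x) (hb : ∀ x i, ‖l i (F x)‖ ≤ b x)
    (hab : Integrable (fun x => ‖a x‖ * b x) μ)
    {f₀ : E} (hf₀ : ∀ i, l i f₀ = ∫ x, a x * l i (F x) ∂μ) :
    Continuous (fun x => L (F x)) ∧ Integrable (fun x => a x * L (F x)) μ ∧
      L f₀ = ∫ x, a x * L (F x) ∂μ := by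
  -- With the discrete topology on `ι`, bounded continuous functions are all bounded functions, so
  -- `W` maps `E` into a Banach space with the supremum norm.
  let _ : TopologicalSpace ι := ⊥
  have _ : DiscreteTopology ι := ⟨rfl⟩
  choose B hB using hE
  let W : E →ₗ[ℂ] BoundedContinuousFunction ι ℂ :=
    { toFun := fun f => BoundedContinuousFunction.ofNormedAddCommGroupDiscrete
        (fun i => l i f) (B f) (hB f)
      map_add' := fun f g => by ext i; simp
      map_smul' := fun c f => by ext i; simp }
  have hW : ∀ f i, W f i = l i f := fun f i => rfl
  have hLW : ∀ f, ‖L f‖ ≤ C * ‖W f‖ := fun f =>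
    hL f ‖W f‖ (norm_nonneg _) fun i => by rw [← hW]; exact (W f).norm_coe_le_norm i
  -- `W` need not be injective, but `L` vanishes on its kernel by the bound `hLW`. Thus `L` descends
  -- to a bounded functional on the range, and Hahn-Banach extends it to the whole Banach space,
  -- where Bochner integrals commute with it.
  obtain ⟨g, hg⟩ := W.rangeRestrict.exists_rightInverse_of_surjective
    (LinearMap.range_rangeRestrict W)
  have hWg : ∀ p : LinearMap.range W, W (g p) = p := fun p =>
    congrArg Subtype.val (LinearMap.congr_fun hg p)
  let T₀ : StrongDual ℂ (LinearMap.range W) := (L ∘ₗ g).mkContinuous C fun p => by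
    have := hLW (g p)
    rw [hWg] at this
    exact this
  obtain ⟨T, hT, -⟩ := exists_extension_norm_eq (LinearMap.range W) T₀
  have hTW : ∀ f, T (W f) = L f := by
    intro f
    have h1 := hT ⟨W f, LinearMap.mem_range_self W f⟩
    rw [h1]
    change L (g ⟨W f, _⟩) = L f
    rw [← sub_eq_zero, ← map_sub]
    have h2 := hLW (g ⟨W f, LinearMap.mem_range_self W f⟩ - f)
    rw [map_sub W, hWg, sub_self, norm_zero, mul_zero] at h2
    exact norm_le_zero_iff.mp h2
  have hcont : Continuous fun x => W (F x) := by
    rw [continuous_iff_continuousAt]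
    intro x₀
    rw [ContinuousAt, Metric.tendsto_nhds]
    intro ε hε
    filter_upwards [hF x₀ (ε / 2) (by positivity)] with x hx
    rw [dist_eq_norm, ← map_sub]
    refine lt_of_le_of_lt ?_ (half_lt_self hε)
    exact (BoundedContinuousFunction.norm_le (by positivity)).mpr fun i => by rw [hW]; exact hx i
  have hWb : ∀ x, ‖W (F x)‖ ≤ b x := fun x =>
    (BoundedContinuousFunction.norm_le (hb0 x)).mpr fun i => by rw [hW]; exact hb x i
  have hint : Integrable (fun x => a x • W (F x)) μ := by
    refine hab.mono' (ha.smul hcont).aestronglyMeasurable (Filter.Eventually.of_forall fun x => ?_)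
    rw [norm_smul]
    exact mul_le_mul_of_nonneg_left (hWb x) (norm_nonneg _)
  have hid : W f₀ = ∫ x, a x • W (F x) ∂μ := by
    ext i
    have h1 := (BoundedContinuousFunction.evalCLM ℂ i).integral_comp_comm hint
    rw [hW, hf₀]
    exact h1
  have hLF : (fun x => a x * L (F x)) = fun x => T (a x • W (F x)) := by
    funext x; rw [map_smul, hTW, smul_eq_mul]
  refine ⟨?_, ?_, ?_⟩
  · simp only [← hTW]; exact T.continuous.comp hcont
  · rw [hLF]; exact T.integrable_comp hint
  · rw [hLF, T.integral_comp_comm hint, ← hid, hTW]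

/-! ### Characters -/

lemma norm_char (ξ x : Rd d) : ‖char ξ x‖ = 1 := by
  rw [char, Complex.norm_exp]; simp

lemma char_comm (ξ x : Rd d) : char ξ x = char x ξ := by
  rw [char, char, real_inner_comm]

lemma char_add (ξ η x : Rd d) : char (ξ + η) x = char ξ x * char η x := by
  rw [char, char, char, ← Complex.exp_add, inner_add_right]
  push_cast; ring_nf

lemma char_add' (ξ x y : Rd d) : char ξ (x + y) = char ξ x * char ξ y := by
  rw [char_comm, char_add, char_comm, char_comm y]

lemma char_zero (x : Rd d) : char 0 x = 1 := by simp [char]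

lemma exp_eq_char_neg (ξ x : Rd d) :
    Complex.exp (Complex.I * (inner ℝ x ξ : ℝ)) = char (-ξ) x := by
  simp [char]

lemma continuous_char (ξ : Rd d) : Continuous (char ξ) := (contDiff_char ξ).continuous

lemma iteratedFDeriv_char_apply (ξ x : Rd d) (n : ℕ) (m : Fin n → Rd d) :
    iteratedFDeriv ℝ n (char ξ) x m =
      ((∏ i, inner ℝ ξ (m i) : ℝ) : ℂ) * ((-Complex.I) ^ n * char ξ x) := by
  rw [char_eq, ContinuousLinearMap.iteratedFDeriv_comp_right _ contDiff_cexp_aux x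
    (i := n) (mod_cast le_top), ContinuousMultilinearMap.compContinuousLinearMap_apply,
    iteratedFDeriv_apply_eq_iteratedDeriv_mul_prod, iteratedDeriv_cexp_aux]
  simp

/-- The character `e^{-i⟨·, ξ⟩}` as an element of the algebra of Gevrey functions. -/
def charGev (hs : 0 < s) (ξ : Rd d) : Gev d s := ⟨char ξ, char_mem_gev hs ξ⟩

/-- Norm continuity of `ξ ↦ e^{-i⟨·,ξ⟩}` on bounded sets. Factor out the character at `ξ₀`; every
derivative of the remaining `e^{-i⟨·,δ⟩} - 1` with `‖δ‖ ≤ 1` is at most `(1 + R)‖δ‖`. -/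
lemma exists_char_sub_le (hs : 0 < s) {h : ℝ} (hh : 0 < h) {R : ℝ} (hR : 0 ≤ R) (ξ₀ : Rd d) :
    ∃ C : ℝ, 0 ≤ C ∧ ∀ ξ : Rd d, ‖ξ - ξ₀‖ ≤ 1 → ∀ (n : ℕ) (y : Rd d), ‖y‖ ≤ R →
      ‖iteratedFDeriv ℝ n (char ξ - char ξ₀) y‖ ≤ C * ‖ξ - ξ₀‖ * (h ^ n * (n ! : ℝ) ^ s) := by
  obtain ⟨C₁, hC₁, hb₁⟩ := exists_pow_le (norm_nonneg ξ₀) (half_pos hh) hs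
  obtain ⟨C₂, hC₂, hb₂⟩ := exists_pow_le zero_le_one (half_pos hh) hs
  refine ⟨C₁ * (1 + R) * C₂, by positivity, fun ξ hξ n y hy => ?_⟩
  set δ := ξ - ξ₀ with hδ
  have e : char ξ - char ξ₀ = fun y => char ξ₀ y * (char δ y - 1) := by
    funext y
    have : ξ = ξ₀ + δ := by rw [hδ]; abel
    rw [Pi.sub_apply, this, char_add]; ring
  have h1 : ∀ n : ℕ, ‖iteratedFDeriv ℝ n (fun y => char δ y - 1) y‖ ≤
      ((1 + R) * C₂ * ‖δ‖) * ((h / 2) ^ n * (n ! : ℝ) ^ s) := by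
    intro n
    have h2 : ‖iteratedFDeriv ℝ n (fun y => char δ y - 1) y‖ ≤ (1 + R) * ‖δ‖ := by
      rcases Nat.eq_zero_or_pos n with rfl | hn
      · rw [norm_iteratedFDeriv_zero]
        have h3 := Real.norm_exp_I_mul_ofReal_sub_one_le (x := -inner ℝ y δ)
        have h4 : Complex.exp (Complex.I * ((-inner ℝ y δ : ℝ) : ℂ)) = char δ y := by
          rw [char]; push_cast; ring_nf
        rw [h4, norm_neg] at h3
        have h5 := norm_inner_le_norm (𝕜 := ℝ) y δ
        have h6 := mul_le_mul_of_nonneg_right hy (norm_nonneg δ)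
        nlinarith [norm_nonneg δ]
      · have h3 : (fun y => char δ y - 1) = char δ - fun _ => (1 : ℂ) := rfl
        rw [h3, iteratedFDeriv_sub_apply ((contDiff_char δ).of_le (mod_cast le_top)).contDiffAt
          contDiff_const.contDiffAt, iteratedFDeriv_const_of_ne hn.ne']
        simp only [Pi.zero_apply, sub_zero]
        have h4 : ‖δ‖ ^ n ≤ ‖δ‖ := pow_le_of_le_one (norm_nonneg δ) hξ hn.ne'
        have := norm_iteratedFDeriv_char_le δ y n
        nlinarith [norm_nonneg δ]
    have h3 := hb₂ n
    rw [one_pow] at h3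
    have h4 := mul_le_mul_of_nonneg_left h3 (show 0 ≤ (1 + R) * ‖δ‖ by positivity)
    linarith
  have := leibniz_bound hs.le (by positivity) (contDiff_char ξ₀)
    ((contDiff_char δ).sub contDiff_const) y
    (fun n => (norm_iteratedFDeriv_char_le ξ₀ y n).trans (hb₁ n)) h1 n
  rw [mul_div_cancel₀ h two_ne_zero] at this
  rw [e]
  refine this.trans (le_of_eq ?_)
  ring

/-! ### Rapid decay and moderate growth -/

/-- `g` decays faster than every stretched exponential of order `1/s`. -/
def RapidDecay (s : ℝ) (g : Rd d → ℂ) : Prop :=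
  ∀ r : ℝ, 0 < r → ∃ C : ℝ, 0 ≤ C ∧ ∀ ξ, ‖g ξ‖ ≤ C * Real.exp (-(r * ‖ξ‖ ^ (1 / s)))

/-- `g` grows at most like a stretched exponential of order `1/s`. -/
def ModerateGrowth (s : ℝ) (g : Rd d → ℂ) : Prop :=
  ∃ r : ℝ, 0 < r ∧ ∃ C : ℝ, 0 ≤ C ∧ ∀ ξ, ‖g ξ‖ ≤ C * Real.exp (r * ‖ξ‖ ^ (1 / s))

lemma RapidDecay.integrable (hs : 0 < s) {g : Rd d → ℂ} (hg : RapidDecay s g)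
    (hc : Continuous g) : Integrable g := by
  obtain ⟨C, -, hC⟩ := hg 1 one_pos
  exact ((integrable_exp_neg_norm_rpow hs one_pos).const_mul C).mono' hc.aestronglyMeasurable
    (Filter.Eventually.of_forall hC)

lemma ModerateGrowth.mul_rapidDecay {f g : Rd d → ℂ} (hf : ModerateGrowth s f)
    (hg : RapidDecay s g) : RapidDecay s (fun ξ => f ξ * g ξ) := by
  obtain ⟨r₀, hr₀, A, hA0, hA⟩ := hf
  intro r hr
  obtain ⟨B, hB0, hB⟩ := hg (r + r₀) (by positivity)
  refine ⟨A * B, by positivity, fun ξ => ?_⟩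
  rw [norm_mul]
  refine (mul_le_mul (hA ξ) (hB ξ) (norm_nonneg _) (by positivity)).trans (le_of_eq ?_)
  have : Real.exp (-(r * ‖ξ‖ ^ (1 / s))) =
      Real.exp (r₀ * ‖ξ‖ ^ (1 / s)) * Real.exp (-((r + r₀) * ‖ξ‖ ^ (1 / s))) := by
    rw [← Real.exp_add]; ring_nf
  rw [this]; ring

lemma RapidDecay.moderateGrowth {g : Rd d → ℂ} (hg : RapidDecay s g) : ModerateGrowth s g := by
  obtain ⟨C, hC0, hC⟩ := hg 1 one_pos
  refine ⟨1, one_pos, C, hC0, fun ξ => (hC ξ).trans ?_⟩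
  gcongr
  have : 0 ≤ ‖ξ‖ ^ (1 / s) := by positivity
  linarith

lemma ModerateGrowth.add {f g : Rd d → ℂ} (hf : ModerateGrowth s f) (hg : ModerateGrowth s g) :
    ModerateGrowth s (fun ξ => f ξ + g ξ) := by
  obtain ⟨r, hr, A, hA0, hA⟩ := hf
  obtain ⟨q, hq, B, hB0, hB⟩ := hg
  refine ⟨r + q, by positivity, A + B, by positivity, fun ξ => ?_⟩
  have hp : 0 ≤ ‖ξ‖ ^ (1 / s) := by positivity
  refine (norm_add_le _ _).trans ?_
  rw [add_mul]
  refine add_le_add ((hA ξ).trans ?_) ((hB ξ).trans ?_) <;> gcongr <;> linarith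

lemma ModerateGrowth.const_mul {f : Rd d → ℂ} (c : ℂ) (hf : ModerateGrowth s f) :
    ModerateGrowth s (fun ξ => c * f ξ) := by
  obtain ⟨r, hr, A, hA0, hA⟩ := hf
  refine ⟨r, hr, ‖c‖ * A, by positivity, fun ξ => ?_⟩
  rw [norm_mul, mul_assoc]
  exact mul_le_mul_of_nonneg_left (hA ξ) (norm_nonneg c)

lemma RapidDecay.comp_neg {g : Rd d → ℂ} (hg : RapidDecay s g) :
    RapidDecay s (fun ξ => g (-ξ)) := fun r hr => by
  obtain ⟨C, hC0, hC⟩ := hg r hr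
  exact ⟨C, hC0, fun ξ => by simpa using hC (-ξ)⟩

lemma RapidDecay.decaysOn {g : Rd d → ℂ} (hg : RapidDecay s g) (Γ : Set (Rd d)) :
    DecaysOn s g Γ := fun r hr => by
  obtain ⟨C, hC0, hC⟩ := hg r hr
  refine ⟨C, fun ξ _ => ?_⟩
  rw [← le_div_iff₀' (Real.exp_pos _), div_eq_mul_inv, ← Real.exp_neg]
  exact hC ξ

/-! ### The Fourier transform of Gelfand-Shilov functions -/

lemma fourierConst_ne_zero (d : ℕ) : fourierConst d ≠ 0 := by
  rw [fourierConst, Complex.ofReal_ne_zero]; positivity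

lemma fourierInv_eq_char (f : Rd d → ℂ) (ξ : Rd d) :
    fourierInv f ξ = fourierConst d * ∫ x, f x * char (-ξ) x := by
  simp only [fourierInv, exp_eq_char_neg]

lemma fourierInv_eq_scaled (f : Rd d → ℂ) (ξ : Rd d) :
    fourierInv f ξ = fourierConst d * 𝓕⁻ f ((2 * Real.pi)⁻¹ • ξ) := by
  rw [fourierInv, Real.fourierInv_eq']
  congr 2
  funext x
  rw [smul_eq_mul, mul_comm, inner_smul_right, ← mul_assoc, mul_inv_cancel₀ (by positivity), one_mul,
    mul_comm Complex.I]

lemma continuous_integral_mul_char {f : Rd d → ℂ} (hf : Integrable f) :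
    Continuous fun ξ : Rd d => ∫ x, f x * char ξ x := by
  refine continuous_of_dominated (bound := fun x => ‖f x‖) (fun ξ => ?_) (fun ξ => ?_) hf.norm ?_
  · exact hf.aestronglyMeasurable.mul (continuous_char ξ).aestronglyMeasurable
  · exact Filter.Eventually.of_forall fun x => by rw [norm_mul, norm_char, mul_one]
  · refine Filter.Eventually.of_forall fun x => ?_
    simp only [char_comm _ x]
    exact continuous_const.mul (continuous_char x)

lemma continuous_fourierInv {f : Rd d → ℂ} (hf : Integrable f) : Continuous (fourierInv f) := by
  have : fourierInv f = fun ξ => fourierConst d * ∫ x, f x * char (-ξ) x :=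
    funext (fourierInv_eq_char f)
  rw [this]
  exact continuous_const.mul ((continuous_integral_mul_char hf).comp continuous_neg)

/-- The Fourier inversion formula. -/
lemma eq_integral_fourierInv_mul_char {f : Rd d → ℂ} (hc : Continuous f) (hf : Integrable f)
    (hf' : Integrable (fourierInv f)) (x : Rd d) :
    f x = fourierConst d * ∫ ξ, fourierInv f ξ * char ξ x := by
  have h2π : (2 * Real.pi)⁻¹ ≠ 0 := by positivity
  have hF : Integrable (𝓕⁻ f) := by
    have h1 : Integrable fun ξ => 𝓕⁻ f ((2 * Real.pi)⁻¹ • ξ) := by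
      refine (hf'.const_mul (fourierConst d)⁻¹).congr (Filter.Eventually.of_forall fun ξ => ?_)
      simp only [fourierInv_eq_scaled, inv_mul_cancel_left₀ (fourierConst_ne_zero d)]
    exact (integrable_comp_smul_iff volume _ h2π).mp h1
  have hF' : Integrable (𝓕 f) := by
    have h1 : 𝓕 f = fun w => 𝓕⁻ f (-w) := by
      funext w; rw [Real.fourierInv_eq_fourier_neg, neg_neg]
    rw [h1]; exact hF.comp_neg
  have h1 := hf.fourier_fourierInv_eq hF' hc.continuousAt (v := x)
  have h2 : ∫ ξ, fourierInv f ξ * char ξ x =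
      fourierConst d * ((2 * Real.pi) ^ d * f x : ℂ) := by
    set G : Rd d → ℂ := fun w => 𝐞 (-inner ℝ w x) • 𝓕⁻ f w with hG
    have h3 : ∀ ξ, fourierInv f ξ * char ξ x = fourierConst d * G ((2 * Real.pi)⁻¹ • ξ) := by
      intro ξ
      rw [fourierInv_eq_scaled, hG, mul_assoc]
      simp only [Circle.smul_def, smul_eq_mul, Real.fourierChar_apply, inner_smul_left]
      rw [mul_comm (𝓕⁻ f _)]
      congr 2
      rw [char_comm, char]
      congr 1
      push_cast
      simp
      field_simp
    simp only [h3]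
    rw [integral_const_mul, Measure.integral_comp_inv_smul_of_nonneg volume G (by positivity),
      finrank_euclideanSpace_fin]
    have h4 : ∫ w, G w = f x := by rw [← h1, Real.fourier_eq]
    rw [h4]
    simp
  -- The dilation by `2π` in the integral produces `(2π)ᵈ`, which the two normalizing factors
  -- cancel.
  have h3 : fourierConst d * fourierConst d * ((2 * Real.pi) ^ d : ℂ) = 1 := by
    rw [fourierConst, ← Complex.ofReal_mul, ← Real.rpow_add (by positivity)]
    have : -(d : ℝ) / 2 + -(d : ℝ) / 2 = -(d : ℝ) := by ring
    rw [this, Real.rpow_neg (by positivity), Real.rpow_natCast]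
    push_cast
    exact inv_mul_cancel₀ (pow_ne_zero _
      (mul_ne_zero two_ne_zero (Complex.ofReal_ne_zero.mpr Real.pi_ne_zero)))
  rw [h2, ← mul_assoc, ← mul_assoc, h3, one_mul]

/-- Integration by parts bounds `‖ξ‖ⁿ` times the transform by integrals of derivatives of order at
most `n`, hence by a multiple of `Hⁿ n!ˢ` for any prescribed `H`; `exists_le_exp_neg` converts these
moments into decay. -/
lemma Sig.rapidDecay_fourierInv (hs : 0 < s) (ht : 0 < t) (f : Sig d t s) :
    RapidDecay s (fourierInv f.1) := by
  intro r hr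
  obtain ⟨H, hH, hdec⟩ := exists_le_exp_neg hs hr
  -- Here `8π = 2π · 2 · 2`: the frequency scaling, the constant `2ⁿ` of the Fourier estimate, and
  -- the number `n + 1 ≤ 2ⁿ` of terms in the sum.
  set h : ℝ := H / (8 * Real.pi) with hh
  have hh0 : 0 < h := by positivity
  obtain ⟨C, hC0, hC⟩ := Sig.exists_decay f ht one_pos hh0
  obtain ⟨C₁, hC₁, hb₁⟩ := exists_pow_le zero_le_one hh0 hs
  set I : ℝ := ∫ x : Rd d, Real.exp (-(1 * ‖x‖ ^ (1 / t))) with hI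
  have hI0 : 0 ≤ I := integral_nonneg fun x => (Real.exp_pos _).le
  set D : ℝ := ‖fourierConst d‖ * (C * I * C₁) with hD
  have hD0 : 0 ≤ D := by positivity
  refine ⟨2 ^ s * D, by positivity, fun ξ =>
    hdec ‖ξ‖ ‖fourierInv f.1 ξ‖ D (norm_nonneg _) (norm_nonneg _) hD0 fun n => ?_⟩
  have hmom : ∀ m ≤ n, ∫ x, ‖iteratedFDeriv ℝ m f.1 x‖ ≤ C * I * C₁ * (h ^ n * (n ! : ℝ) ^ s) := by
    intro m hm
    have h1 : ∫ x, ‖iteratedFDeriv ℝ m f.1 x‖ ≤ C * I * (h ^ m * (m ! : ℝ) ^ s) := by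
      have e : C * I * (h ^ m * (m ! : ℝ) ^ s) =
          ∫ x : Rd d, C * Real.exp (-(1 * ‖x‖ ^ (1 / t))) * (h ^ m * (m ! : ℝ) ^ s) := by
        rw [integral_mul_const, integral_const_mul]
      rw [e]
      refine integral_mono ?_ (((integrable_exp_neg_norm_rpow ht one_pos).const_mul C).mul_const _)
        fun x => hC m x
      simpa using Sig.integrable_pow_mul f ht 0 m
    have h2 : h ^ m * (m ! : ℝ) ^ s ≤ C₁ * (h ^ n * (n ! : ℝ) ^ s) := by
      have h3 := hb₁ (n - m)
      rw [one_pow] at h3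
      have h4 := factorial_rpow_mul_le hs.le hm
      calc h ^ m * (m ! : ℝ) ^ s ≤
            (C₁ * (h ^ (n - m) * (((n - m)! : ℕ) : ℝ) ^ s)) * (h ^ m * (m ! : ℝ) ^ s) :=
            le_mul_of_one_le_left (by positivity) h3
        _ = C₁ * (h ^ n * ((m ! : ℝ) ^ s * (((n - m)! : ℕ) : ℝ) ^ s)) := by
            rw [← Nat.add_sub_cancel' hm, pow_add, Nat.add_sub_cancel' hm]; ring
        _ ≤ _ := by gcongr
    have := mul_le_mul_of_nonneg_left h2 (show 0 ≤ C * I by positivity)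
    linarith
  set w : Rd d := (2 * Real.pi)⁻¹ • ξ with hw
  have hwn : ‖ξ‖ = 2 * Real.pi * ‖w‖ := by
    rw [hw, norm_smul, norm_inv, Real.norm_of_nonneg (by positivity : 0 ≤ 2 * Real.pi),
      mul_inv_cancel_left₀ (by positivity)]
  have h1 := Real.pow_mul_norm_iteratedFDeriv_fourier_le (K := ⊤) (N := ⊤) (k := 0) (n := n)
    f.2.1 (fun k n _ _ => Sig.integrable_pow_mul f ht k n) le_top le_top (-w)
  rw [norm_iteratedFDeriv_zero, ← Real.fourierInv_eq_fourier_neg, norm_neg] at h1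
  simp only [pow_zero, one_mul, Nat.cast_zero, mul_zero, zero_add, Finset.range_one,
    Finset.singleton_product, Finset.sum_map, Function.Embedding.coeFn_mk] at h1
  have h2 : ∑ m ∈ Finset.range (n + 1), ∫ x, ‖iteratedFDeriv ℝ m f.1 x‖ ≤
      2 ^ n * (C * I * C₁ * (h ^ n * (n ! : ℝ) ^ s)) := by
    refine (Finset.sum_le_sum fun m hm => hmom m (Nat.lt_succ_iff.mp (Finset.mem_range.mp hm))).trans
      ?_
    rw [Finset.sum_const, Finset.card_range, nsmul_eq_mul]
    refine mul_le_mul_of_nonneg_right ?_ (by positivity)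
    exact_mod_cast Nat.lt_two_pow_self
  have h3 := h1.trans (mul_le_mul_of_nonneg_left h2 (by positivity))
  rw [fourierInv_eq_scaled, norm_mul, hwn, mul_pow]
  have h4 := mul_le_mul_of_nonneg_left h3
    (show 0 ≤ (2 * Real.pi) ^ n * ‖fourierConst d‖ by positivity)
  have h5 : H ^ n = (2 * Real.pi) ^ n * 2 ^ n * 2 ^ n * h ^ n := by
    rw [← mul_pow, ← mul_pow, ← mul_pow, hh]; congr 1; field_simp; norm_num
  rw [h5, hD]
  linarith

lemma Sig.integrable_fourierInv (hs : 0 < s) (ht : 0 < t) (f : Sig d t s) :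
    Integrable (fourierInv f.1) :=
  (Sig.rapidDecay_fourierInv hs ht f).integrable hs (continuous_fourierInv (Sig.integrable f ht))

lemma Sig.eq_integral (hs : 0 < s) (ht : 0 < t) (f : Sig d t s) (x : Rd d) :
    f.1 x = fourierConst d * ∫ ξ, fourierInv f.1 ξ * char ξ x :=
  eq_integral_fourierInv_mul_char f.2.1.continuous (Sig.integrable f ht)
    (Sig.integrable_fourierInv hs ht f) x

/-- Differentiation under the integral in the inversion formula, allowed because all moments of the
transform are integrable. -/
lemma Sig.iteratedFDeriv_eq_integral (hs : 0 < s) (ht : 0 < t) (f : Sig d t s) (n : ℕ) (x : Rd d)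
    (m : Fin n → Rd d) : iteratedFDeriv ℝ n f.1 x m =
      ∫ ξ, fourierConst d * fourierInv f.1 ξ * iteratedFDeriv ℝ n (char ξ) x m := by
  set G := fourierInv f.1 with hG
  have hGc : Continuous G := continuous_fourierInv (Sig.integrable f ht)
  -- The pairing is scaled so that the standard character `𝐞 (-L ξ y)` is `e^{-i⟨y,ξ⟩}`, and the
  -- general results on vector Fourier integrals apply.
  obtain ⟨L, hLa⟩ : ∃ L : Rd d →L[ℝ] Rd d →L[ℝ] ℝ,
      ∀ ξ y, L ξ y = (2 * Real.pi)⁻¹ * inner ℝ ξ y :=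
    ⟨(2 * Real.pi)⁻¹ • innerSL ℝ, fun ξ y => rfl⟩
  have hmom : ∀ k : ℕ, (k : ℕ∞) ≤ ⊤ → Integrable fun ξ => ‖ξ‖ ^ k * ‖G ξ‖ := by
    intro k _
    obtain ⟨A, hA0, hA⟩ := exists_pow_le_exp hs one_pos k
    have hmg : ModerateGrowth s (fun ξ : Rd d => ((‖ξ‖ ^ k : ℝ) : ℂ)) :=
      ⟨1, one_pos, A, hA0.le, fun ξ => by
        rw [Complex.norm_real, Real.norm_of_nonneg (by positivity)]
        exact (pow_le_pow_left₀ (norm_nonneg ξ) (by linarith [norm_nonneg ξ]) k).trans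
          (hA _ (norm_nonneg ξ))⟩
    have := ((hmg.mul_rapidDecay (Sig.rapidDecay_fourierInv hs ht f)).integrable hs
      (((Complex.continuous_ofReal.comp (continuous_norm.pow k))).mul hGc)).norm
    refine this.congr (Filter.Eventually.of_forall fun ξ => ?_)
    simp only [norm_mul, Complex.norm_real, norm_pow, norm_norm, hG]
  have hchar : ∀ ξ y : Rd d, ((𝐞 (-L ξ y) : Circle) : ℂ) = char ξ y := by
    intro ξ y
    rw [Real.fourierChar_apply, hLa, char_comm, char]
    congr 1
    push_cast
    have : (Real.pi : ℂ) ≠ 0 := by exact_mod_cast Real.pi_ne_zero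
    field_simp
  have hfG : f.1 = fourierConst d • VectorFourier.fourierIntegral 𝐞 volume L.toLinearMap₁₂ G := by
    funext y
    rw [Sig.eq_integral hs ht f y, Pi.smul_apply, smul_eq_mul, VectorFourier.fourierIntegral]
    congr 2
    funext ξ
    rw [Circle.smul_def, smul_eq_mul, mul_comm]
    congr 1
    exact (hchar ξ y).symm
  have hsm : ContDiff ℝ n (VectorFourier.fourierIntegral 𝐞 volume L.toLinearMap₁₂ G) :=
    VectorFourier.contDiff_fourierIntegral L (N := n) fun k _ => hmom k le_top
  have hint : Integrable (fun ξ => 𝐞 (-L ξ x) • VectorFourier.fourierPowSMulRight L G ξ n) := by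
    have h1 : Integrable (fun ξ => VectorFourier.fourierPowSMulRight L G ξ n) :=
      VectorFourier.integrable_fourierPowSMulRight L (hmom n le_top) hGc.aestronglyMeasurable
    exact (VectorFourier.fourierIntegral_convergent_iff Real.continuous_fourierChar
      (by apply L.continuous₂ : Continuous fun p : Rd d × Rd d => L.toLinearMap₁₂ p.1 p.2) x).2 h1
  have h1 : iteratedFDeriv ℝ n f.1 x m = fourierConst d * (iteratedFDeriv ℝ n
      (VectorFourier.fourierIntegral 𝐞 volume L.toLinearMap₁₂ G) x m) := by
    rw [hfG, iteratedFDeriv_const_smul_apply hsm.contDiffAt]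
    rfl
  have h2 : iteratedFDeriv ℝ n (VectorFourier.fourierIntegral 𝐞 volume L.toLinearMap₁₂ G) x m =
      ∫ ξ, (𝐞 (-L ξ x) • VectorFourier.fourierPowSMulRight L G ξ n) m := by
    rw [VectorFourier.iteratedFDeriv_fourierIntegral L hmom hGc.aestronglyMeasurable
      (le_top : (n : ℕ∞) ≤ ⊤)]
    exact ((ContinuousMultilinearMap.apply ℝ (fun _ : Fin n => Rd d) ℂ m).integral_comp_comm
      hint).symm
  rw [h1, h2, ← integral_const_mul]
  congr 1
  funext ξ
  rw [Circle.smul_def, smul_apply, VectorFourier.fourierPowSMulRight_apply,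
    iteratedFDeriv_char_apply, hchar]
  simp only [smul_eq_mul, hLa, Finset.prod_mul_distrib, Finset.prod_const, Finset.card_univ,
    Fintype.card_fin, Complex.real_smul]
  have h3 : (-(2 * Real.pi * Complex.I) : ℂ) ^ n * ((2 * Real.pi : ℂ)⁻¹) ^ n = (-Complex.I) ^ n := by
    rw [← mul_pow]
    congr 1
    have : (Real.pi : ℂ) ≠ 0 := by exact_mod_cast Real.pi_ne_zero
    field_simp
  rw [← h3]
  push_cast
  ring

/-! ### Parseval's formula for localized ultradistributions -/

/-- The normalized derivative `f ↦ Dⁿ f(y)(m) / (hⁿ n!ˢ ∏ |mᵢ|)`. -/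
def normalizedDeriv (s h : ℝ) (y : Rd d) (p : Σ n : ℕ, Fin n → Rd d) : Gev d s →ₗ[ℂ] ℂ where
  toFun f := (((h ^ p.1 * (p.1 ! : ℝ) ^ s) * ∏ i, ‖p.2 i‖)⁻¹ : ℝ) *
    iteratedFDeriv ℝ p.1 f.1 y p.2
  map_add' f g := by
    have : iteratedFDeriv ℝ p.1 (f + g).1 y =
        iteratedFDeriv ℝ p.1 f.1 y + iteratedFDeriv ℝ p.1 g.1 y :=
      iteratedFDeriv_add_apply ((f.2.1.of_le (mod_cast le_top)).contDiffAt)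
        ((g.2.1.of_le (mod_cast le_top)).contDiffAt)
    rw [this, add_apply, mul_add]
  map_smul' c f := by
    have : iteratedFDeriv ℝ p.1 (c • f).1 y = c • iteratedFDeriv ℝ p.1 f.1 y :=
      iteratedFDeriv_const_smul_apply ((f.2.1.of_le (mod_cast le_top)).contDiffAt)
    rw [this, smul_apply, smul_eq_mul, RingHom.id_apply, smul_eq_mul]
    ring

lemma normalizedDeriv_apply (h : ℝ) (y : Rd d) (p : Σ n : ℕ, Fin n → Rd d) (f : Gev d s) :
    normalizedDeriv s h y p f = (((h ^ p.1 * (p.1 ! : ℝ) ^ s) * ∏ i, ‖p.2 i‖)⁻¹ : ℝ) *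
      iteratedFDeriv ℝ p.1 f.1 y p.2 := rfl

lemma norm_normalizedDeriv_le {h : ℝ} (hh : 0 < h) {y : Rd d} {f : Gev d s} {M : ℝ} (hM : 0 ≤ M)
    {p : Σ n : ℕ, Fin n → Rd d}
    (hf : ‖iteratedFDeriv ℝ p.1 f.1 y‖ ≤ M * (h ^ p.1 * (p.1 ! : ℝ) ^ s)) :
    ‖normalizedDeriv s h y p f‖ ≤ M := by
  rw [normalizedDeriv_apply, norm_mul, Complex.norm_real, norm_inv, Real.norm_of_nonneg
    (by positivity)]
  refine inv_mul_le_of_le_mul₀ (by positivity) hM ?_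
  refine ((iteratedFDeriv ℝ p.1 f.1 y).le_opNorm p.2).trans ?_
  have := mul_le_mul_of_nonneg_right hf (show 0 ≤ ∏ i, ‖p.2 i‖ by positivity)
  linarith

lemma norm_iteratedFDeriv_le_of_normalizedDeriv {h : ℝ} (hh : 0 < h) {y : Rd d} {f : Gev d s}
    {M : ℝ} (hM : 0 ≤ M) (n : ℕ)
    (hf : ∀ m : Fin n → Rd d, ‖normalizedDeriv s h y ⟨n, m⟩ f‖ ≤ M) :
    ‖iteratedFDeriv ℝ n f.1 y‖ ≤ M * (h ^ n * (n ! : ℝ) ^ s) := by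
  refine ContinuousMultilinearMap.opNorm_le_bound (by positivity) fun m => ?_
  by_cases hm : ∃ i, m i = 0
  · obtain ⟨i, hi⟩ := hm
    rw [ContinuousMultilinearMap.map_coord_zero _ i hi, norm_zero]
    positivity
  · push Not at hm
    have hprod : 0 < ∏ i, ‖m i‖ := Finset.prod_pos fun i _ => norm_pos_iff.mpr (hm i)
    have h1 := hf m
    rw [normalizedDeriv_apply, norm_mul, Complex.norm_real, norm_inv, Real.norm_of_nonneg
      (by positivity), inv_mul_le_iff₀ (by positivity)] at h1
    refine h1.trans (le_of_eq (by ring))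

/-- Since `v` is continuous for one norm with parameter `h`, it suffices to estimate that norm of a
character, and `‖η‖ⁿ ≤ hⁿ n!ˢ exp(r‖η‖^{1/s})` with `r` depending on `h`. -/
lemma GevreyDual.moderateGrowth_cutoff_char (hs : 0 < s) (v : GevreyDual d s) (χ : GevreyC d s) :
    ModerateGrowth s (fun η => v.cutoff hs χ (charGev hs η)) := by
  obtain ⟨h, hh, C, hC0, hC⟩ := v.exists_cutoff_le hs χ
  refine ⟨s * (1 / h) ^ (1 / s), by positivity, C, hC0, fun η => ?_⟩
  refine hC _ _ (Real.exp_pos _).le fun n x _ => ?_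
  refine (norm_iteratedFDeriv_char_le η x n).trans ?_
  rw [mul_comm]
  exact pow_le_exp_rpow hs hh (norm_nonneg η) n

/-- Parseval's formula for a localized ultradistribution. -/
theorem GevreyDual.cutoff_parseval (hs : 0 < s) (ht : 0 < t) (v : GevreyDual d s) (χ : GevreyC d s)
    (f : Sig d t s) :
    Continuous (fun η => v.cutoff hs χ (charGev hs η)) ∧
      v.cutoff hs χ ⟨f.1, Sig.mem_gev f⟩ =
        ∫ η, fourierConst d * fourierInv f.1 η * v.cutoff hs χ (charGev hs η) := by
  obtain ⟨h, hh, C, hC0, hC⟩ := v.exists_cutoff_le hs χ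
  obtain ⟨R, hR⟩ := (show IsCompact (tsupport χ.1) from χ.2.2.1).isBounded.exists_norm_le
  set r : ℝ := s * (1 / h) ^ (1 / s) with hr
  have hGc : Continuous (fourierInv f.1) := continuous_fourierInv (Sig.integrable f ht)
  -- The norm that controls the localized functional is the supremum of the normalized derivatives
  -- at points of the support of `χ`. For each of these the integral formula is the differentiated
  -- Fourier inversion formula, so it passes to the functional itself.
  have key := map_integral_of_bounded (E := Gev d s) (X := Rd d)
    (ι := tsupport χ.1 × (Σ n : ℕ, Fin n → Rd d)) volume
    (fun i => normalizedDeriv s h i.1 i.2) (fun g => by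
      obtain ⟨M, hM⟩ := g.2.2 h hh
      exact ⟨M, fun i => norm_normalizedDeriv_le hh hM.nonneg (hM _ _)⟩)
    (v.cutoff hs χ) C (fun g M hM hg => hC g M hM fun n x hx =>
      norm_iteratedFDeriv_le_of_normalizedDeriv hh hM n fun m => hg (⟨x, hx⟩, ⟨n, m⟩))
    (a := fun η => fourierConst d * fourierInv f.1 η) (continuous_const.mul hGc)
    (F := charGev hs) (fun η₀ ε hε => by
      obtain ⟨A, hA0, hA⟩ := exists_char_sub_le hs hh (abs_nonneg R) η₀
      have hδ : 0 < min 1 (ε / (A + 1)) := by positivity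
      filter_upwards [Metric.ball_mem_nhds η₀ hδ] with η hη i
      rw [mem_ball_iff_norm] at hη
      have h1 : ‖η - η₀‖ ≤ 1 := hη.le.trans (min_le_left _ _)
      have h2 : ‖η - η₀‖ ≤ ε / (A + 1) := hη.le.trans (min_le_right _ _)
      refine norm_normalizedDeriv_le hh hε.le ((hA η h1 i.2.1 i.1
        ((hR _ i.1.2).trans (le_abs_self R))).trans ?_)
      refine mul_le_mul_of_nonneg_right ?_ (by positivity)
      rw [le_div_iff₀ (by positivity)] at h2
      nlinarith [norm_nonneg (η - η₀)])
    (b := fun η => Real.exp (r * ‖η‖ ^ (1 / s))) (fun η => (Real.exp_pos _).le)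
    (fun η i => norm_normalizedDeriv_le hh (Real.exp_pos _).le
      ((norm_iteratedFDeriv_char_le η _ _).trans (by
        rw [mul_comm (Real.exp _)]
        exact pow_le_exp_rpow hs hh (norm_nonneg η) _)))
    (by
      have hmg : ModerateGrowth s (fun η : Rd d =>
          fourierConst d * ((Real.exp (r * ‖η‖ ^ (1 / s)) : ℝ) : ℂ)) :=
        ModerateGrowth.const_mul _ ⟨r, by positivity, 1, zero_le_one, fun η => by
          rw [Complex.norm_real, Real.norm_of_nonneg (Real.exp_pos _).le, one_mul]⟩
      have hcn : Continuous fun x : Rd d => ‖x‖ ^ (1 / s) :=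
        continuous_norm.rpow_const fun _ => Or.inr (by positivity)
      have := ((hmg.mul_rapidDecay (Sig.rapidDecay_fourierInv hs ht f)).integrable hs
        ((continuous_const.mul (Complex.continuous_ofReal.comp
          (Real.continuous_exp.comp (continuous_const.mul hcn)))).mul hGc)).norm
      refine this.congr (Filter.Eventually.of_forall fun η => ?_)
      simp only [norm_mul, Complex.norm_real, Real.norm_of_nonneg (Real.exp_pos _).le]
      ring)
    (f₀ := ⟨f.1, Sig.mem_gev f⟩) (fun i => by
      rw [normalizedDeriv_apply, Sig.iteratedFDeriv_eq_integral hs ht, ← integral_const_mul]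
      congr 1
      funext η
      rw [normalizedDeriv_apply]
      change _ = _ * (_ * iteratedFDeriv ℝ i.2.1 (char η) i.1 i.2.2)
      ring)
  exact ⟨key.1, key.2.2⟩

/-- The continuity statement in Parseval's formula involves no test function, so `f = 0` and `t = 1`
serve. -/
lemma GevreyDual.continuous_cutoff_char (hs : 0 < s) (v : GevreyDual d s) (χ : GevreyC d s) :
    Continuous (fun η => v.cutoff hs χ (charGev hs η)) :=
  (v.cutoff_parseval hs one_pos χ (0 : Sig d 1 s)).1

/-! ### The Fourier transform of an element of `E_s' + Σ_t^s` -/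

lemma SigDual.MemCompactAddSig.exists_rep {ht : 0 < t} (hs : 1 < s) {u : SigDual d t s}
    (hu : u.MemCompactAddSig ht) :
    ∃ (v : GevreyDual d s) (w : Sig d t s) (χ : GevreyC d s) (K O : Set (Rd d)),
      IsOpen O ∧ K ⊆ O ∧ (∀ ϕ : GevreyC d s, tsupport ϕ.1 ⊆ Kᶜ → v.toLin ϕ = 0) ∧
      (∀ x ∈ O, χ.1 x = 1) ∧
      (∀ ϕ : GevreyC d s, (u.toGevreyDual ht).toLin ϕ = v.toLin ϕ + ∫ x, w.1 x * ϕ.1 x) ∧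
      ∀ f : Sig d t s, u.toLin f =
        v.cutoff (zero_lt_one.trans hs) χ ⟨f.1, Sig.mem_gev f⟩ + ∫ x, w.1 x * f.1 x := by
  obtain ⟨v, ⟨K, hK, hv⟩, w, hw⟩ := hu
  obtain ⟨χ₀, hχ₀⟩ := exists_cutoff d hs
  obtain ⟨R, hR⟩ := hK.isBounded.exists_norm_le
  have hR1 : 1 ≤ max 1 (R + 1) := le_max_left _ _
  have hR0 : 0 < max 1 (R + 1) := by linarith
  have hχ : ∀ x ∈ Metric.ball (0 : Rd d) (max 1 (R + 1)), (GevreyC.dilate χ₀ hR1).1 x = 1 := by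
    intro x hx
    refine hχ₀ _ ?_
    rw [norm_smul, norm_inv, Real.norm_of_nonneg hR0.le, inv_mul_le_iff₀ hR0, mul_one]
    exact (mem_ball_zero_iff.mp hx).le
  have hKO : K ⊆ Metric.ball (0 : Rd d) (max 1 (R + 1)) := fun x hx => mem_ball_zero_iff.mpr
    (lt_of_lt_of_le (by linarith [hR x hx]) (le_max_right _ _))
  exact ⟨v, w, GevreyC.dilate χ₀ hR1, K, _, Metric.isOpen_ball, hKO, hv, hχ, hw,
    SigDual.eq_cutoff_add_integral hs ht hK hv Metric.isOpen_ball hKO hw hχ⟩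

lemma integral_mul_char_eq (f : Rd d → ℂ) (η : Rd d) :
    ∫ x, f x * char η x = (fourierConst d)⁻¹ * fourierInv f (-η) := by
  rw [fourierInv_eq_char, neg_neg, inv_mul_cancel_left₀ (fourierConst_ne_zero d)]

/-- Insert the inversion formula for `f` and interchange the integrals. -/
lemma Sig.integral_mul_eq (hs : 0 < s) (ht : 0 < t) (w f : Sig d t s) :
    ∫ x, w.1 x * f.1 x = ∫ η, fourierInv w.1 (-η) * fourierInv f.1 η := by
  have hF := Sig.integrable_fourierInv hs ht f
  have h1 : ∀ x, w.1 x * f.1 x =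
      ∫ η, fourierConst d * (w.1 x * (fourierInv f.1 η * char η x)) := fun x => by
    rw [integral_const_mul, integral_const_mul, Sig.eq_integral hs ht f x]; ring
  have h2 : ∀ η, fourierInv w.1 (-η) * fourierInv f.1 η =
      ∫ x, fourierConst d * (w.1 x * (fourierInv f.1 η * char η x)) := fun η => by
    rw [integral_const_mul, fourierInv_eq_char, neg_neg, mul_assoc, ← integral_mul_const]
    congr 2
    funext x
    ring
  simp only [h1, h2]
  refine integral_integral_swap ?_
  have h3 : Integrable (fun p : Rd d × Rd d => w.1 p.1 * fourierInv f.1 p.2)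
      (volume.prod volume) := (Sig.integrable w ht).mul_prod hF
  have h4 : Continuous fun p : Rd d × Rd d => char p.2 p.1 := by
    unfold char; fun_prop
  refine ((h3.mul_bdd (c := 1) h4.aestronglyMeasurable (Filter.Eventually.of_forall fun p =>
    (norm_char _ _).le)).const_mul (fourierConst d)).congr (Filter.Eventually.of_forall fun p => ?_)
  simp only [Function.uncurry]
  ring

/-- The Fourier transform of `χ v + w`. -/
def fourierSum (hs : 0 < s) (v : GevreyDual d s) (χ : GevreyC d s) (w : Sig d t s) (η : Rd d) : ℂ :=
  fourierConst d * v.cutoff hs χ (charGev hs η) + fourierInv w.1 (-η)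

lemma moderateGrowth_fourierSum (hs : 0 < s) (ht : 0 < t) (v : GevreyDual d s) (χ : GevreyC d s)
    (w : Sig d t s) :
    ModerateGrowth s (fourierSum hs v χ w) :=
  ((v.moderateGrowth_cutoff_char hs χ).const_mul _).add
    (Sig.rapidDecay_fourierInv hs ht w).comp_neg.moderateGrowth

lemma continuous_fourierSum (hs : 0 < s) (ht : 0 < t) (v : GevreyDual d s) (χ : GevreyC d s)
    (w : Sig d t s) :
    Continuous (fourierSum hs v χ w) :=
  (continuous_const.mul (v.continuous_cutoff_char hs χ)).add
    ((continuous_fourierInv (Sig.integrable w ht)).comp continuous_neg)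

lemma hasFourierTransform_fourierSum (hs : 0 < s) (ht : 0 < t) (v : GevreyDual d s) (χ : GevreyC d s)
    (w : Sig d t s) {u : SigDual d t s}
    (hu : ∀ f : Sig d t s, u.toLin f =
      v.cutoff hs χ ⟨f.1, Sig.mem_gev f⟩ + ∫ x, w.1 x * f.1 x) :
    u.HasFourierTransform (fourierSum hs v χ w) := by
  refine ⟨continuous_fourierSum hs ht v χ w, fun f => ?_⟩
  have hfd := Sig.rapidDecay_fourierInv hs ht f
  have hfc := continuous_fourierInv (Sig.integrable f ht)
  have hA : Integrable (fun η => fourierConst d * v.cutoff hs χ (charGev hs η) *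
      fourierInv f.1 η) :=
    (((v.moderateGrowth_cutoff_char hs χ).const_mul _).mul_rapidDecay hfd).integrable hs
      ((continuous_const.mul (v.continuous_cutoff_char hs χ)).mul hfc)
  have hB : Integrable (fun η => fourierInv w.1 (-η) * fourierInv f.1 η) :=
    ((Sig.rapidDecay_fourierInv hs ht w).comp_neg.moderateGrowth.mul_rapidDecay hfd).integrable hs
      (((continuous_fourierInv (Sig.integrable w ht)).comp continuous_neg).mul hfc)
  refine ⟨((moderateGrowth_fourierSum hs ht v χ w).mul_rapidDecay hfd).integrable hs
    ((continuous_fourierSum hs ht v χ w).mul hfc), ?_⟩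
  simp only [fourierSum, add_mul]
  rw [hu, integral_add hA hB, Sig.integral_mul_eq hs ht, (v.cutoff_parseval hs ht χ f).2]
  congr 2
  funext η
  ring

/-! ### The short-time Fourier transform -/

section Stft

variable (hs : 0 < s) (ht : 0 < t) {u : SigDual d t s} (ψ : Sig d t s)

lemma fourierInv_mul_char (f : Rd d → ℂ) (ξ η : Rd d) :
    fourierInv (fun y => char ξ y * f y) η = fourierInv f (η - ξ) := by
  rw [fourierInv_eq_char, fourierInv_eq_char]
  congr 2
  funext y
  rw [show -(η - ξ) = ξ + -η by abel, char_add]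
  ring

lemma fourierInv_translate (f : Rd d → ℂ) (x η : Rd d) :
    fourierInv (fun y => f (y - x)) η = char (-η) x * fourierInv f η := by
  rw [fourierInv_eq_char, fourierInv_eq_char,
    ← integral_add_right_eq_self (fun y => f (y - x) * char (-η) y) x, mul_left_comm,
    ← integral_const_mul (char (-η) x)]
  congr 2
  funext y
  rw [add_sub_cancel_right, char_add']
  ring

lemma fourierInv_stft_test (x ξ η : Rd d) :
    fourierInv (Sig.mulChar hs (Sig.translate ht (Sig.conj ψ) x) ξ).1 η =
      char (ξ - η) x * fourierInv (Sig.conj ψ).1 (η - ξ) := by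
  have h1 := fourierInv_mul_char (fun y => (Sig.conj ψ).1 (y - x)) ξ η
  rw [fourierInv_translate, neg_sub] at h1
  exact h1

variable {ψ}

/-- Integrability against transforms of test functions is part of `HasFourierTransform`; the
untranslated modulated window is the test function to use. -/
lemma SigDual.HasFourierTransform.integrable_mul_window {g : Rd d → ℂ}
    (hg : u.HasFourierTransform g) (hs : 0 < s) (ht : 0 < t) (ψ : Sig d t s) (ξ : Rd d) :
    Integrable fun η => g η * fourierInv (Sig.conj ψ).1 (η - ξ) := by
  have h1 := (hg.2 (Sig.mulChar hs (Sig.translate ht (Sig.conj ψ) 0) ξ)).1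
  refine h1.congr (Filter.Eventually.of_forall fun η => ?_)
  simp only [fourierInv_stft_test]
  simp [char]

/-- On the Fourier side modulation by `ξ` shifts the window and translation by `x` multiplies it by
a character. That character turns the pairing with `g` into an inverse Fourier transform at `x`. -/
lemma SigDual.HasFourierTransform.stft_eq {g : Rd d → ℂ} (hg : u.HasFourierTransform g)
    (x ξ : Rd d) :
    u.stft ht hs ψ x ξ =
      char ξ x * fourierInv (fun η => g η * fourierInv (Sig.conj ψ).1 (η - ξ)) x := by
  rw [SigDual.stft, (hg.2 _).2, fourierInv_eq_char, mul_left_comm, ← integral_const_mul (char ξ x)]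
  congr 2
  funext η
  rw [fourierInv_stft_test, sub_eq_add_neg ξ η, char_add, char_comm (-x) η]
  have : char (-η) x = char η (-x) := by simp [char]
  rw [this]
  ring

lemma SigDual.HasFourierTransform.norm_stft_le {g : Rd d → ℂ} (hg : u.HasFourierTransform g)
    {G : Rd d → ℝ} (hG : Integrable G) (x ξ : Rd d)
    (h : ∀ η, ‖g η‖ * ‖fourierInv (Sig.conj ψ).1 (η - ξ)‖ ≤ G η) :
    ‖u.stft ht hs ψ x ξ‖ ≤ ‖fourierConst d‖ * ∫ η, G η := by
  rw [hg.stft_eq hs ht, fourierInv_eq_char, norm_mul, norm_char, one_mul, norm_mul]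
  refine mul_le_mul_of_nonneg_left ?_ (norm_nonneg _)
  refine norm_integral_le_of_norm_le hG (Filter.Eventually.of_forall fun η => ?_)
  rw [norm_mul, norm_mul, norm_char, mul_one]
  exact h η

/-- Fourier inversion in the space variable applied to `stft_eq`: pointwise values of `g` are
recovered wherever the shifted window transform does not vanish. -/
lemma SigDual.HasFourierTransform.mul_window_eq {g : Rd d → ℂ} (hg : u.HasFourierTransform g)
    {ξ : Rd d} (hint : Integrable fun x => u.stft ht hs ψ x ξ) (η : Rd d) :
    g η * fourierInv (Sig.conj ψ).1 (η - ξ) =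
      fourierConst d * ∫ x, (char (-ξ) x * u.stft ht hs ψ x ξ) * char x η := by
  have hcan : ∀ x, char (-ξ) x * char ξ x = 1 := fun x => by
    rw [← char_add, neg_add_cancel, char_zero]
  have e : ∀ x, fourierInv (fun η => g η * fourierInv (Sig.conj ψ).1 (η - ξ)) x =
      char (-ξ) x * u.stft ht hs ψ x ξ := fun x => by
    rw [hg.stft_eq hs ht, ← mul_assoc, hcan, one_mul]
  have hF := hg.integrable_mul_window hs ht ψ ξ
  have hc : Continuous fun η => g η * fourierInv (Sig.conj ψ).1 (η - ξ) :=
    hg.1.mul ((continuous_fourierInv (Sig.integrable _ ht)).comp (continuous_id.sub continuous_const))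
  have hI : Integrable (fourierInv fun η => g η * fourierInv (Sig.conj ψ).1 (η - ξ)) := by
    have e' := funext e
    rw [e']
    refine hint.bdd_mul (c := 1) (continuous_char _).aestronglyMeasurable
      (Filter.Eventually.of_forall fun x => (norm_char _ _).le)
  have := eq_integral_fourierInv_mul_char hc hF hI η
  simp only [e] at this
  exact this

lemma exists_window_ne_zero (hs : 0 < s) (ht : 0 < t) (hψ : ψ ≠ 0) :
    ∃ ζ, fourierInv (Sig.conj ψ).1 ζ ≠ 0 := by
  by_contra! h
  refine hψ (Subtype.ext (funext fun x => ?_))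
  have h1 := Sig.eq_integral hs ht (Sig.conj ψ) x
  simp only [h, zero_mul, integral_zero, mul_zero] at h1
  exact (map_eq_zero (starRingEnd ℂ)).mp h1

/-- The short-time Fourier transform grows moderately in frequency and decays rapidly in space. -/
lemma exists_norm_stft_le {v : GevreyDual d s} {χ : GevreyC d s} {w : Sig d t s}
    (hu : ∀ f : Sig d t s, u.toLin f =
      v.cutoff hs χ ⟨f.1, Sig.mem_gev f⟩ + ∫ x, w.1 x * f.1 x) :
    ∃ r₀ : ℝ, 0 < r₀ ∧ ∀ r : ℝ, 0 < r → ∃ C : ℝ, 0 ≤ C ∧ ∀ x ξ : Rd d,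
      ‖u.stft ht hs ψ x ξ‖ ≤
        C * Real.exp (r₀ * ‖ξ‖ ^ (1 / s)) * Real.exp (-(r * ‖x‖ ^ (1 / t))) := by
  obtain ⟨h, hh, C, hC0, hC⟩ := v.exists_cutoff_le hs χ
  obtain ⟨R, hR⟩ := (show IsCompact (tsupport χ.1) from χ.2.2.1).isBounded.exists_norm_le
  -- The frequency rate depends only on the continuity constant of the localized `v`, and is fixed
  -- before `r`; the later comparisons need this order of the quantifiers.
  set r₀ : ℝ := s * (1 / (h / 2)) ^ (1 / s) with hr₀
  refine ⟨r₀, by positivity, fun r hr => ?_⟩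
  set q : ℝ := r * 2 ^ (1 / t) with hq
  have hq0 : 0 < q := by positivity
  have htri : ∀ x y z : Rd d, ‖x‖ ≤ ‖y‖ + ‖z‖ →
      r * ‖x‖ ^ (1 / t) ≤ q * ‖y‖ ^ (1 / t) + q * ‖z‖ ^ (1 / t) := by
    intro x y z h
    have h1 := (Real.rpow_le_rpow (norm_nonneg x) h (by positivity)).trans
      (rpow_add_le_two_rpow (norm_nonneg y) (norm_nonneg z) (by positivity : 0 ≤ 1 / t))
    have h2 := mul_le_mul_of_nonneg_left h1 hr.le
    rw [hq]; linarith
  obtain ⟨D, hD0, hD⟩ := Sig.exists_decay (Sig.conj ψ) ht hq0 (half_pos hh)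
  -- A rate `q` is used up in the triangle inequality that produces decay in `x`; the additional `1`
  -- keeps the integral over `y` finite.
  obtain ⟨A, hA0, hA⟩ := Sig.exists_norm_le w ht (show 0 < q + 1 by positivity)
  set I : ℝ := ∫ y : Rd d, Real.exp (-(1 * ‖y‖ ^ (1 / t))) with hI
  have hI0 : 0 ≤ I := integral_nonneg fun x => (Real.exp_pos _).le
  refine ⟨‖fourierConst d‖ * (C * (D * Real.exp (q * |R| ^ (1 / t))) + A * D * I),
    by positivity, fun x ξ => ?_⟩
  set f : Sig d t s := Sig.mulChar hs (Sig.translate ht (Sig.conj ψ) x) ξ with hf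
  set E := Real.exp (r₀ * ‖ξ‖ ^ (1 / s)) with hE
  set X := Real.exp (-(r * ‖x‖ ^ (1 / t))) with hX
  have hE1 : 1 ≤ E := Real.one_le_exp (by positivity)
  have hX0 : 0 < X := Real.exp_pos _
  have h1 : ‖v.cutoff hs χ ⟨f.1, Sig.mem_gev f⟩‖ ≤
      C * (E * (D * Real.exp (q * |R| ^ (1 / t)) * X)) := by
    refine hC _ _ (by positivity) fun n y hy => ?_
    have h2 : ∀ n : ℕ, ‖iteratedFDeriv ℝ n (fun y => (Sig.conj ψ).1 (y - x)) y‖ ≤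
        D * Real.exp (q * |R| ^ (1 / t)) * X * ((h / 2) ^ n * (n ! : ℝ) ^ s) := by
      intro n
      rw [iteratedFDeriv_comp_sub]
      refine (hD n (y - x)).trans ?_
      refine mul_le_mul_of_nonneg_right ?_ (by positivity)
      rw [mul_assoc D, hX, ← Real.exp_add]
      refine mul_le_mul_of_nonneg_left (Real.exp_le_exp.mpr ?_) hD0
      have h3 := htri x y (y - x) (by simpa using norm_sub_le y (y - x))
      have h4 : ‖y‖ ^ (1 / t) ≤ |R| ^ (1 / t) :=
        Real.rpow_le_rpow (norm_nonneg y) ((hR y hy).trans (le_abs_self R)) (by positivity)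
      nlinarith
    have h3 := leibniz_bound hs.le (half_pos hh).le (contDiff_char ξ)
      (Sig.translate ht (Sig.conj ψ) x).2.1 y (fun n => (norm_iteratedFDeriv_char_le ξ y n).trans
        ((pow_le_exp_rpow hs (half_pos hh) (norm_nonneg ξ) n).trans (le_of_eq (mul_comm _ _)))) h2 n
    rw [mul_div_cancel₀ h two_ne_zero] at h3
    exact h3
  have h2 : ‖∫ y, w.1 y * f.1 y‖ ≤ A * D * I * X := by
    have e : A * D * I * X =
        ∫ y : Rd d, A * D * Real.exp (-(1 * ‖y‖ ^ (1 / t))) * X := by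
      rw [integral_mul_const, integral_const_mul]
    rw [e]
    refine norm_integral_le_of_norm_le
      (((integrable_exp_neg_norm_rpow ht one_pos).const_mul _).mul_const _)
      (Filter.Eventually.of_forall fun y => ?_)
    have h3 : ‖f.1 y‖ ≤ D * Real.exp (-(q * ‖y - x‖ ^ (1 / t))) := by
      have : ‖f.1 y‖ = ‖(Sig.conj ψ).1 (y - x)‖ := by
        change ‖char ξ y * (Sig.conj ψ).1 (y - x)‖ = _
        rw [norm_mul, norm_char, one_mul]
      rw [this]
      simpa using hD 0 (y - x)
    rw [norm_mul]
    refine (mul_le_mul (hA y) h3 (norm_nonneg _) (by positivity)).trans ?_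
    have h4 : Real.exp (-((q + 1) * ‖y‖ ^ (1 / t))) * Real.exp (-(q * ‖y - x‖ ^ (1 / t))) ≤
        Real.exp (-(1 * ‖y‖ ^ (1 / t))) * X := by
      rw [hX, ← Real.exp_add, ← Real.exp_add]
      refine Real.exp_le_exp.mpr ?_
      have := htri x y (y - x) (by simpa using norm_sub_le y (y - x))
      linarith
    have h5 := mul_le_mul_of_nonneg_left h4 (show 0 ≤ A * D by positivity)
    linarith
  rw [SigDual.stft, ← hf, hu f, norm_mul]
  have h3 := (norm_add_le _ _).trans (add_le_add h1 h2)
  have h4 := mul_le_mul_of_nonneg_left h3 (norm_nonneg (fourierConst d))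
  refine h4.trans ?_
  have h5 : A * D * I * X ≤ A * D * I * X * E := le_mul_of_one_le_right (by positivity) hE1
  have h6 := mul_le_mul_of_nonneg_left h5 (norm_nonneg (fourierConst d))
  linarith

lemma integrable_stft {g : Rd d → ℂ} (hg : u.HasFourierTransform g)
    {v : GevreyDual d s} {χ : GevreyC d s} {w : Sig d t s}
    (hu : ∀ f : Sig d t s, u.toLin f =
      v.cutoff hs χ ⟨f.1, Sig.mem_gev f⟩ + ∫ x, w.1 x * f.1 x) (ξ : Rd d) :
    Integrable fun x => u.stft ht hs ψ x ξ := by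
  obtain ⟨r₀, hr₀, h⟩ := exists_norm_stft_le hs ht (ψ := ψ) hu
  obtain ⟨C, hC0, hC⟩ := h 1 one_pos
  refine ((integrable_exp_neg_norm_rpow ht one_pos).const_mul
    (C * Real.exp (r₀ * ‖ξ‖ ^ (1 / s)))).mono' (Continuous.aestronglyMeasurable ?_)
    (Filter.Eventually.of_forall fun x => hC x ξ)
  have : (fun x => u.stft ht hs ψ x ξ) = fun x =>
      char ξ x * fourierInv (fun η => g η * fourierInv (Sig.conj ψ).1 (η - ξ)) x :=
    funext fun x => hg.stft_eq hs ht x ξ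
  rw [this]
  exact (continuous_char ξ).mul (continuous_fourierInv (hg.integrable_mul_window hs ht ψ ξ))

/-- The continuous function representing the Fourier transform is unique. -/
lemma SigDual.HasFourierTransform.unique (ht : 0 < t) {g g' : Rd d → ℂ} (hg : u.HasFourierTransform g)
    (hg' : u.HasFourierTransform g') (hψ : ψ ≠ 0)
    {v : GevreyDual d s} {χ : GevreyC d s} {w : Sig d t s}
    (hu : ∀ f : Sig d t s, u.toLin f =
      v.cutoff hs χ ⟨f.1, Sig.mem_gev f⟩ + ∫ x, w.1 x * f.1 x) : g = g' := by
  obtain ⟨ζ, hζ⟩ := exists_window_ne_zero hs ht hψ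
  funext η
  -- At the frequency `η - ζ` the window transform is evaluated at `ζ`, where it does not vanish.
  have hint := integrable_stft hs ht (ψ := ψ) hg hu (η - ζ)
  have h1 := hg.mul_window_eq hs ht hint η
  rw [← hg'.mul_window_eq hs ht hint η, sub_sub_cancel] at h1
  exact mul_right_cancel₀ hζ h1

end Stft

/-! ### Cones -/

/-- The open cone generated by the ball of radius `δ` around `η`. -/
def coneAt (η : Rd d) (δ : ℝ) : Set (Rd d) := {ξ | ∃ ν : ℝ, 0 < ν ∧ ‖ν⁻¹ • ξ - η‖ < δ}

lemma isOpenConic_coneAt {η : Rd d} {δ : ℝ} (hδ : δ ≤ ‖η‖) : IsOpenConic (coneAt η δ) := by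
  refine ⟨?_, ?_, ?_⟩
  · have : coneAt η δ = ⋃ ν : ℝ, ⋃ _ : 0 < ν, {ξ | ‖ν⁻¹ • ξ - η‖ < δ} := by
      ext ξ; simp [coneAt]
    rw [this]
    exact isOpen_iUnion fun ν => isOpen_iUnion fun _ => isOpen_lt (by fun_prop) continuous_const
  · rintro ⟨ν, -, h⟩
    rw [smul_zero, zero_sub, norm_neg] at h
    linarith
  · rintro ξ ⟨ν, hν, h⟩ a ha
    refine ⟨a * ν, by positivity, ?_⟩
    rwa [smul_smul, mul_inv, mul_comm a⁻¹, mul_assoc, inv_mul_cancel₀ ha.ne', mul_one]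

lemma mem_coneAt_self {η : Rd d} {δ : ℝ} (hδ : 0 < δ) : η ∈ coneAt η δ :=
  ⟨1, one_pos, by simpa using hδ⟩

/-- A vector in a small subcone is far from the vectors outside of the cone. -/
lemma IsOpenConic.exists_subcone {Γ : Set (Rd d)} (hΓ : IsOpenConic Γ) {η₀ : Rd d} (hη₀ : η₀ ∈ Γ) :
    ∃ Γ' : Set (Rd d), IsOpenConic Γ' ∧ η₀ ∈ Γ' ∧ ∃ δ : ℝ, 0 < δ ∧ ∀ ξ ∈ Γ', ∀ η : Rd d,
      (η ∈ Γ ∧ δ * ‖ξ‖ ≤ ‖η‖) ∨ δ * ‖ξ‖ ≤ ‖η - ξ‖ := by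
  have hne : η₀ ≠ 0 := fun h => hΓ.2.1 (h ▸ hη₀)
  have hn : 0 < ‖η₀‖ := norm_pos_iff.mpr hne
  obtain ⟨ρ, hρ, hball⟩ := Metric.isOpen_iff.mp hΓ.1 η₀ hη₀
  -- Points within `2ε` of `η₀` remain in `Γ` and have norm at least `2ε`.
  set ε : ℝ := min (ρ / 2) (‖η₀‖ / 4) with hε
  have hε0 : 0 < ε := by positivity
  have hερ : 2 * ε ≤ ρ := by linarith [min_le_left (ρ / 2) (‖η₀‖ / 4)]
  have hεη : 4 * ε ≤ ‖η₀‖ := by linarith [min_le_right (ρ / 2) (‖η₀‖ / 4)]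
  refine ⟨coneAt η₀ ε, isOpenConic_coneAt (by linarith), mem_coneAt_self hε0,
    ε / (‖η₀‖ + ε), by positivity, ?_⟩
  rintro ξ ⟨ν, hν, hξ⟩ η
  have hscale : ∀ z : Rd d, ‖z‖ = ν * ‖ν⁻¹ • z‖ := fun z => by
    rw [norm_smul, norm_inv, Real.norm_of_nonneg hν.le, mul_inv_cancel_left₀ hν.ne']
  have hξn : ε / (‖η₀‖ + ε) * ‖ξ‖ ≤ ν * ε := by
    have h1 : ‖ν⁻¹ • ξ‖ ≤ ‖η₀‖ + ε := by
      have := norm_add_le (ν⁻¹ • ξ - η₀) η₀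
      rw [sub_add_cancel] at this
      linarith
    rw [hscale ξ, div_mul_eq_mul_div, div_le_iff₀ (by positivity)]
    have := mul_le_mul_of_nonneg_left h1 (show 0 ≤ ε * ν by positivity)
    linarith
  -- After scaling by `ν⁻¹` the vector `ξ` is within `ε` of `η₀`: either `η` is within `2ε` of `η₀`,
  -- hence in the cone, or its distance to `ξ` is comparable to `‖ξ‖`.
  rcases lt_or_ge ‖η - ξ‖ (ν * ε) with h | h
  · left
    rw [hscale, smul_sub] at h
    have h1 : ‖ν⁻¹ • η - ν⁻¹ • ξ‖ < ε := lt_of_mul_lt_mul_left h hν.le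
    have h2 : ‖ν⁻¹ • η - η₀‖ < 2 * ε := by
      have := norm_add_le (ν⁻¹ • η - ν⁻¹ • ξ) (ν⁻¹ • ξ - η₀)
      rw [sub_add_sub_cancel] at this
      linarith
    refine ⟨?_, hξn.trans ?_⟩
    · have h3 := hΓ.2.2 _ (hball (mem_ball_iff_norm.mpr (h2.trans_le hερ))) ν hν
      rwa [smul_inv_smul₀ hν.ne'] at h3
    · rw [hscale η]
      refine mul_le_mul_of_nonneg_left ?_ hν.le
      have := norm_sub_norm_le η₀ (ν⁻¹ • η)
      rw [norm_sub_rev] at this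
      linarith
  · exact Or.inr (hξn.trans h)

lemma IsOpenConic.inter {Γ Γ' : Set (Rd d)} (hΓ : IsOpenConic Γ) (hΓ' : IsOpenConic Γ') :
    IsOpenConic (Γ ∩ Γ') :=
  ⟨hΓ.1.inter hΓ'.1, fun h => hΓ.2.1 h.1, fun ξ hξ a ha =>
    ⟨hΓ.2.2 ξ hξ.1 a ha, hΓ'.2.2 ξ hξ.2 a ha⟩⟩

lemma exists_isOpenConic_biInter {ι : Type*} (T : Finset ι) {Γ : ι → Set (Rd d)}
    (hΓ : ∀ i, IsOpenConic (Γ i)) {η : Rd d} (hη : ∀ i, η ∈ Γ i) (hη0 : η ≠ 0) :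
    ∃ Γ' : Set (Rd d), IsOpenConic Γ' ∧ η ∈ Γ' ∧ ∀ i ∈ T, Γ' ⊆ Γ i := by
  classical
  induction T using Finset.induction_on with
  | empty =>
    exact ⟨coneAt η ‖η‖, isOpenConic_coneAt le_rfl, mem_coneAt_self (norm_pos_iff.mpr hη0), by simp⟩
  | insert i T _ ih =>
    obtain ⟨Γ', h1, h2, h3⟩ := ih
    refine ⟨Γ i ∩ Γ', (hΓ i).inter h1, ⟨hη i, h2⟩, fun j hj => ?_⟩
    rcases Finset.mem_insert.mp hj with rfl | hj
    · exact Set.inter_subset_left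
    · exact Set.inter_subset_right.trans (h3 j hj)

/-! ### Decay on cones -/

lemma decaysOn_iff {g : Rd d → ℂ} {Γ : Set (Rd d)} : DecaysOn s g Γ ↔
    ∀ r : ℝ, 0 < r → ∃ C : ℝ, 0 ≤ C ∧ ∀ ξ ∈ Γ, ‖g ξ‖ ≤ C * Real.exp (-(r * ‖ξ‖ ^ (1 / s))) := by
  refine forall₂_congr fun r _ => ⟨?_, ?_⟩
  · rintro ⟨C, hC⟩
    refine ⟨max C 0, le_max_right _ _, fun ξ hξ => ?_⟩
    rw [Real.exp_neg, ← div_eq_mul_inv, le_div_iff₀' (Real.exp_pos _)]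
    exact (hC ξ hξ).trans (le_max_left _ _)
  · rintro ⟨C, -, hC⟩
    refine ⟨C, fun ξ hξ => ?_⟩
    rw [← le_div_iff₀' (Real.exp_pos _), div_eq_mul_inv, ← Real.exp_neg]
    exact hC ξ hξ

lemma DecaysOn.mono {g : Rd d → ℂ} {Γ Γ' : Set (Rd d)} (hg : DecaysOn s g Γ) (h : Γ' ⊆ Γ) :
    DecaysOn s g Γ' := fun r hr => by
  obtain ⟨C, hC⟩ := hg r hr
  exact ⟨C, fun ξ hξ => hC ξ (h hξ)⟩

lemma DecaysOn.add {f g : Rd d → ℂ} {Γ : Set (Rd d)} (hf : DecaysOn s f Γ) (hg : DecaysOn s g Γ) :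
    DecaysOn s (fun ξ => f ξ + g ξ) Γ := fun r hr => by
  obtain ⟨A, hA⟩ := hf r hr
  obtain ⟨B, hB⟩ := hg r hr
  refine ⟨A + B, fun ξ hξ => ?_⟩
  have := mul_le_mul_of_nonneg_left (norm_add_le (f ξ) (g ξ)) (Real.exp_pos (r * ‖ξ‖ ^ (1 / s))).le
  linarith [hA ξ hξ, hB ξ hξ]

lemma DecaysOn.const_mul {f : Rd d → ℂ} {Γ : Set (Rd d)} (c : ℂ) (hf : DecaysOn s f Γ) :
    DecaysOn s (fun ξ => c * f ξ) Γ := fun r hr => by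
  obtain ⟨A, hA⟩ := hf r hr
  refine ⟨‖c‖ * A, fun ξ hξ => ?_⟩
  rw [norm_mul, mul_left_comm]
  exact mul_le_mul_of_nonneg_left (hA ξ hξ) (norm_nonneg c)

lemma DecaysOn.sum {ι : Type*} (T : Finset ι) {f : ι → Rd d → ℂ} {Γ : Set (Rd d)}
    (hf : ∀ i ∈ T, DecaysOn s (f i) Γ) : DecaysOn s (fun ξ => ∑ i ∈ T, f i ξ) Γ := by
  classical
  induction T using Finset.induction_on with
  | empty => exact fun r hr => ⟨0, fun ξ _ => by simp⟩
  | insert i T hi ih =>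
    simp only [Finset.sum_insert hi]
    exact (hf i (Finset.mem_insert_self i T)).add
      (ih fun j hj => hf j (Finset.mem_insert_of_mem hj))

/-- The basic estimate for convolutions: decay on a cone survives, on a smaller cone, the
convolution with a rapidly decaying function. -/
lemma IsOpenConic.exists_convolution_bound (hs : 0 < s) {Γ : Set (Rd d)} (hΓ : IsOpenConic Γ)
    {η₀ : Rd d} (hη₀ : η₀ ∈ Γ) :
    ∃ Γ' : Set (Rd d), IsOpenConic Γ' ∧ η₀ ∈ Γ' ∧ ∀ B Ψ : Rd d → ℂ, ModerateGrowth s B →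
      DecaysOn s B Γ → RapidDecay s Ψ → ∀ r : ℝ, 0 < r → ∃ C : ℝ, 0 ≤ C ∧ ∀ ξ ∈ Γ', ∀ η : Rd d,
        ‖B η‖ * ‖Ψ (η - ξ)‖ ≤ C * Real.exp (-(r * ‖ξ‖ ^ (1 / s))) *
          Real.exp (-(1 * ‖η - ξ‖ ^ (1 / s))) := by
  obtain ⟨Γ', hΓ', hη₀', δ, hδ, hsep⟩ := hΓ.exists_subcone hη₀
  refine ⟨Γ', hΓ', hη₀', fun B Ψ hB hBΓ hΨ r hr => ?_⟩
  set τ : ℝ := δ ^ (1 / s) with hτ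
  have hτ0 : 0 < τ := by positivity
  have hsi : 0 ≤ 1 / s := by positivity
  have hpow : ∀ a b : ℝ, 0 ≤ a → δ * a ≤ b → τ * a ^ (1 / s) ≤ b ^ (1 / s) := fun a b ha h => by
    rw [hτ, ← Real.mul_rpow hδ.le ha]
    exact Real.rpow_le_rpow (by positivity) h hsi
  obtain ⟨r₀, hr₀, A, hA0, hA⟩ := hB
  obtain ⟨C₁, hC₁, hb₁⟩ := decaysOn_iff.mp hBΓ (r / τ) (by positivity)
  obtain ⟨C₂, hC₂, hb₂⟩ := hΨ 1 one_pos
  set S : ℝ := 2 ^ (1 / s) * (1 + 1 / τ) with hS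
  have hS0 : 0 < S := by positivity
  -- When `η` is far from `ξ`, both `‖ξ‖^{1/s}` and `‖η‖^{1/s}` are multiples of `z = ‖η -
  -- ξ‖^{1/s}`. The three terms of the rate pay for the growth of `B`, for the decay in `ξ`, and for
  -- integrability in `η`.
  obtain ⟨C₃, hC₃, hb₃⟩ := hΨ (r₀ * S + r / τ + 1) (by positivity)
  refine ⟨max (C₁ * C₂) (A * C₃), by positivity, fun ξ hξ η => ?_⟩
  rcases hsep ξ hξ η with ⟨hηΓ, h⟩ | h
  · have h1 := hpow _ _ (norm_nonneg ξ) h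
    have h2 : ‖B η‖ ≤ C₁ * Real.exp (-(r * ‖ξ‖ ^ (1 / s))) := by
      refine (hb₁ η hηΓ).trans (mul_le_mul_of_nonneg_left (Real.exp_le_exp.mpr ?_) hC₁)
      have := mul_le_mul_of_nonneg_left h1 (show 0 ≤ r / τ by positivity)
      rw [← mul_assoc, div_mul_cancel₀ r hτ0.ne'] at this
      linarith
    refine (mul_le_mul h2 (hb₂ (η - ξ)) (norm_nonneg _) (by positivity)).trans ?_
    have h3 := mul_le_mul_of_nonneg_right (le_max_left (C₁ * C₂) (A * C₃))
      (show 0 ≤ Real.exp (-(r * ‖ξ‖ ^ (1 / s))) * Real.exp (-(1 * ‖η - ξ‖ ^ (1 / s))) by positivity)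
    linarith
  · have h1 := hpow _ _ (norm_nonneg ξ) h
    set z := ‖η - ξ‖ ^ (1 / s) with hz
    have hξz : ‖ξ‖ ^ (1 / s) ≤ 1 / τ * z := by
      rw [one_div_mul_eq_div, le_div_iff₀' hτ0]; exact h1
    have hηz : ‖η‖ ^ (1 / s) ≤ S * z := by
      have h2 : ‖η‖ ≤ ‖η - ξ‖ + ‖ξ‖ := by simpa using norm_add_le (η - ξ) ξ
      refine (Real.rpow_le_rpow (norm_nonneg η) h2 hsi).trans
        ((rpow_add_le_two_rpow (norm_nonneg _) (norm_nonneg _) hsi).trans ?_)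
      rw [hS, mul_assoc, ← hz]
      refine mul_le_mul_of_nonneg_left ?_ (by positivity)
      linarith
    refine (mul_le_mul (hA η) (hb₃ (η - ξ)) (norm_nonneg _) (by positivity)).trans ?_
    rw [← hz]
    have h2 : Real.exp (r₀ * ‖η‖ ^ (1 / s)) * Real.exp (-((r₀ * S + r / τ + 1) * z)) ≤
        Real.exp (-(r * ‖ξ‖ ^ (1 / s))) * Real.exp (-(1 * z)) := by
      rw [← Real.exp_add, ← Real.exp_add]
      refine Real.exp_le_exp.mpr ?_
      have h3 := mul_le_mul_of_nonneg_left hηz hr₀.le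
      have h4 := mul_le_mul_of_nonneg_left hξz hr.le
      have h5 : r * (1 / τ * z) = r / τ * z := by ring
      linarith
    have h3 := mul_le_mul (le_max_right (C₁ * C₂) (A * C₃)) h2 (by positivity) (by positivity)
    linarith

/-! ### Directions of decay and the wave front set -/

/-- Multiplication by `θ` becomes convolution: this is Parseval's formula for `θ` times a character,
the modulation shifting the transform of `θ`. The auxiliary index `t = 1` only serves to regard `θ`
as a Gelfand-Shilov function. -/
lemma GevreyDual.cutoff_mul_char_eq (hs : 0 < s) (v : GevreyDual d s) (ϕ : GevreyC d s)
    (θ : GevreyC d s) (ξ : Rd d) (f : Gev d s) (hf : f.1 = fun y => char ξ y * θ.1 y) :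
    v.cutoff hs ϕ f = ∫ η, fourierConst d * fourierInv θ.1 (η - ξ) *
      v.cutoff hs ϕ (charGev hs η) := by
  have h1 := (v.cutoff_parseval hs one_pos ϕ
    (Sig.mulChar hs (Submodule.inclusion (gevreyC_le_sig one_pos) θ) ξ)).2
  have h2 : f = ⟨(Sig.mulChar hs (Submodule.inclusion (gevreyC_le_sig one_pos) θ) ξ :
      Sig d 1 s).1, Sig.mem_gev _⟩ := Subtype.ext hf
  rw [h2, h1]
  congr 1
  funext η
  congr 2
  exact fourierInv_mul_char θ.1 ξ η

/-- Decay of `(ϕ u)^` on a cone passes to the compactly supported part `v` of `u = v + w`. -/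
lemma decaysOn_cutoff_char (hs : 0 < s) (ht : 0 < t) {u : SigDual d t s} {v : GevreyDual d s}
    {w : Sig d t s} (hu : ∀ ϕ : GevreyC d s,
      (u.toGevreyDual ht).toLin ϕ = v.toLin ϕ + ∫ x, w.1 x * ϕ.1 x) {ϕ : GevreyC d s}
    {Γ : Set (Rd d)} (h : DecaysOn s ((u.toGevreyDual ht).localFourier hs ϕ) Γ) :
    DecaysOn s (fun η => v.cutoff hs ϕ (charGev hs η)) Γ := by
  -- The product `w ϕ` is again a Gevrey function of compact support, so its contribution decays in
  -- all directions and can be subtracted.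
  set p : Sig d t s := Submodule.inclusion (gevreyC_le_sig ht)
    ⟨fun x => w.1 x * ϕ.1 x, gevreyC_mul_mem hs ϕ (Sig.mem_gev w)⟩ with hp
  have h1 : (fun η => v.cutoff hs ϕ (charGev hs η)) = fun η =>
      (fourierConst d)⁻¹ * (u.toGevreyDual ht).localFourier hs ϕ η +
        -(fourierConst d)⁻¹ * fourierInv p.1 (-η) := by
    funext η
    have h2 : ∫ x, w.1 x * (char η x * ϕ.1 x) = (fourierConst d)⁻¹ * fourierInv p.1 (-η) := by
      rw [← integral_mul_char_eq]
      congr 1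
      funext x
      change _ = w.1 x * ϕ.1 x * char η x
      ring
    have h3 : (u.toGevreyDual ht).localFourier hs ϕ η = fourierConst d *
        (v.cutoff hs ϕ (charGev hs η) + ∫ x, w.1 x * (char η x * ϕ.1 x)) := by
      rw [GevreyDual.localFourier, hu]
      rfl
    rw [h3, h2, inv_mul_cancel_left₀ (fourierConst_ne_zero d)]
    ring
  rw [h1]
  exact (h.const_mul _).add
    (((Sig.rapidDecay_fourierInv hs ht p).comp_neg.decaysOn Γ).const_mul _)

/-- If no point over `η₀` is in the wave front set, then the Fourier transform decays in a conic
neighbourhood of `η₀`. -/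
theorem exists_decaysOn_of_forall_notMem_waveFront (hs : 1 < s) (ht : 0 < t) {u : SigDual d t s}
    {v : GevreyDual d s} {χ : GevreyC d s} {w : Sig d t s} {K O : Set (Rd d)} (hO : IsOpen O)
    (hKO : K ⊆ O) (hv : ∀ ϕ : GevreyC d s, tsupport ϕ.1 ⊆ Kᶜ → v.toLin ϕ = 0)
    (hχ : ∀ x ∈ O, χ.1 x = 1)
    (hu : ∀ ϕ : GevreyC d s, (u.toGevreyDual ht).toLin ϕ = v.toLin ϕ + ∫ x, w.1 x * ϕ.1 x)
    {η₀ : Rd d} (hη₀ : η₀ ≠ 0)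
    (hwf : ∀ x, (x, η₀) ∉ (u.toGevreyDual ht).waveFront (zero_lt_one.trans hs)) :
    ∃ Γ : Set (Rd d), IsOpenConic Γ ∧ η₀ ∈ Γ ∧
      DecaysOn s (fourierSum (zero_lt_one.trans hs) v χ w) Γ := by
  have hs0 := zero_lt_one.trans hs
  have hloc : ∀ x : Rd d, ∃ ϕ : GevreyC d s, ϕ.1 x = 1 ∧ ∃ Γ : Set (Rd d), IsOpenConic Γ ∧
      η₀ ∈ Γ ∧ DecaysOn s ((u.toGevreyDual ht).localFourier hs0 ϕ) Γ := by
    intro x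
    have := hwf x
    simp only [GevreyDual.waveFront, Set.mem_ofPred_eq, not_and, not_not] at this
    exact this hη₀
  choose ϕ hϕ1 Γ hΓ hηΓ hdec using hloc
  obtain ⟨T, hT⟩ := (show IsCompact (tsupport χ.1) from χ.2.2.1).elim_finite_subcover
    (fun x => {y | (ϕ x).1 y ≠ 0})
    (fun x => isOpen_ne_fun (ϕ x).2.1.continuous continuous_const)
    (fun x _ => Set.mem_iUnion.mpr ⟨x, by simp [hϕ1 x]⟩)
  -- The extra term `|1 - χ|²` keeps `F` away from `0` outside the support of `χ`, where the `ϕ x`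
  -- may all vanish, and disappears on `O`, where `χ = 1`.
  set F : Rd d → ℝ := fun y => ∑ x ∈ T, Complex.normSq ((ϕ x).1 y) + Complex.normSq (1 - χ.1 y)
    with hF
  have hF0 : ∀ y, 0 < F y := by
    intro y
    have hsum : 0 ≤ ∑ x ∈ T, Complex.normSq ((ϕ x).1 y) :=
      Finset.sum_nonneg fun x _ => Complex.normSq_nonneg _
    by_cases hy : y ∈ tsupport χ.1
    · obtain ⟨x, hx, hxy⟩ := Set.mem_iUnion₂.mp (hT hy)
      have h1 := Finset.single_le_sum (f := fun x => Complex.normSq ((ϕ x).1 y))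
        (fun x _ => Complex.normSq_nonneg _) hx
      have h2 : 0 < Complex.normSq ((ϕ x).1 y) := Complex.normSq_pos.mpr hxy
      have h3 := Complex.normSq_nonneg (1 - χ.1 y)
      simp only [hF]
      linarith
    · simp only [hF, image_eq_zero_of_notMem_tsupport hy, sub_zero, map_one]
      linarith
  have hFC : ∀ y, (F y : ℂ) = ∑ x ∈ T, (ϕ x).1 y * conj ((ϕ x).1 y) +
      (1 - χ.1 y) * conj (1 - χ.1 y) := by
    intro y
    simp only [hF, Complex.mul_conj]
    push_cast
    rfl
  have hFmem : (fun y => (F y : ℂ)) ∈ Gev d s := by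
    simp only [hFC]
    have h1 : (fun y => ∑ x ∈ T, (ϕ x).1 y * conj ((ϕ x).1 y)) ∈ Gev d s := by
      have := (Gev d s).sum_mem (t := T) (f := fun x => fun y => (ϕ x).1 y * conj ((ϕ x).1 y))
        fun x _ => mul_mem_gev hs0 (GevreyC.mem_gev (ϕ x)) (conj_mem_gev (GevreyC.mem_gev (ϕ x)))
      convert this using 1
      funext y
      rw [Finset.sum_apply]
    have h2 : (fun y => 1 - χ.1 y) ∈ Gev d s :=
      (Gev d s).sub_mem (const_mem_gev hs0 1) (GevreyC.mem_gev χ)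
    exact (Gev d s).add_mem h1 (mul_mem_gev hs0 h2 (conj_mem_gev h2))
  have hFcont : Continuous F := by
    have h1 : ∀ x, Continuous (ϕ x).1 := fun x => (ϕ x).2.1.continuous
    have h2 : Continuous χ.1 := χ.2.1.continuous
    simp only [hF]
    refine (continuous_finsetSum _ fun x _ => Complex.continuous_normSq.comp (h1 x)).add
      (Complex.continuous_normSq.comp (continuous_const.sub h2))
  obtain ⟨c, hc, hcF⟩ : ∃ c : ℝ, 0 < c ∧ ∀ y, c ≤ F y := by
    obtain ⟨c, hc, hcK⟩ := (show IsCompact (tsupport χ.1) from χ.2.2.1).exists_forall_le'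
      hFcont.continuousOn (a := 0) fun y _ => hF0 y
    refine ⟨min c 1, by positivity, fun y => ?_⟩
    by_cases hy : y ∈ tsupport χ.1
    · exact (min_le_left _ _).trans (hcK y hy)
    · refine (min_le_right _ _).trans ?_
      simp only [hF, image_eq_zero_of_notMem_tsupport hy, sub_zero, map_one]
      linarith [Finset.sum_nonneg fun x (_ : x ∈ T) => Complex.normSq_nonneg ((ϕ x).1 y)]
  have hFinv : (fun y => (F y : ℂ)⁻¹) ∈ Gev d s := inv_mem_gev hs hc hFmem fun y => by
    rw [Complex.norm_real, Real.norm_of_nonneg (hF0 y).le]; exact hcF y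
  -- On `O` one has `∑ θ x * ϕ x = χ`. The functional `v` sees only a neighbourhood of `K`, so this
  -- identity on `O` suffices for the splitting.
  let θ : Rd d → GevreyC d s := fun x =>
    ⟨fun y => (conj ((ϕ x).1 y) * (F y : ℂ)⁻¹) * χ.1 y,
      gevreyC_mul_mem hs0 χ (mul_mem_gev hs0 (conj_mem_gev (GevreyC.mem_gev (ϕ x))) hFinv)⟩
  let f : Rd d → Rd d → Gev d s := fun x ξ =>
    ⟨fun y => char ξ y * (θ x).1 y, mul_mem_gev hs0 (char_mem_gev hs0 ξ) (GevreyC.mem_gev (θ x))⟩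
  have hsplit : ∀ ξ, v.cutoff hs0 χ (charGev hs0 ξ) = ∑ x ∈ T, v.cutoff hs0 (ϕ x) (f x ξ) := by
    intro ξ
    simp only [GevreyDual.cutoff_apply]
    rw [← sub_eq_zero, ← map_sum, ← map_sub]
    refine GevreyDual.apply_eq_zero hv hO hKO _ fun y hy => ?_
    rw [Submodule.coe_sub, Submodule.coe_sum, Pi.sub_apply, Finset.sum_apply]
    change char ξ y * χ.1 y - ∑ x ∈ T, char ξ y *
      ((conj ((ϕ x).1 y) * (F y : ℂ)⁻¹) * χ.1 y) * (ϕ x).1 y = 0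
    have h1 := hFC y
    rw [hχ y hy, sub_self, zero_mul, add_zero] at h1
    have h2 : ∑ x ∈ T, char ξ y * ((conj ((ϕ x).1 y) * (F y : ℂ)⁻¹) * χ.1 y) * (ϕ x).1 y =
        char ξ y * χ.1 y * (F y : ℂ)⁻¹ * ∑ x ∈ T, (ϕ x).1 y * conj ((ϕ x).1 y) := by
      rw [Finset.mul_sum]
      exact Finset.sum_congr rfl fun x _ => by ring
    rw [h2, ← h1, mul_assoc, inv_mul_cancel₀ (Complex.ofReal_ne_zero.mpr (hF0 y).ne'), mul_one,
      sub_self]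
  -- The cones depend on the base point; since the cover is finite, their intersection is still an
  -- open cone around `η₀`.
  obtain ⟨Γ₁, hΓ₁, hη₁, hsub⟩ := exists_isOpenConic_biInter T hΓ hηΓ hη₀
  obtain ⟨Γ₂, hΓ₂, hη₂, hconv⟩ := hΓ₁.exists_convolution_bound hs0 hη₁
  refine ⟨Γ₂, hΓ₂, hη₂, ?_⟩
  have hA : DecaysOn s (fun ξ => v.cutoff hs0 χ (charGev hs0 ξ)) Γ₂ := by
    simp only [hsplit]
    refine DecaysOn.sum T fun x hx => decaysOn_iff.mpr fun r hr => ?_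
    obtain ⟨C, hC0, hC⟩ := hconv (fun η => v.cutoff hs0 (ϕ x) (charGev hs0 η))
      (fourierInv (θ x).1) (v.moderateGrowth_cutoff_char hs0 (ϕ x))
      ((decaysOn_cutoff_char hs0 ht hu (hdec x)).mono (hsub x hx))
      (Sig.rapidDecay_fourierInv hs0 one_pos
        (Submodule.inclusion (gevreyC_le_sig (one_pos : (0 : ℝ) < 1)) (θ x))) r hr
    set I : ℝ := ∫ y : Rd d, Real.exp (-(1 * ‖y‖ ^ (1 / s))) with hI
    have hI0 : 0 ≤ I := integral_nonneg fun x => (Real.exp_pos _).le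
    refine ⟨‖fourierConst d‖ * C * I, by positivity, fun ξ hξ => ?_⟩
    rw [v.cutoff_mul_char_eq hs0 (ϕ x) (θ x) ξ (f x ξ) rfl]
    have e : ‖fourierConst d‖ * C * I * Real.exp (-(r * ‖ξ‖ ^ (1 / s))) =
        ∫ η : Rd d, ‖fourierConst d‖ * (C * Real.exp (-(r * ‖ξ‖ ^ (1 / s))) *
          Real.exp (-(1 * ‖η - ξ‖ ^ (1 / s)))) := by
      rw [integral_const_mul, integral_const_mul,
        integral_sub_right_eq_self (fun η : Rd d => Real.exp (-(1 * ‖η‖ ^ (1 / s)))) ξ]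
      ring
    rw [e]
    refine norm_integral_le_of_norm_le ((((integrable_exp_neg_norm_rpow hs0
      one_pos).comp_sub_right ξ).const_mul _).const_mul _) (Filter.Eventually.of_forall fun η => ?_)
    rw [norm_mul, norm_mul, mul_assoc]
    refine mul_le_mul_of_nonneg_left ?_ (norm_nonneg _)
    rw [mul_comm]
    exact hC ξ hξ η
  exact (hA.const_mul _).add ((Sig.rapidDecay_fourierInv hs0 ht w).comp_neg.decaysOn Γ₂)

/-- Homogeneity: under the anisotropic dilations both `‖x‖^{1/t}` and `‖ξ‖^{1/s}` scale linearly, so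
all exponents can be compared with `r * l`. -/
lemma norm_smul_rpow (hs : 0 < s) {l : ℝ} (hl : 0 < l) (ξ : Rd d) :
    ‖l ^ s • ξ‖ ^ (1 / s) = l * ‖ξ‖ ^ (1 / s) := by
  rw [norm_smul, Real.norm_of_nonneg (by positivity), Real.mul_rpow (by positivity) (norm_nonneg ξ),
    ← Real.rpow_mul hl.le, mul_one_div_cancel hs.ne', Real.rpow_one]

/-! ### Global wave front set and directions of decay -/

section WaveFront

variable (hs : 0 < s) (ht : 0 < t) {u : SigDual d t s} {ψ : Sig d t s} {g : Rd d → ℂ}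

/-- The `t,s`-wave front set lies over the origin. -/
lemma notMem_waveFront_of_fst_ne_zero {v : GevreyDual d s} {χ : GevreyC d s} {w : Sig d t s}
    (hu : ∀ f : Sig d t s, u.toLin f =
      v.cutoff hs χ ⟨f.1, Sig.mem_gev f⟩ + ∫ x, w.1 x * f.1 x)
    {p : Rd d × Rd d} (hp : p.1 ≠ 0) : p ∉ u.waveFront ht hs ψ := by
  rintro ⟨-, hno⟩
  refine hno ?_
  obtain ⟨r₀, hr₀, hb⟩ := exists_norm_stft_le hs ht (ψ := ψ) hu
  have hp0 : 0 < ‖p.1‖ := norm_pos_iff.mpr hp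
  refine ⟨{z | ‖p.1‖ / 2 < ‖z.1‖ ∧ ‖z.2‖ < ‖p.2‖ + 1},
    (isOpen_lt continuous_const continuous_fst.norm).inter
      (isOpen_lt continuous_snd.norm continuous_const), fun h => ?_, ⟨by linarith, by linarith⟩,
    fun r hr => ?_⟩
  · have h1 := h.1
    simp only [Prod.fst_zero, norm_zero] at h1
    linarith
  · set a : ℝ := (‖p.1‖ / 2) ^ (1 / t) with ha
    set b : ℝ := (‖p.2‖ + 1) ^ (1 / s) with hb'
    have ha0 : 0 < a := by positivity
    have hb0 : 0 < b := by positivity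
    -- On this neighbourhood the decay in space is at least `a * l` times the rate, and the growth
    -- in frequency at most `r₀ * b * l`; the rate covers that growth and the required `r * l`.
    obtain ⟨C, hC0, hC⟩ := hb ((r + r₀ * b) / a) (by positivity)
    refine ⟨C, fun l hl z hz => ?_⟩
    have h1 := hC (l ^ t • z.1) (l ^ s • z.2)
    rw [norm_smul_rpow hs hl, norm_smul_rpow ht hl] at h1
    have hza : a ≤ ‖z.1‖ ^ (1 / t) := Real.rpow_le_rpow (by positivity) hz.1.le (by positivity)
    have hzb : ‖z.2‖ ^ (1 / s) ≤ b := Real.rpow_le_rpow (by positivity) hz.2.le (by positivity)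
    have h2 : Real.exp (r * l) * (Real.exp (r₀ * (l * ‖z.2‖ ^ (1 / s))) *
        Real.exp (-((r + r₀ * b) / a * (l * ‖z.1‖ ^ (1 / t))))) ≤ 1 := by
      rw [← Real.exp_add, ← Real.exp_add, Real.exp_le_one_iff]
      have h3 := mul_le_mul_of_nonneg_left hza (show 0 ≤ (r + r₀ * b) / a * l by positivity)
      have h4 := mul_le_mul_of_nonneg_left hzb (show 0 ≤ r₀ * l by positivity)
      have h5 : (r + r₀ * b) / a * l * a = (r + r₀ * b) * l := by field_simp
      rw [h5] at h3
      linarith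
    have h3 := mul_le_mul_of_nonneg_left h1 (Real.exp_pos (r * l)).le
    have h4 := mul_le_mul_of_nonneg_left h2 hC0
    linarith

/-- If the Fourier transform decays in a conic neighbourhood of `η₀`, then `(0, η₀)` is not in the
`t,s`-wave front set. -/
lemma notMem_waveFront_of_decaysOn (hg : u.HasFourierTransform g) (hgm : ModerateGrowth s g)
    {Γ : Set (Rd d)} (hΓ : IsOpenConic Γ) {η₀ : Rd d} (hη₀ : η₀ ∈ Γ) (hdec : DecaysOn s g Γ) :
    ((0 : Rd d), η₀) ∉ u.waveFront ht hs ψ := by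
  rintro ⟨-, hno⟩
  refine hno ?_
  have hη0 : 0 < ‖η₀‖ := norm_pos_iff.mpr fun h => hΓ.2.1 (h ▸ hη₀)
  obtain ⟨Γ', hΓ', hη₀', hconv⟩ := hΓ.exists_convolution_bound hs hη₀
  -- The space variable is unrestricted, as the estimate is uniform in it. The lower bound on
  -- `‖z.2‖` turns decay in frequency into decay in `l`.
  refine ⟨{z | z.2 ∈ Γ' ∧ ‖η₀‖ / 2 < ‖z.2‖}, (hΓ'.1.preimage continuous_snd).inter
    (isOpen_lt continuous_const continuous_snd.norm), fun h => hΓ'.2.1 h.1,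
    ⟨hη₀', by simp only; linarith⟩, fun r hr => ?_⟩
  set a : ℝ := (‖η₀‖ / 2) ^ (1 / s) with ha
  have ha0 : 0 < a := by positivity
  obtain ⟨C, hC0, hC⟩ := hconv g (fourierInv (Sig.conj ψ).1) hgm hdec
    (Sig.rapidDecay_fourierInv hs ht _) (r / a) (by positivity)
  set I : ℝ := ∫ y : Rd d, Real.exp (-(1 * ‖y‖ ^ (1 / s))) with hI
  have hI0 : 0 ≤ I := integral_nonneg fun x => (Real.exp_pos _).le
  refine ⟨‖fourierConst d‖ * (C * I), fun l hl z hz => ?_⟩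
  have h1 := hg.norm_stft_le hs ht (ψ := ψ) ((((integrable_exp_neg_norm_rpow hs
    one_pos).comp_sub_right (l ^ s • z.2)).const_mul _)) (l ^ t • z.1) (l ^ s • z.2)
    (hC _ (hΓ'.2.2 z.2 hz.1 (l ^ s) (by positivity)))
  rw [integral_const_mul, norm_smul_rpow hs hl,
    integral_sub_right_eq_self (fun η : Rd d => Real.exp (-(1 * ‖η‖ ^ (1 / s)))), ← hI] at h1
  have hza : a ≤ ‖z.2‖ ^ (1 / s) := Real.rpow_le_rpow (by positivity) hz.2.le (by positivity)
  have h2 : Real.exp (r * l) * Real.exp (-(r / a * (l * ‖z.2‖ ^ (1 / s)))) ≤ 1 := by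
    rw [← Real.exp_add, Real.exp_le_one_iff]
    have h3 := mul_le_mul_of_nonneg_left hza (show 0 ≤ r / a * l by positivity)
    have h5 : r / a * l * a = r * l := by field_simp
    rw [h5] at h3
    linarith
  have h3 := mul_le_mul_of_nonneg_left h1 (Real.exp_pos (r * l)).le
  have h4 := mul_le_mul_of_nonneg_left h2 (show 0 ≤ ‖fourierConst d‖ * (C * I) by positivity)
  linarith

/-- If `(0, η₀)` is not in the `t,s`-wave front set, then the Fourier transform decays in a conic
neighbourhood of `η₀`. -/
lemma exists_decaysOn_of_notMem_waveFront {v : GevreyDual d s} {χ : GevreyC d s} {w : Sig d t s}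
    (hu : ∀ f : Sig d t s, u.toLin f =
      v.cutoff hs χ ⟨f.1, Sig.mem_gev f⟩ + ∫ x, w.1 x * f.1 x)
    (hg : u.HasFourierTransform g) (hgm : ModerateGrowth s g) (hψ : ψ ≠ 0) {η₀ : Rd d}
    (hη₀ : η₀ ≠ 0) (hwf : ((0 : Rd d), η₀) ∉ u.waveFront ht hs ψ) :
    ∃ Γ : Set (Rd d), IsOpenConic Γ ∧ η₀ ∈ Γ ∧ DecaysOn s g Γ := by
  have hp : ((0 : Rd d), η₀) ≠ 0 := fun h => hη₀ (congrArg Prod.snd h)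
  simp only [SigDual.waveFront, Set.mem_ofPred_eq, not_and, not_not] at hwf
  obtain ⟨U, hU, -, hpU, hUdec⟩ := hwf hp
  have hη0 : 0 < ‖η₀‖ := norm_pos_iff.mpr hη₀
  obtain ⟨ρ, hρ, hball⟩ := Metric.isOpen_iff.mp hU _ hpU
  set ε : ℝ := min ρ ‖η₀‖ with hε
  have hε0 : 0 < ε := by positivity
  have hUmem : ∀ x ξ : Rd d, ‖x‖ < ε → ‖ξ - η₀‖ < ε → (x, ξ) ∈ U := fun x ξ hx hξ => by
    refine hball ?_
    rw [Metric.mem_ball, Prod.dist_eq, max_lt_iff, dist_zero_right, dist_eq_norm]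
    exact ⟨hx.trans_le (min_le_left _ _), hξ.trans_le (min_le_left _ _)⟩
  obtain ⟨ζ, hζ⟩ := exists_window_ne_zero hs ht hψ
  have hζ0 : 0 < ‖fourierInv (Sig.conj ψ).1 ζ‖ := norm_pos_iff.mpr hζ
  obtain ⟨r₀, hr₀, hst⟩ := exists_norm_stft_le hs ht (ψ := ψ) hu
  refine ⟨coneAt η₀ (ε / 2), isOpenConic_coneAt (by linarith [min_le_right ρ ‖η₀‖]),
    mem_coneAt_self (by positivity), decaysOn_iff.mpr fun r hr => ?_⟩
  set p : ℝ := 1 / s with hpdef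
  have hp0 : 0 < p := by positivity
  set T : ℝ := (‖η₀‖ + ε) ^ p with hT
  have hT0 : 0 < T := by positivity
  set e : ℝ := ε ^ (1 / t) with he
  have he0 : 0 < e := by positivity
  -- The part `r * T` gives the decay of `g`, because `‖η‖ ^ p ≤ l * T`. The part `e` pays for an
  -- integrable weight in `x`, because `‖x‖ ^ (1 / t) ≤ l * e` in the region where `U` is used.
  obtain ⟨C₁, hC₁⟩ := hUdec (r * T + e) (by positivity)
  -- For the other `x`, where `‖x‖ ^ (1 / t) ≥ l * e`, this rate compensates the frequency growth
  -- `r₀ * T * l`, gives `r * T * l`, and leaves the same weight.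
  obtain ⟨C₂, hC₂0, hC₂⟩ := hst (1 + (r * T + r₀ * T) / e) (by positivity)
  set C : ℝ := max C₁ C₂ with hC
  have hC0 : 0 ≤ C := hC₂0.trans (le_max_right _ _)
  set I : ℝ := ∫ y : Rd d, Real.exp (-(1 * ‖y‖ ^ (1 / t))) with hI
  have hI0 : 0 ≤ I := integral_nonneg fun x => (Real.exp_pos _).le
  obtain ⟨q, hq, A, hA0, hA⟩ := hgm
  set N : ℝ := 2 * ‖ζ‖ / ε + 1 with hN
  have hN0 : 0 < N := by positivity
  set D₁ : ℝ := ‖fourierConst d‖ * (C * I) / ‖fourierInv (Sig.conj ψ).1 ζ‖ with hD₁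
  set D₂ : ℝ := A * Real.exp ((q + r) * (N ^ p * T)) with hD₂
  refine ⟨max D₁ D₂, le_max_of_le_right (by positivity), ?_⟩
  rintro η ⟨ν, hν, hη⟩
  set η₁ : Rd d := ν⁻¹ • η with hη₁
  have hηe : η = ν • η₁ := by rw [hη₁, smul_inv_smul₀ hν.ne']
  have hTn : ∀ ξ : Rd d, ‖ξ - η₀‖ < ε → ‖ξ‖ ^ p ≤ T := fun ξ hξ => by
    refine Real.rpow_le_rpow (norm_nonneg ξ) ?_ hp0.le
    have := norm_add_le (ξ - η₀) η₀
    rw [sub_add_cancel] at this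
    linarith
  have hηp : ‖η‖ ^ p ≤ ν ^ p * T := by
    rw [hηe, norm_smul, Real.norm_of_nonneg hν.le, Real.mul_rpow hν.le (norm_nonneg _)]
    exact mul_le_mul_of_nonneg_left (hTn _ (by linarith)) (by positivity)
  -- For `ν < N` the vector `η` is bounded and moderate growth is enough. For `ν ≥ N` the shift by
  -- `ν⁻¹ • ζ` is at most `ε / 2`, so `η - ζ` is still a dilate of a vector near `η₀`.
  rcases lt_or_ge ν N with hνN | hνN
  · have h1 : ‖η‖ ^ p ≤ N ^ p * T := hηp.trans
      (mul_le_mul_of_nonneg_right (Real.rpow_le_rpow hν.le hνN.le hp0.le) hT0.le)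
    have h2 : Real.exp (q * ‖η‖ ^ p) ≤
        Real.exp ((q + r) * (N ^ p * T)) * Real.exp (-(r * ‖η‖ ^ p)) := by
      rw [← Real.exp_add]
      refine Real.exp_le_exp.mpr ?_
      have := mul_le_mul_of_nonneg_left h1 (show 0 ≤ q + r by positivity)
      linarith
    have h3 := (hA η).trans (mul_le_mul_of_nonneg_left h2 hA0)
    rw [← mul_assoc] at h3
    exact h3.trans (mul_le_mul_of_nonneg_right (le_max_right _ _) (Real.exp_pos _).le)
  · set l : ℝ := ν ^ p with hl
    have hl0 : 0 < l := by positivity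
    have hls : l ^ s = ν := by
      rw [hl, ← Real.rpow_mul hν.le, hpdef, one_div_mul_cancel hs.ne', Real.rpow_one]
    set ξ₁ : Rd d := η₁ - ν⁻¹ • ζ with hξ₁
    have hξ₁n : ‖ξ₁ - η₀‖ < ε := by
      have h1 : ‖ν⁻¹ • ζ‖ ≤ ε / 2 := by
        rw [norm_smul, norm_inv, Real.norm_of_nonneg hν.le, inv_mul_le_iff₀ hν]
        have h2 : 2 * ‖ζ‖ / ε ≤ ν := by linarith
        rw [div_le_iff₀ hε0] at h2
        linarith
      have h2 : ξ₁ - η₀ = (η₁ - η₀) - ν⁻¹ • ζ := by rw [hξ₁]; abel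
      rw [h2]
      have := norm_sub_le (η₁ - η₀) (ν⁻¹ • ζ)
      linarith
    have hξ : η - ζ = l ^ s • ξ₁ := by
      rw [hls, hξ₁, smul_sub, ← hηe, smul_inv_smul₀ hν.ne']
    have hbound : ∀ x, ‖u.stft ht hs ψ x (η - ζ)‖ ≤
        C * Real.exp (-(r * T * l)) * Real.exp (-(1 * ‖x‖ ^ (1 / t))) := by
      intro x
      have hlt : 0 < l ^ t := by positivity
      set x₁ : Rd d := (l ^ t)⁻¹ • x with hx₁
      have hxe : x = l ^ t • x₁ := by rw [hx₁, smul_inv_smul₀ hlt.ne']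
      have hxp : ‖x‖ ^ (1 / t) = l * ‖x₁‖ ^ (1 / t) := by rw [hxe, norm_smul_rpow ht hl0]
      rcases lt_or_ge ‖x₁‖ ε with hx | hx
      · have h1 := hC₁ l hl0 (x₁, ξ₁) (hUmem _ _ hx hξ₁n)
        rw [← hξ, ← hxe, ← le_div_iff₀' (Real.exp_pos _), div_eq_mul_inv, ← Real.exp_neg] at h1
        have h2 : ‖x₁‖ ^ (1 / t) ≤ e := Real.rpow_le_rpow (norm_nonneg _) hx.le (by positivity)
        have h3 : Real.exp (-((r * T + e) * l)) ≤
            Real.exp (-(r * T * l)) * Real.exp (-(1 * ‖x‖ ^ (1 / t))) := by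
          rw [← Real.exp_add]
          refine Real.exp_le_exp.mpr ?_
          rw [hxp]
          have := mul_le_mul_of_nonneg_left h2 hl0.le
          linarith
        rw [mul_assoc]
        refine h1.trans ?_
        exact (mul_le_mul_of_nonneg_right (le_max_left C₁ C₂) (Real.exp_pos _).le).trans
          (mul_le_mul_of_nonneg_left h3 hC0)
      · have h1 := hC₂ x (η - ζ)
        have h2 : e ≤ ‖x₁‖ ^ (1 / t) := Real.rpow_le_rpow hε0.le hx (by positivity)
        have h3 : ‖η - ζ‖ ^ (1 / s) ≤ l * T := by
          rw [hξ, norm_smul_rpow hs hl0]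
          exact mul_le_mul_of_nonneg_left (hTn ξ₁ hξ₁n) hl0.le
        have h4 : Real.exp (r₀ * ‖η - ζ‖ ^ (1 / s)) *
            Real.exp (-((1 + (r * T + r₀ * T) / e) * ‖x‖ ^ (1 / t))) ≤
            Real.exp (-(r * T * l)) * Real.exp (-(1 * ‖x‖ ^ (1 / t))) := by
          rw [← Real.exp_add, ← Real.exp_add]
          refine Real.exp_le_exp.mpr ?_
          have h5 := mul_le_mul_of_nonneg_left h3 hr₀.le
          have h6 := mul_le_mul_of_nonneg_left h2 (show 0 ≤ (r * T + r₀ * T) / e * l by positivity)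
          have h7 : (r * T + r₀ * T) / e * l * e = (r * T + r₀ * T) * l := by field_simp
          have h8 : (r * T + r₀ * T) / e * l * ‖x₁‖ ^ (1 / t) =
            (r * T + r₀ * T) / e * ‖x‖ ^ (1 / t) := by rw [hxp]; ring
          rw [h7, h8] at h6
          linarith
        rw [mul_assoc] at h1 ⊢
        exact h1.trans (mul_le_mul (le_max_right _ _) h4 (by positivity) hC0)
    have hint := integrable_stft hs ht (ψ := ψ) hg hu (η - ζ)
    have h1 := hg.mul_window_eq hs ht hint η
    rw [sub_sub_cancel] at h1
    have h2 : ‖g η‖ * ‖fourierInv (Sig.conj ψ).1 ζ‖ ≤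
        ‖fourierConst d‖ * (C * Real.exp (-(r * T * l)) * I) := by
      rw [← norm_mul, h1, norm_mul]
      refine mul_le_mul_of_nonneg_left ?_ (norm_nonneg _)
      rw [hI, ← integral_const_mul]
      refine norm_integral_le_of_norm_le ((integrable_exp_neg_norm_rpow ht one_pos).const_mul _)
        (Filter.Eventually.of_forall fun x => ?_)
      rw [norm_mul, norm_mul, norm_char, norm_char, one_mul, mul_one]
      exact hbound x
    rw [← le_div_iff₀ hζ0] at h2
    have h3 : Real.exp (-(r * T * l)) ≤ Real.exp (-(r * ‖η‖ ^ p)) := by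
      refine Real.exp_le_exp.mpr ?_
      have := mul_le_mul_of_nonneg_left hηp hr.le
      linarith
    have h4 : ‖g η‖ ≤ D₁ * Real.exp (-(r * T * l)) := by
      refine h2.trans (le_of_eq ?_)
      rw [hD₁]; ring
    exact h4.trans (mul_le_mul (le_max_left _ _) h3 (Real.exp_pos _).le
      (le_max_of_le_right (by positivity)))

end WaveFront

end GelfandShilov

end

/-! ### The theorem -/

open GelfandShilov
theorem proposition5p2 {d : ℕ} {t s : ℝ} (ht : 0 < t) (hs : 1 < s)
    (u : GelfandShilov.SigDual d t s) (hu : u.MemCompactAddSig ht)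
    (ψ : GelfandShilov.Sig d t s) (hψ : ψ ≠ 0) :
    u.waveFront ht (zero_lt_one.trans hs) ψ ⊆
        {0} ×ˢ (Prod.snd '' (u.toGevreyDual ht).waveFront (zero_lt_one.trans hs)) ∧
      (s ≤ t → u.waveFront ht (zero_lt_one.trans hs) ψ = {0} ×ˢ u.singularDirections) := by
  have hs0 := zero_lt_one.trans hs
  obtain ⟨v, w, χ, K, O, hO, hKO, hv, hχ, huc, huf⟩ := hu.exists_rep hs
  have hg := hasFourierTransform_fourierSum hs0 ht v χ w huf
  have hgm := moderateGrowth_fourierSum hs0 ht v χ w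
  have hfst : ∀ p ∈ u.waveFront ht hs0 ψ, p.1 = 0 ∧ p.2 ≠ 0 := by
    intro p hp
    have h1 : p.1 = 0 := by
      by_contra h
      exact notMem_waveFront_of_fst_ne_zero hs0 ht huf h hp
    exact ⟨h1, fun h2 => hp.1 (Prod.ext h1 h2)⟩
  refine ⟨?_, fun _ => Set.Subset.antisymm ?_ ?_⟩
  · rintro ⟨x, η⟩ hp
    obtain ⟨rfl, hη⟩ := hfst _ hp
    refine ⟨rfl, ?_⟩
    by_contra hno
    obtain ⟨Γ, hΓ, hηΓ, hdec⟩ := exists_decaysOn_of_forall_notMem_waveFront hs ht hO hKO hv hχ huc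
      hη fun x hx => hno ⟨(x, η), hx, rfl⟩
    exact notMem_waveFront_of_decaysOn hs0 ht hg hgm hΓ hηΓ hdec hp
  · rintro ⟨x, η⟩ hp
    obtain ⟨rfl, hη⟩ := hfst _ hp
    refine ⟨rfl, hη, ?_⟩
    rintro ⟨g, hg', Γ, hΓ, hηΓ, hdec⟩
    -- Singular directions refer to some continuous representative of the Fourier transform;
    -- uniqueness identifies it with `fourierSum`, whose moderate growth is known.
    rw [hg'.unique hs0 ht hg hψ huf] at hdec
    exact notMem_waveFront_of_decaysOn hs0 ht hg hgm hΓ hηΓ hdec hp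
  · rintro ⟨x, η⟩ ⟨hx, hη, hsing⟩
    obtain rfl : x = 0 := hx
    by_contra hwf
    exact hsing ⟨_, hg, exists_decaysOn_of_notMem_waveFront hs0 ht huf hg hgm hψ hη hwf⟩
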